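/- **Setting.** $L^{2,1}(\mathbb R)$ is the space of $f$ with $(1+x^2)^{1/2}f\in L^2(\mathbb R)$, and $H^{1,1}(\mathbb R)$ is the space of $f\in L^{2,1}(\mathbb R)$ with weak derivative $f_x\in L^{2,1}(\mathbb R)$; intersections carry the sum of the norms. For $u\in H^{1,1}(\mathbb R)$ and $k\in\mathbb R\cup i\mathbb R$ put $$Q(x;k)=\begin{pmatrix}\frac i2|u(x)|^2& k\,u(x)\\ -k\,\overline{u(x)}&-\frac i2|u(x)|^2\end{pmatrix},$$ and let $\varphi_\pm(\cdot;k)$, $\phi_\pm(\cdot;k)$ be the bounded continuous solutions of $$\varphi_\pm(x;k)=e_1+\int_{\pm\infty}^x\begin{pmatrix}1&0\\0&e^{2i(k^2+1)(x-y)}\end{pmatrix}Q(y;k)\varphi_\pm(y;k)\,dy,$$ $$\phi_\pm(x;k)=e_2+\int_{\pm\infty}^x\begin{pmatrix}e^{-2i(k^2+1)(x-y)}&0\\0&1\end{pmatrix}Q(y;k)\phi_\pm(y;k)\,dy.$$ The scattering coefficients $a(k),b(k)$ are defined by $\varphi_-(x;k)=a(k)\varphi_+(x;k)+b(k)e^{2i(k^2+1)x}\phi_+(x;k)$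 for all $x\in\mathbb R$. Put $r(k)=b(k)/a(k)$ and, for $z=k^2\in\mathbb R$, $$r_+(z)=\frac{r(k)}{2k},\qquad r_-(z)=2k\,r(k).$$ Let also $w=-iu_x+2u-\frac12|u|^2u$ and $W=\begin{pmatrix}0&u/2\\ \bar w&0\end{pmatrix}$, with the Frobenius norm of matrices in $\|W\|_{L^1}$. **Lemma.** 1. If $u\in H^{1,1}(\mathbb R)$ and $a(k)\ne0$ for all $k\in\mathbb R$, then $r_\pm\in H^1(\mathbb R)$. 2. If $u\in H^2(\mathbb R)\cap H^{1,1}(\mathbb R)$ and $a(k)\neq0$ for all $k\in\mathbb R$, then $r_\pm\in L^{2,1}(\mathbb R)$. 3. The map $H^2(\mathbb R)\cap H^{1,1}(\mathbb R)\ni u\mapsto(r_-,r_+)\in H^1(\mathbb R)\cap L^{2,1}(\mathbb R)$ is Lipschitz continuous on bounded sets of potentials for which $a$ is bounded away from zero: for all $B$ and all $c>0$ there is $L=L(B,c)$ such that, if $u,\tilde u\in H^2\cap H^{1,1}$ have norms at most $B$ and $|a(k)|,|\tilde a(k)|\ge c$ for all $k\in\mathbb R$, then $$\|r_--\tilde r_-\|_{H^1\cap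 L^{2,1}}+\|r_+-\tilde r_+\|_{H^1\cap L^{2,1}}\le L\,\|u-\tilde u\|_{H^2\cap H^{1,1}}.$$ 4. If $u\in H^{1,1}(\mathbb R)$ satisfies the smallness condition $1-\frac12\|u\|_{L^1}e^{\|W\|_{L^1}}>0$, then $a(k)\ne0$ for all $k\in\mathbb R$. For potentials $u,\tilde u\in H^2\cap H^{1,1}$ of norm at most $B$ that satisfy this condition, the estimate of part 3 holds with a constant $L=L(B)$ depending only on $B$. -/

import Mathlib

open scoped ContDiff ComplexConjugate

noncomputable section

namespace NLSGI

open MeasureTheory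

/-! ### Function spaces on the real line -/

/-- `g` is a weak (distributional) derivative of `f` on `ℝ`. -/
def IsWeakDeriv (f g : ℝ → ℂ) : Prop :=
  LocallyIntegrable f ∧ LocallyIntegrable g ∧
    ∀ θ : ℝ → ℝ, ContDiff ℝ ∞ θ → HasCompactSupport θ →
      ∫ x, ((deriv θ x : ℝ) : ℂ) * f x = -∫ x, ((θ x : ℝ) : ℂ) * g x

/-- A representative of the weak derivative of `f`; it is unique almost everywhere, and every
notion below depends only on its class. -/
def weakDeriv (f : ℝ → ℂ) : ℝ → ℂ := Classical.epsilon (IsWeakDeriv f)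

/-- The norm of `L²(ℝ)`. -/
def l2Norm (f : ℝ → ℂ) : ℝ := (eLpNorm f 2 volume).toReal

/-- The function `x ↦ (1 + x²)^{1/2} f(x)`. -/
def weighted (f : ℝ → ℂ) : ℝ → ℂ := fun x => ((Real.sqrt (1 + x ^ 2) : ℝ) : ℂ) * f x

/-- `f ∈ L^{2,1}(ℝ)`: `(1 + x²)^{1/2} f ∈ L²(ℝ)`. -/
def MemL21 (f : ℝ → ℂ) : Prop := MemLp (weighted f) 2 volume

/-- The norm of `L^{2,1}(ℝ)`. -/
def l21Norm (f : ℝ → ℂ) : ℝ := l2Norm (weighted f)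

/-- `f ∈ H¹(ℝ)`. -/
def MemH1 (f : ℝ → ℂ) : Prop :=
  MemLp f 2 volume ∧ ∃ g, IsWeakDeriv f g ∧ MemLp g 2 volume

/-- The norm of `H¹(ℝ)`. -/
def h1Norm (f : ℝ → ℂ) : ℝ := Real.sqrt (l2Norm f ^ 2 + l2Norm (weakDeriv f) ^ 2)

/-- `f ∈ H²(ℝ)`. -/
def MemH2 (f : ℝ → ℂ) : Prop :=
  MemLp f 2 volume ∧ ∃ g h, IsWeakDeriv f g ∧ MemLp g 2 volume ∧
    IsWeakDeriv g h ∧ MemLp h 2 volume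

/-- The norm of `H²(ℝ)`. -/
def h2Norm (f : ℝ → ℂ) : ℝ :=
  Real.sqrt (l2Norm f ^ 2 + l2Norm (weakDeriv f) ^ 2 + l2Norm (weakDeriv (weakDeriv f)) ^ 2)

/-- `f ∈ H^{1,1}(ℝ)`: both `f` and its weak derivative lie in `L^{2,1}(ℝ)`. -/
def MemH11 (f : ℝ → ℂ) : Prop :=
  MemL21 f ∧ ∃ g, IsWeakDeriv f g ∧ MemL21 g

/-- The norm of `H^{1,1}(ℝ)`. -/
def h11Norm (f : ℝ → ℂ) : ℝ := Real.sqrt (l21Norm f ^ 2 + l21Norm (weakDeriv f) ^ 2)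

/-- The norm of `H²(ℝ) ∩ H^{1,1}(ℝ)`. -/
def potentialNorm (u : ℝ → ℂ) : ℝ := h2Norm u + h11Norm u

/-- The norm of `H¹(ℝ) ∩ L^{2,1}(ℝ)`. -/
def reflectionNorm (r : ℝ → ℂ) : ℝ := h1Norm r + l21Norm r

/-! ### Jost functions and scattering data

Here `k` is a complex number with `k ^ 2` real. -/

/-- The coefficient matrix `Q(y; k)` of the spectral problem. -/
def coeffMatrix (u : ℝ → ℂ) (k : ℂ) (y : ℝ) : Matrix (Fin 2) (Fin 2) ℂ :=
  !![Complex.I / 2 * ((‖u y‖ ^ 2 : ℝ) : ℂ), k * u y;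
     -k * conj (u y), -(Complex.I / 2) * ((‖u y‖ ^ 2 : ℝ) : ℂ)]

/-- The exponential `e^{2i(k²+1)s}`. -/
def phase (k : ℂ) (s : ℝ) : ℂ := Complex.exp (2 * Complex.I * (k ^ 2 + 1) * s)

/-- `f` is the bounded continuous solution `φ₋(·; k)` of the Volterra equation
normalized to `e₁` at `-∞`. -/
def IsVarphiMinus (u : ℝ → ℂ) (k : ℂ) (f : ℝ → Fin 2 → ℂ) : Prop :=
  Continuous f ∧ (∃ M : ℝ, ∀ x, ‖f x‖ ≤ M) ∧
    ∀ x, f x = ![1, 0] + ∫ y in Set.Iic x,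
      (Matrix.diagonal ![1, phase k (x - y)] * coeffMatrix u k y).mulVec (f y)

/-- `f` is the bounded continuous solution `φ₊(·; k)` of the Volterra equation
normalized to `e₁` at `+∞`. -/
def IsVarphiPlus (u : ℝ → ℂ) (k : ℂ) (f : ℝ → Fin 2 → ℂ) : Prop :=
  Continuous f ∧ (∃ M : ℝ, ∀ x, ‖f x‖ ≤ M) ∧
    ∀ x, f x = ![1, 0] - ∫ y in Set.Ioi x,
      (Matrix.diagonal ![1, phase k (x - y)] * coeffMatrix u k y).mulVec (f y)

/-- `f` is the bounded continuous solution `ϕ₊(·; k)` of the Volterra equation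
normalized to `e₂` at `+∞`. -/
def IsPhiPlus (u : ℝ → ℂ) (k : ℂ) (f : ℝ → Fin 2 → ℂ) : Prop :=
  Continuous f ∧ (∃ M : ℝ, ∀ x, ‖f x‖ ≤ M) ∧
    ∀ x, f x = ![0, 1] - ∫ y in Set.Ioi x,
      (Matrix.diagonal ![phase k (-(x - y)), 1] * coeffMatrix u k y).mulVec (f y)

/-- The Jost function `φ₋(·; k)`. -/
def varphiMinus (u : ℝ → ℂ) (k : ℂ) : ℝ → Fin 2 → ℂ := Classical.epsilon (IsVarphiMinus u k)

/-- The Jost function `φ₊(·; k)`. -/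
def varphiPlus (u : ℝ → ℂ) (k : ℂ) : ℝ → Fin 2 → ℂ := Classical.epsilon (IsVarphiPlus u k)

/-- The Jost function `ϕ₊(·; k)`. -/
def phiPlus (u : ℝ → ℂ) (k : ℂ) : ℝ → Fin 2 → ℂ := Classical.epsilon (IsPhiPlus u k)

/-- The scattering relation `φ₋ = a φ₊ + b e^{2i(k²+1)x} ϕ₊`, with `s = (a, b)`. -/
def IsScatteringPair (u : ℝ → ℂ) (k : ℂ) (s : ℂ × ℂ) : Prop :=
  ∀ x, varphiMinus u k x = s.1 • varphiPlus u k x + (s.2 * phase k x) • phiPlus u k x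

/-- The scattering coefficients `(a(k), b(k))`. -/
def scatteringPair (u : ℝ → ℂ) (k : ℂ) : ℂ × ℂ := Classical.epsilon (IsScatteringPair u k)

/-- The scattering coefficient `a(k)`. -/
def scatA (u : ℝ → ℂ) (k : ℂ) : ℂ := (scatteringPair u k).1

/-- The scattering coefficient `b(k)`. -/
def scatB (u : ℝ → ℂ) (k : ℂ) : ℂ := (scatteringPair u k).2

/-- The reflection coefficient `r(k) = b(k) / a(k)`. -/
def reflection (u : ℝ → ℂ) (k : ℂ) : ℂ := scatB u k / scatA u k

/-- `r₊(z) = r(k) / (2k)` with `k² = z`. Since `r` is odd, the choice of the root is immaterial;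
the value at the single point `z = 0` is irrelevant. -/
def rPlus (u : ℝ → ℂ) (z : ℝ) : ℂ :=
  reflection u (Complex.sqrt z) / (2 * Complex.sqrt z)

/-- `r₋(z) = 2k r(k)` with `k² = z`. -/
def rMinus (u : ℝ → ℂ) (z : ℝ) : ℂ :=
  2 * Complex.sqrt z * reflection u (Complex.sqrt z)

/-! ### The smallness condition -/

/-- `w = -i uₓ + 2u - |u|²u / 2`. -/
def wFun (u : ℝ → ℂ) (x : ℝ) : ℂ :=
  -Complex.I * weakDeriv u x + 2 * u x - 1 / 2 * ((‖u x‖ ^ 2 : ℝ) : ℂ) * u x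

/-- The `L¹` norm of the matrix `[[0, u/2], [w̄, 0]]`, with the Frobenius norm of matrices. -/
def coeffL1Norm (u : ℝ → ℂ) : ℝ := ∫ x, Real.sqrt (‖u x / 2‖ ^ 2 + ‖wFun u x‖ ^ 2)

/-- The smallness condition `1 - ½ ‖u‖_{L¹} exp ‖W‖_{L¹} > 0`. -/
def IsSmall (u : ℝ → ℂ) : Prop :=
  0 < 1 - 1 / 2 * (∫ x, ‖u x‖) * Real.exp (coeffL1Norm u)

end NLSGI

end

open NLSGI

open NLSGI
open scoped ContDiff ComplexConjugate
open MeasureTheory Set Filter Topology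

/-! The exponentials of the spectral problem depend on k only through l = k² + 1, but the matrix Q
contains k as well. Two triangular gauge transformations remove it. Replacing φ₂ by 2k φ₂ + i ū φ₁
leads to the system p₁' = f p₂, p₂' = 2il p₂ + g p₁ with f = u/2 and g = w̄. A transformation of the
opposite type, with the function i u/2 and the constant k, leads to f = -w/2 and g = -ū. These
coefficients are free of k and lie in L^{2,1} when u is in H^{1,1}. The coefficient a is the
Wronskian `scatDiag` of either system, while 2kb and b/k are the Wronskians `scatOff` of the first
and the second one (`scattering_lower`, `scattering_upper`). So r₋ and 2r₊ are quotients of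
Wronskians taken at x = 0, with l = z + 1.

The Jost functions are then estimated in the norm of L² in l. The first Picard iterate is a Fourier
transform, so Plancherel's identity bounds it by an L² tail of g, which decays like (1 + x²)^{-1/2};
Minkowski's inequality and Gronwall's lemma bound the rest (`specNorm_volt_one_le`,
`specNorm_le_of_volt`).

Regularity in l needs no differentiation. A shift of l by h is the modulation of f and g by
e^{±2ihy} (`IsJost.shift`), which moves the coefficients by at most 2|h||y| times themselves, and
the weight of L^{2,1} absorbs |y|. Hence translates in l are Lipschitz in L², and Hahn-Banach with
the Riesz theorem produces a weak derivative (`IsWeakDeriv.of_translation`). Lipschitz dependence of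
this derivative on u is an estimate of second differences, over modulation and change of potential
(`specNorm_jost_diff2_le`).

Decay in l comes from an integration by parts, which costs one derivative of g in L²: u'' for r₋,
but only u' for r₊. The boundary values at 0 cancel in the combination `scatOff` (`mul_scatOff`).

Division by a needs a lower bound for all real l, that is for real and imaginary k. For imaginary k,
|a|² - |b|² = 1 gives |a| ≥ 1. For real k, |a|² + |b|² = 1 and b is small both for large k (2kb is
bounded) and for small k (b/k is bounded); compactness covers the rest (`exists_scatDiag_ge`). Under
the smallness condition a sharp Gronwall bound gives |a - 1| ≤ ‖f‖₁(exp ‖W‖₁ - 1) with ‖f‖₁ = ½‖u‖₁,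
which yields a lower bound depending on B only (`norm_scatDiag_ge_of_bdd`). -/

/-! ### Indefinite integrals -/

/-- `F` is an indefinite integral of the locally integrable function `f`. -/
def IsPrim (F f : ℝ → ℂ) : Prop :=
  (∀ a b, IntervalIntegrable f volume a b) ∧ ∀ a b, F b - F a = ∫ x in a..b, f x

/-- An additive interval function that is of second order in a continuous monotone function
vanishes. -/
theorem additive_eq_zero {D : ℝ → ℝ → ℂ} {μ : ℝ → ℝ} {C : ℝ}
    (hadd : ∀ a b c, D a c = D a b + D b c) (hμ : Continuous μ)
    (hD : ∀ a b, a ≤ b → ‖D a b‖ ≤ C * (μ b - μ a) ^ 2) {a b : ℝ} (hab : a ≤ b) :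
    D a b = 0 := by
  have key : ∀ n : ℕ, ∀ a b, a ≤ b → ‖D a b‖ ≤ C * (μ b - μ a) ^ 2 * (1 / 2) ^ n := by
    intro n
    induction n with
    | zero => intro a b h; simpa using hD a b h
    | succ n ih =>
      intro a b h
      -- The increment of `μ` is bisected, not the interval. Each half contributes a quarter of the
      -- square, so every bisection gains a factor 1/2.
      obtain ⟨c, hc, hcm⟩ : ∃ c ∈ Icc a b, μ c = (μ a + μ b) / 2 := by
        have := intermediate_value_uIcc (a := a) (b := b) hμ.continuousOn
        have h2 : (μ a + μ b) / 2 ∈ uIcc (μ a) (μ b) := by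
          rw [mem_uIcc]
          rcases le_total (μ a) (μ b) with h | h
          · left; constructor <;> linarith
          · right; constructor <;> linarith
        obtain ⟨c, hc, e⟩ := this h2
        exact ⟨c, by rwa [uIcc_of_le h] at hc, e⟩
      rw [hadd a c b]
      refine (norm_add_le _ _).trans ?_
      have h1 := ih a c hc.1
      have h2 := ih c b hc.2
      rw [hcm] at h1 h2
      calc _ ≤ _ := add_le_add h1 h2
        _ = _ := by rw [pow_succ]; ring
  have hlim : Tendsto (fun n : ℕ => C * (μ b - μ a) ^ 2 * (1 / 2 : ℝ) ^ n) atTop (𝓝 0) := by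
    simpa using (tendsto_pow_atTop_nhds_zero_of_lt_one (by norm_num)
      (by norm_num : (1 / 2 : ℝ) < 1)).const_mul (C * (μ b - μ a) ^ 2)
  have : ‖D a b‖ ≤ 0 := ge_of_tendsto' hlim fun n => key n a b hab
  simpa using this

namespace IsPrim

variable {F G f g : ℝ → ℂ}

theorem continuous (h : IsPrim F f) : Continuous F := by
  have : F = fun x => F 0 + ∫ t in (0 : ℝ)..x, f t := by
    ext x; rw [← h.2 0 x]; ring
  rw [this]
  exact continuous_const.add (intervalIntegral.continuous_primitive h.1 0)

theorem const (c : ℂ) : IsPrim (fun _ => c) (fun _ => 0) :=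
  ⟨fun _ _ => by simp, fun _ _ => by simp⟩

theorem add (h : IsPrim F f) (h' : IsPrim G g) :
    IsPrim (fun x => F x + G x) (fun x => f x + g x) :=
  ⟨fun a b => (h.1 a b).add (h'.1 a b), fun a b => by
    rw [intervalIntegral.integral_add (h.1 a b) (h'.1 a b), ← h.2, ← h'.2]; ring⟩

theorem const_mul (h : IsPrim F f) (c : ℂ) : IsPrim (fun x => c * F x) (fun x => c * f x) :=
  ⟨fun a b => (h.1 a b).const_mul c, fun a b => by
    rw [intervalIntegral.integral_const_mul, ← h.2]; ring⟩

theorem neg (h : IsPrim F f) : IsPrim (fun x => - F x) (fun x => - f x) := by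
  simpa using h.const_mul (-1)

theorem sub (h : IsPrim F f) (h' : IsPrim G g) :
    IsPrim (fun x => F x - G x) (fun x => f x - g x) := by
  simpa [sub_eq_add_neg] using h.add h'.neg

theorem congr_ae {f' : ℝ → ℂ} (h : IsPrim F f) (e : f =ᵐ[volume] f') : IsPrim F f' :=
  ⟨fun a b => (h.1 a b).congr_ae (ae_restrict_of_ae e), fun a b => by
    rw [h.2]; exact intervalIntegral.integral_congr_ae (e.mono fun x hx _ => hx)⟩

theorem star (h : IsPrim F f) : IsPrim (fun x => conj (F x)) (fun x => conj (f x)) := by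
  refine ⟨fun a b => ?_, fun a b => ?_⟩
  · have := h.1 a b
    rw [intervalIntegrable_iff] at this ⊢
    exact (LinearIsometryEquiv.integrable_comp_iff Complex.conjLIE).2 this
  · rw [intervalIntegral.intervalIntegral_eq_integral_uIoc, integral_conj, ← map_sub, h.2,
      intervalIntegral.intervalIntegral_eq_integral_uIoc]
    split_ifs <;> simp

theorem comp_neg (h : IsPrim F f) : IsPrim (fun x => F (-x)) (fun x => - f (-x)) := by
  refine ⟨fun a b => ?_, fun a b => ?_⟩
  · have := (h.1 (-a) (-b)).comp_mul_left (c := -1)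
    simp only [neg_mul, one_mul, div_neg, div_one, neg_neg] at this
    exact this.neg
  · rw [intervalIntegral.integral_neg, intervalIntegral.integral_comp_neg, h.2,
      intervalIntegral.integral_symm]

/-- Integration by parts with derivatives that are merely integrable. The defect of the product
formula is additive over intervals and of second order in the increment of the primitive of |f| +
|g|, so it vanishes. -/
theorem mul (h : IsPrim F f) (h' : IsPrim G g) :
    IsPrim (fun x => F x * G x) (fun x => f x * G x + F x * g x) := by
  have i1 : ∀ a b, IntervalIntegrable (fun x => f x * G x) volume a b := fun a b =>
    (h.1 a b).mul_continuousOn h'.continuous.continuousOn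
  have i2 : ∀ a b, IntervalIntegrable (fun x => F x * g x) volume a b := fun a b =>
    (h'.1 a b).continuousOn_mul h.continuous.continuousOn
  have hi : ∀ a b, IntervalIntegrable (fun x => f x * G x + F x * g x) volume a b :=
    fun a b => (i1 a b).add (i2 a b)
  refine ⟨hi, ?_⟩
  set m : ℝ → ℝ := fun x => ‖f x‖ + ‖g x‖ with hm
  have im : ∀ a b, IntervalIntegrable m volume a b := fun a b => (h.1 a b).norm.add (h'.1 a b).norm
  set μ : ℝ → ℝ := fun x => ∫ t in (0 : ℝ)..x, m t with hμ
  have hμd : ∀ a b, μ b - μ a = ∫ t in a..b, m t := fun a b => by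
    rw [hμ]; exact intervalIntegral.integral_interval_sub_left (im _ _) (im _ _)
  have hm0 : ∀ x, 0 ≤ m x := fun x => by positivity
  have hmono : ∀ a b, a ≤ b → μ a ≤ μ b := fun a b hab => by
    have := intervalIntegral.integral_nonneg (μ := volume) hab (fun x _ => hm0 x)
    linarith [hμd a b]
  have bF : ∀ a b, a ≤ b → ‖F b - F a‖ ≤ μ b - μ a := fun a b hab => by
    rw [h.2, hμd]
    refine (intervalIntegral.norm_integral_le_integral_norm hab).trans ?_
    exact intervalIntegral.integral_mono_on hab (h.1 a b).norm (im a b)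
      fun x _ => le_add_of_nonneg_right (norm_nonneg _)
  have bG : ∀ a b, a ≤ b → ‖G b - G a‖ ≤ μ b - μ a := fun a b hab => by
    rw [h'.2, hμd]
    refine (intervalIntegral.norm_integral_le_integral_norm hab).trans ?_
    exact intervalIntegral.integral_mono_on hab (h'.1 a b).norm (im a b)
      fun x _ => le_add_of_nonneg_left (norm_nonneg _)
  have main : ∀ a b, a ≤ b →
      F b * G b - F a * G a - ∫ x in a..b, (f x * G x + F x * g x) = 0 := by
    intro a b hab
    refine additive_eq_zero
      (D := fun a b => F b * G b - F a * G a - ∫ x in a..b, (f x * G x + F x * g x))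
      (μ := μ) (C := 1) ?_ (intervalIntegral.continuous_primitive im 0) ?_ hab
    · intro a b c
      rw [← intervalIntegral.integral_add_adjacent_intervals (hi a b) (hi b c)]; ring
    · intro a b hab
      -- In this form each term of the integrand has a factor that is an increment of F or G inside
      -- [a, b], which supplies the second power of the increment of `μ`.
      have e : F b * G b - F a * G a - ∫ x in a..b, (f x * G x + F x * g x)
          = ∫ x in a..b, (f x * (G b - G x) - (F x - F a) * g x) := by
        have e1 : F b * G b - F a * G a = (F b - F a) * G b + F a * (G b - G a) := by ring
        rw [e1, h.2 a b, h'.2 a b, ← intervalIntegral.integral_mul_const,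
          ← intervalIntegral.integral_const_mul, ← intervalIntegral.integral_add
            ((h.1 a b).mul_const _) ((h'.1 a b).const_mul _), ← intervalIntegral.integral_sub
            (((h.1 a b).mul_const _).add ((h'.1 a b).const_mul _)) (hi a b)]
        congr 1; ext x; ring
      rw [e, one_mul, sq]
      calc _ ≤ ∫ x in a..b, m x * (μ b - μ a) := by
            refine intervalIntegral.norm_integral_le_of_norm_le hab ?_ ((im a b).mul_const _)
            refine Eventually.of_forall fun x hx => ?_
            have h1 := bG x b hx.2
            have h2 := bF a x hx.1.le
            have h3 := hmono a x hx.1.le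
            have h4 := hmono x b hx.2
            calc _ ≤ ‖f x‖ * ‖G b - G x‖ + ‖F x - F a‖ * ‖g x‖ := by
                  refine (norm_sub_le _ _).trans ?_
                  rw [norm_mul, norm_mul]
              _ ≤ ‖f x‖ * (μ b - μ a) + (μ b - μ a) * ‖g x‖ := by gcongr <;> linarith
              _ = _ := by rw [hm]; ring
        _ = _ := by rw [intervalIntegral.integral_mul_const, hμd]
  intro a b
  rcases le_total a b with hab | hab
  · exact sub_eq_zero.1 (main a b hab)
  · rw [intervalIntegral.integral_symm, ← sub_eq_zero.1 (main b a hab)]; ring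

theorem of_deriv (hF : ∀ x, HasDerivAt F (f x) x) (hf : Continuous f) : IsPrim F f :=
  ⟨fun a b => hf.intervalIntegrable a b, fun a b =>
    (intervalIntegral.integral_eq_sub_of_hasDerivAt (fun x _ => hF x)
      (hf.intervalIntegrable a b)).symm⟩

theorem eq_of_zero (h : IsPrim F (fun _ => 0)) (a b : ℝ) : F a = F b := by
  have := h.2 b a; simpa [sub_eq_zero] using this

/-- An indefinite integral that vanishes at `-∞`. -/
theorem eq_integral_Iic (h : IsPrim F f) (hf : Integrable f) {c : ℂ}
    (hc : Tendsto F atBot (𝓝 c)) (x : ℝ) : F x = c + ∫ y in Iic x, f y := by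
  have h1 := intervalIntegral_tendsto_integral_Iic x hf.integrableOn tendsto_id
  have h2 : Tendsto (fun a => F x - F a) atBot (𝓝 (F x - c)) := tendsto_const_nhds.sub hc
  have := tendsto_nhds_unique (h1.congr fun a => (h.2 a x).symm) h2
  rw [this]; ring

theorem of_Iic {c : ℂ} (hf : Integrable f) (h : ∀ x, F x = c + ∫ y in Iic x, f y) :
    IsPrim F f :=
  ⟨fun a b => hf.intervalIntegrable, fun a b => by
    rw [h, h, ← intervalIntegral.integral_Iic_sub_Iic hf.integrableOn hf.integrableOn]; ring⟩

end IsPrim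

theorem tendsto_integral_Iic_atBot {E : Type*} [NormedAddCommGroup E] [NormedSpace ℝ E]
    {f : ℝ → E} (hf : Integrable f) : Tendsto (fun x => ∫ y in Iic x, f y) atBot (𝓝 0) := by
  have h1 := (intervalIntegral_tendsto_integral_Iic 0 hf.integrableOn tendsto_id).const_sub
    (∫ y in Iic (0:ℝ), f y)
  rw [sub_self] at h1
  refine h1.congr fun x => ?_
  simp only [id]
  rw [← intervalIntegral.integral_Iic_sub_Iic hf.integrableOn hf.integrableOn]; abel

theorem tendsto_integral_Iic_atTop {E : Type*} [NormedAddCommGroup E] [NormedSpace ℝ E]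
    {f : ℝ → E} (hf : Integrable f) :
    Tendsto (fun x => ∫ y in Iic x, f y) atTop (𝓝 (∫ y, f y)) := by
  have h1 := (intervalIntegral_tendsto_integral_Ioi 0 hf.integrableOn tendsto_id).const_add
    (∫ y in Iic (0:ℝ), f y)
  rw [intervalIntegral.integral_Iic_add_Ioi hf.integrableOn hf.integrableOn] at h1
  refine h1.congr fun x => ?_
  simp only [id]
  rw [← intervalIntegral.integral_Iic_sub_Iic hf.integrableOn hf.integrableOn]; abel

/-! ### Gronwall's inequality with an integrable coefficient -/

/-- `∫_{-∞}^x m`. -/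
noncomputable def cumul (m : ℝ → ℝ) (x : ℝ) : ℝ := ∫ y in Iic x, m y

theorem cumul_nonneg {m : ℝ → ℝ} (hm0 : ∀ x, 0 ≤ m x) (x : ℝ) : 0 ≤ cumul m x :=
  integral_nonneg hm0

theorem cumul_le_integral {m : ℝ → ℝ} (hm : Integrable m) (hm0 : ∀ x, 0 ≤ m x) (x : ℝ) :
    cumul m x ≤ ∫ y, m y :=
  setIntegral_le_integral hm (Eventually.of_forall hm0)

theorem cumul_sub {m : ℝ → ℝ} (hm : Integrable m) (a b : ℝ) :
    cumul m b - cumul m a = ∫ y in a..b, m y :=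
  intervalIntegral.integral_Iic_sub_Iic hm.integrableOn hm.integrableOn

theorem cumul_mono {m : ℝ → ℝ} (hm : Integrable m) (hm0 : ∀ x, 0 ≤ m x) : Monotone (cumul m) :=
  fun a b hab => by
    have := intervalIntegral.integral_nonneg (μ := volume) hab (fun x _ => hm0 x)
    linarith [cumul_sub hm a b]

theorem continuous_cumul {m : ℝ → ℝ} (hm : Integrable m) : Continuous (cumul m) := by
  have : cumul m = fun x => cumul m 0 + ∫ y in (0 : ℝ)..x, m y := by
    ext x; rw [← cumul_sub hm]; ring
  rw [this]
  exact continuous_const.add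
    (intervalIntegral.continuous_primitive (fun _ _ => hm.intervalIntegrable) 0)

theorem integrable_mul_exp_cumul {m : ℝ → ℝ} (hm : Integrable m) (hm0 : ∀ x, 0 ≤ m x) {θ : ℝ}
    (hθ : 0 ≤ θ) : Integrable fun y => m y * Real.exp (θ * cumul m y) := by
  refine hm.mul_bdd (c := Real.exp (θ * ∫ y, m y)) ?_ ?_
  · exact (Real.continuous_exp.comp
      ((continuous_cumul hm).const_mul θ)).aestronglyMeasurable
  · refine Eventually.of_forall fun y => ?_
    rw [Real.norm_eq_abs, Real.abs_exp]
    exact Real.exp_le_exp.2 (by gcongr; exact cumul_le_integral hm hm0 y)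

/-- The chain rule for the exponential of an indefinite integral. Since `m` is only integrable, it
is again obtained from a defect that is additive and of second order. -/
theorem integral_Iic_mul_exp_cumul {m : ℝ → ℝ} (hm : Integrable m) (hm0 : ∀ x, 0 ≤ m x) {θ : ℝ}
    (hθ : 0 ≤ θ) (x : ℝ) :
    θ * ∫ y in Iic x, m y * Real.exp (θ * cumul m y) = Real.exp (θ * cumul m x) - 1 := by
  set E : ℝ → ℝ := fun y => Real.exp (θ * cumul m y) with hE
  have hint := integrable_mul_exp_cumul hm hm0 hθ
  have hEm : Monotone E := fun a b hab =>
    Real.exp_le_exp.2 (by gcongr; exact cumul_mono hm hm0 hab)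
  have hEb : ∀ x, E x ≤ Real.exp (θ * ∫ y, m y) := fun x =>
    Real.exp_le_exp.2 (by gcongr; exact cumul_le_integral hm hm0 x)
  -- The tangent inequality 1 + t ≤ eᵗ, used at both ends, encloses the increment of `E`. The
  -- integral of m E is enclosed between the same two bounds by monotonicity, so they differ by a
  -- second-order quantity.
  have hstep : ∀ a b, a ≤ b →
      E a * (θ * (cumul m b - cumul m a)) ≤ E b - E a ∧
      E b - E a ≤ E b * (θ * (cumul m b - cumul m a)) := by
    intro a b hab
    have h1 := Real.add_one_le_exp (θ * cumul m b - θ * cumul m a)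
    have h2 := Real.add_one_le_exp (θ * cumul m a - θ * cumul m b)
    have e1 : E b = E a * Real.exp (θ * cumul m b - θ * cumul m a) := by
      rw [hE]; simp only; rw [← Real.exp_add]; ring_nf
    have e2 : E a = E b * Real.exp (θ * cumul m a - θ * cumul m b) := by
      rw [hE]; simp only; rw [← Real.exp_add]; ring_nf
    have pa : 0 < E a := Real.exp_pos _
    have pb : 0 < E b := Real.exp_pos _
    constructor
    · have := mul_le_mul_of_nonneg_left h1 pa.le
      rw [← e1] at this; linarith
    · have := mul_le_mul_of_nonneg_left h2 pb.le
      rw [← e2] at this; linarith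
  have hprim : ∀ a b, a ≤ b → E b - E a - θ * ∫ y in a..b, m y * E y = 0 := by
    intro a b hab
    have := additive_eq_zero
      (D := fun a b => ((E b - E a - θ * ∫ y in a..b, m y * E y : ℝ) : ℂ)) (μ := cumul m)
      (C := θ ^ 2 * Real.exp (θ * ∫ y, m y)) ?_ (continuous_cumul hm) ?_ hab
    · exact_mod_cast this
    · intro a b c
      rw [← intervalIntegral.integral_add_adjacent_intervals (hint.intervalIntegrable (a := a)
        (b := b)) (hint.intervalIntegrable (a := b) (b := c))]
      push_cast; ring
    · intro a b hab
      rw [Complex.norm_real, Real.norm_eq_abs]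
      have hd : 0 ≤ cumul m b - cumul m a := sub_nonneg.2 (cumul_mono hm hm0 hab)
      have i1 : E a * (cumul m b - cumul m a) ≤ ∫ y in a..b, m y * E y := by
        rw [cumul_sub hm, ← intervalIntegral.integral_const_mul]
        refine intervalIntegral.integral_mono_on hab (hm.intervalIntegrable.const_mul _)
          hint.intervalIntegrable fun x hx => ?_
        rw [mul_comm]
        exact mul_le_mul_of_nonneg_left (hEm hx.1) (hm0 x)
      have i2 : ∫ y in a..b, m y * E y ≤ E b * (cumul m b - cumul m a) := by
        rw [cumul_sub hm, ← intervalIntegral.integral_const_mul]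
        refine intervalIntegral.integral_mono_on hab
          hint.intervalIntegrable (hm.intervalIntegrable.const_mul _) fun x hx => ?_
        rw [mul_comm (E b)]
        exact mul_le_mul_of_nonneg_left (hEm hx.2) (hm0 x)
      obtain ⟨s1, s2⟩ := hstep a b hab
      have j1 := mul_le_mul_of_nonneg_left i1 hθ
      have j2 := mul_le_mul_of_nonneg_left i2 hθ
      have hdiff : E b - E a ≤ Real.exp (θ * ∫ y, m y) * (θ * (cumul m b - cumul m a)) :=
        s2.trans (by gcongr; exact hEb b)
      have hk : 0 ≤ θ * (cumul m b - cumul m a) := by positivity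
      have k := mul_le_mul_of_nonneg_right hdiff hk
      rw [abs_le]
      constructor <;> nlinarith
  have hP : IsPrim (fun x => (E x : ℂ)) (fun y => ((θ * (m y * E y) : ℝ) : ℂ)) := by
    refine ⟨fun a b => (hint.const_mul θ).ofReal.intervalIntegrable, fun a b => ?_⟩
    rw [intervalIntegral.integral_ofReal, intervalIntegral.integral_const_mul]
    rcases le_total a b with hab | hab
    · have := hprim a b hab
      rw [← sub_eq_zero]; beta_reduce; exact_mod_cast this
    · have := hprim b a hab
      rw [intervalIntegral.integral_symm, ← sub_eq_zero]
      have h : E b - E a - θ * -∫ y in b..a, m y * E y = 0 := by linarith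
      beta_reduce; exact_mod_cast h
  have hl : Tendsto (fun x => (E x : ℂ)) atBot (𝓝 ((1 : ℝ) : ℂ)) := by
    refine (Complex.continuous_ofReal.tendsto _).comp ?_
    have h0 : Tendsto (cumul m) atBot (𝓝 0) := tendsto_integral_Iic_atBot hm
    have := (Real.continuous_exp.tendsto _).comp (h0.const_mul θ)
    rw [mul_zero, Real.exp_zero] at this
    exact this
  have := hP.eq_integral_Iic (hint.const_mul θ).ofReal hl x
  rw [integral_complex_ofReal, integral_const_mul] at this
  have h : E x = 1 + θ * ∫ y in Iic x, m y * E y := by exact_mod_cast this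
  change θ * ∫ y in Iic x, m y * E y = E x - 1
  linarith

theorem lintegral_Iic_mul_exp_cumul {m : ℝ → ℝ} (hm : Integrable m) (hm0 : ∀ x, 0 ≤ m x) {θ : ℝ}
    (hθ : 0 < θ) (x : ℝ) :
    ∫⁻ y in Iic x, ENNReal.ofReal (m y) * ENNReal.ofReal (Real.exp (θ * cumul m y))
      = ENNReal.ofReal ((Real.exp (θ * cumul m x) - 1) / θ) := by
  rw [← integral_Iic_mul_exp_cumul hm hm0 hθ.le, mul_div_cancel_left₀ _ hθ.ne',
    ofReal_integral_eq_lintegral_ofReal (integrable_mul_exp_cumul hm hm0 hθ.le).integrableOn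
      (Eventually.of_forall fun y => mul_nonneg (hm0 y) (Real.exp_pos _).le)]
  refine lintegral_congr fun y => ?_
  rw [ENNReal.ofReal_mul (hm0 y)]

/-- Gronwall's inequality. -/
theorem gronwall {m : ℝ → ℝ} (hm : Integrable m) (hm0 : ∀ x, 0 ≤ m x) {N : ℝ → ENNReal}
    {x₀ K M : ℝ} (hM : 0 ≤ M) (hK : ∀ x ≤ x₀, N x ≤ ENNReal.ofReal K)
    (h : ∀ x ≤ x₀, N x ≤ ENNReal.ofReal M + ∫⁻ y in Iic x, ENNReal.ofReal (m y) * N y) :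
    ∀ x ≤ x₀, N x ≤ ENNReal.ofReal (M * Real.exp (cumul m x)) := by
  have hK' : ∀ x ≤ x₀, N x ≤ ENNReal.ofReal |K| := fun x hx =>
    (hK x hx).trans (ENNReal.ofReal_le_ofReal (le_abs_self K))
  have hμ := cumul_nonneg hm0
  -- The weight exp(2 ∫ m) makes the integral operator a contraction with factor 1/2, so the a
  -- priori bound `K` is halved at every iteration. `N` need not be measurable, since it is replaced
  -- by a continuous majorant before the integral is split.
  have key : ∀ n : ℕ, ∀ x ≤ x₀, N x ≤ ENNReal.ofReal
      (M * Real.exp (cumul m x) + |K| * (1 / 2) ^ n * Real.exp (2 * cumul m x)) := by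
    intro n
    induction n with
    | zero =>
      intro x hx
      refine (hK' x hx).trans (ENNReal.ofReal_le_ofReal ?_)
      have h1 : 1 ≤ Real.exp (2 * cumul m x) := Real.one_le_exp (by linarith [hμ x])
      have h2 := mul_nonneg hM (Real.exp_pos (cumul m x)).le
      have h3 := mul_le_mul_of_nonneg_left h1 (abs_nonneg K)
      simp only [pow_zero, mul_one] at h3 ⊢
      linarith
    | succ n ih =>
      intro x hx
      refine (h x hx).trans ?_
      set c := |K| * (1 / 2 : ℝ) ^ n with hc
      have hc0 : 0 ≤ c := by positivity
      have bound : ∫⁻ y in Iic x, ENNReal.ofReal (m y) * N y ≤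
          ENNReal.ofReal M * ENNReal.ofReal ((Real.exp (1 * cumul m x) - 1) / 1) +
          ENNReal.ofReal c * ENNReal.ofReal ((Real.exp (2 * cumul m x) - 1) / 2) := by
        rw [← lintegral_Iic_mul_exp_cumul hm hm0 one_pos,
          ← lintegral_Iic_mul_exp_cumul hm hm0 two_pos, ← lintegral_const_mul' _ _ (by simp),
          ← lintegral_const_mul' _ _ (by simp), ← lintegral_add_left']
        · refine setLIntegral_mono' measurableSet_Iic fun y hy => ?_
          refine (mul_le_mul_right (ih y (le_trans hy hx)) _).trans (le_of_eq ?_)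
          rw [ENNReal.ofReal_add (by positivity) (by positivity), ENNReal.ofReal_mul hM,
            ENNReal.ofReal_mul hc0, one_mul]
          ring
        · refine AEMeasurable.const_mul ?_ _
          refine (hm.aemeasurable.ennreal_ofReal.mul ?_).restrict
          exact ((Real.continuous_exp.comp
            ((continuous_cumul hm).const_mul 1)).measurable.ennreal_ofReal).aemeasurable
      refine (add_le_add_right bound _).trans ?_
      have e1 : 1 ≤ Real.exp (cumul m x) := Real.one_le_exp (hμ x)
      have e2 : 1 ≤ Real.exp (2 * cumul m x) := Real.one_le_exp (by linarith [hμ x])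
      rw [one_mul, div_one, ← ENNReal.ofReal_mul hM, ← ENNReal.ofReal_mul hc0,
        ← ENNReal.ofReal_add (mul_nonneg hM (by linarith)) (mul_nonneg hc0 (by linarith)),
        ← ENNReal.ofReal_add hM (add_nonneg (mul_nonneg hM (by linarith))
          (mul_nonneg hc0 (by linarith)))]
      refine ENNReal.ofReal_le_ofReal ?_
      rw [pow_succ, ← mul_assoc, ← hc]
      linarith
  intro x hx
  have hl : Tendsto (fun n : ℕ => ENNReal.ofReal
      (M * Real.exp (cumul m x) + |K| * (1 / 2) ^ n * Real.exp (2 * cumul m x))) atTop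
      (𝓝 (ENNReal.ofReal (M * Real.exp (cumul m x) + |K| * 0 * Real.exp (2 * cumul m x)))) := by
    refine ENNReal.tendsto_ofReal (((tendsto_const_nhds.mul ?_).mul_const _).const_add _)
    exact tendsto_pow_atTop_nhds_zero_of_lt_one (by norm_num) (by norm_num)
  simpa using ge_of_tendsto' hl fun n => key n x hx

/-! ### Tools in `L²` -/

theorem eLpNorm_two_eq {α E : Type*} [MeasurableSpace α] {ν : Measure α} [NormedAddCommGroup E]
    (f : α → E) : eLpNorm f 2 ν = (∫⁻ x, ‖f x‖ₑ ^ 2 ∂ν) ^ (1 / 2 : ℝ) := by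
  rw [eLpNorm_eq_lintegral_rpow_enorm_toReal (by norm_num) (by norm_num)]
  norm_num

theorem eLpNorm_two_sq {α E : Type*} [MeasurableSpace α] {ν : Measure α} [NormedAddCommGroup E]
    (f : α → E) : eLpNorm f 2 ν ^ 2 = ∫⁻ x, ‖f x‖ₑ ^ 2 ∂ν := by
  rw [eLpNorm_two_eq, ← ENNReal.rpow_natCast, ← ENNReal.rpow_mul]; norm_num

theorem lintegral_mul_le_eLpNorm_two {α E F : Type*} [MeasurableSpace α] {ν : Measure α}
    [NormedAddCommGroup E] [NormedAddCommGroup F] {f : α → E} {g : α → F}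
    (hf : AEStronglyMeasurable f ν) (hg : AEStronglyMeasurable g ν) :
    ∫⁻ x, ‖f x‖ₑ * ‖g x‖ₑ ∂ν ≤ eLpNorm f 2 ν * eLpNorm g 2 ν := by
  have := ENNReal.lintegral_mul_le_Lp_mul_Lq ν (p := 2) (q := 2)
    (by constructor <;> norm_num) hf.enorm hg.enorm
  rw [eLpNorm_two_eq, eLpNorm_two_eq]
  simpa using this

/-- Minkowski's integral inequality in `L²`. -/
theorem eLpNorm_two_integral_le {α β : Type*} [MeasurableSpace α] [MeasurableSpace β]
    {μ : Measure α} {ν : Measure β} [SFinite μ] [SFinite ν] {h : α → β → ℂ}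
    (hm : StronglyMeasurable (Function.uncurry h)) :
    eLpNorm (fun l => ∫ y, h y l ∂μ) 2 ν ≤ ∫⁻ y, eLpNorm (h y) 2 ν ∂μ := by
  rw [← ENNReal.pow_le_pow_left_iff (two_ne_zero), eLpNorm_two_sq]
  have ha : Measurable fun p : α × β => ‖h p.1 p.2‖ₑ := hm.enorm
  have hy : ∀ y, Measurable fun l => ‖h y l‖ₑ := fun y => ha.comp measurable_prodMk_left
  have hl : ∀ l, Measurable fun y => ‖h y l‖ₑ := fun l => ha.comp measurable_prodMk_right
  have hN : Measurable fun y => eLpNorm (h y) 2 ν := by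
    simp_rw [eLpNorm_two_eq]
    exact ((ha.pow_const 2).lintegral_prod_right').pow_const _
  -- The square is a double integral over y and y'. After two applications of Tonelli's theorem the
  -- inner integral over l is bounded by Cauchy-Schwarz, and what remains is again a square.
  calc ∫⁻ l, ‖∫ y, h y l ∂μ‖ₑ ^ 2 ∂ν
      ≤ ∫⁻ l, (∫⁻ y, ‖h y l‖ₑ ∂μ) ^ 2 ∂ν := by
        refine lintegral_mono fun l => ?_
        gcongr
        exact enorm_integral_le_lintegral_enorm _
    _ = ∫⁻ l, ∫⁻ y, ∫⁻ y', ‖h y l‖ₑ * ‖h y' l‖ₑ ∂μ ∂μ ∂ν := by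
        refine lintegral_congr fun l => ?_
        rw [sq, ← lintegral_mul_const _ (hl l)]
        refine lintegral_congr fun y => ?_
        rw [lintegral_const_mul _ (hl l)]
    _ = ∫⁻ y, ∫⁻ l, ∫⁻ y', ‖h y l‖ₑ * ‖h y' l‖ₑ ∂μ ∂ν ∂μ := by
        refine lintegral_lintegral_swap (Measurable.aemeasurable ?_)
        have : Measurable fun p : (β × α) × α => ‖h p.1.2 p.1.1‖ₑ * ‖h p.2 p.1.1‖ₑ :=
          (ha.comp ((measurable_snd.comp measurable_fst).prodMk
            (measurable_fst.comp measurable_fst))).mul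
          (ha.comp (measurable_snd.prodMk (measurable_fst.comp measurable_fst)))
        exact this.lintegral_prod_right'
    _ = ∫⁻ y, ∫⁻ y', ∫⁻ l, ‖h y l‖ₑ * ‖h y' l‖ₑ ∂ν ∂μ ∂μ := by
        refine lintegral_congr fun y => ?_
        refine lintegral_lintegral_swap (Measurable.aemeasurable ?_)
        exact ((hy y).comp measurable_fst).mul (ha.comp (measurable_snd.prodMk measurable_fst))
    _ ≤ ∫⁻ y, ∫⁻ y', eLpNorm (h y) 2 ν * eLpNorm (h y') 2 ν ∂μ ∂μ := by
        refine lintegral_mono fun y => lintegral_mono fun y' => ?_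
        exact lintegral_mul_le_eLpNorm_two
          (hm.comp_measurable measurable_prodMk_left).aestronglyMeasurable
          (hm.comp_measurable measurable_prodMk_left).aestronglyMeasurable
    _ = _ := by
        rw [sq, ← lintegral_mul_const _ hN]
        refine lintegral_congr fun y => ?_
        rw [lintegral_const_mul _ hN]

/-- Monotone convergence over growing intervals. It lets the estimates be made for finite measures,
where bounded functions have a finite L² norm as Gronwall's inequality requires. -/
theorem eLpNorm_two_le_of_restrict {f : ℝ → ℂ} {K : ENNReal}
    (h : ∀ n : ℕ, eLpNorm f 2 (volume.restrict (Icc (-(n : ℝ)) n)) ≤ K) :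
    eLpNorm f 2 volume ≤ K := by
  rw [← ENNReal.pow_le_pow_left_iff (two_ne_zero), eLpNorm_two_sq]
  have hU : (⋃ n : ℕ, Icc (-(n : ℝ)) n) = univ := by
    refine eq_univ_of_forall fun x => mem_iUnion.2 ?_
    obtain ⟨n, hn⟩ := exists_nat_ge |x|
    exact ⟨n, abs_le.1 hn⟩
  rw [← setLIntegral_univ, ← hU, setLIntegral_iUnion_of_directed]
  · refine iSup_le fun n => ?_
    rw [← eLpNorm_two_sq]
    gcongr
    exact h n
  · refine Monotone.directed_le fun m n hmn => Icc_subset_Icc ?_ ?_ <;> simpa using hmn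

/-! ### Plancherel's identity -/

-- The transform on L² is an abstract extension, so it is compared with the integral by testing
-- against smooth compactly supported functions and moving the transform to the test function.
open FourierTransform in
theorem fourier_toLp_ae_eq {g : ℝ → ℂ} (h1 : Integrable g) (h2 : MemLp g 2) :
    (𝓕 (h2.toLp g) : Lp ℂ 2 (volume : Measure ℝ)) =ᵐ[volume] 𝓕 g := by
  have hc : Continuous (𝓕 g) := by
    exact VectorFourier.fourierIntegral_continuous Real.continuous_fourierChar
      (by exact continuous_inner) h1
  refine ae_eq_of_integral_contDiff_smul_eq ?_ hc.locallyIntegrable ?_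
  · exact (Lp.memLp _).locallyIntegrable (by norm_num)
  · intro θ hθ hθc
    have hg₁ : HasCompactSupport (Complex.ofRealCLM ∘ θ) := hθc.comp_left rfl
    have hg₂ : ContDiff ℝ ∞ (Complex.ofRealCLM ∘ θ) := by fun_prop
    set s := hg₁.toSchwartzMap hg₂ with hs
    have e1 := congrArg (fun T => T s) (Lp.fourier_toTemperedDistribution_eq (h2.toLp g))
    simp only [TemperedDistribution.fourier_apply, Lp.toTemperedDistribution_apply] at e1
    have e2 : ∀ x, s x = (θ x : ℂ) := fun x => rfl
    have e3 : ∫ x, (𝓕 s) x • (h2.toLp g) x = ∫ x, (𝓕 s) x • g x :=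
      integral_congr_ae (h2.coeFn_toLp.mono fun x hx => by simp only [hx])
    have e4 : ∫ x, (𝓕 s) x • g x = ∫ x, s x • 𝓕 g x := by
      have := VectorFourier.integral_fourierIntegral_smul_eq_flip (L := innerₗ ℝ)
        Real.continuous_fourierChar continuous_inner (f := s) (g := g) (s.integrable (μ := volume)) h1
      rw [flip_innerₗ] at this
      rw [SchwartzMap.fourier_coe]
      exact this
    rw [e3, e4] at e1
    simpa [e2] using e1.symm

open FourierTransform in
theorem eLpNorm_fourier_eq {g : ℝ → ℂ} (h1 : Integrable g) (h2 : MemLp g 2) :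
    eLpNorm (𝓕 g) 2 volume = eLpNorm g 2 volume := by
  have := Lp.norm_fourier_eq (h2.toLp g)
  rw [Lp.norm_def, Lp.norm_def, ENNReal.toReal_eq_toReal_iff' (Lp.eLpNorm_ne_top _)
    (Lp.eLpNorm_ne_top _), eLpNorm_congr_ae h2.coeFn_toLp,
    eLpNorm_congr_ae (fourier_toLp_ae_eq h1 h2)] at this
  exact this

-- Plancherel's identity in the normalization e^{-2ily}: the integral is the Fourier transform at
-- the frequency l/π.
open FourierTransform in
theorem eLpNorm_exp_integral_le {g : ℝ → ℂ} (h1 : Integrable g) (h2 : MemLp g 2) :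
    eLpNorm (fun l : ℝ => ∫ y : ℝ, Complex.exp (2 * Complex.I * (l * (-y))) * g y) 2 volume
      ≤ 2 * eLpNorm g 2 volume := by
  have e : (fun l : ℝ => ∫ y : ℝ, Complex.exp (2 * Complex.I * (l * (-y))) * g y)
      = fun l => 𝓕 g (Real.pi⁻¹ * l) := by
    ext l
    rw [Real.fourier_real_eq_integral_exp_smul]
    refine integral_congr_ae (Eventually.of_forall fun y => ?_)
    simp only [smul_eq_mul]
    congr 2
    push_cast
    field_simp
  rw [e, ← ENNReal.pow_le_pow_left_iff (two_ne_zero), eLpNorm_two_sq, mul_pow,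
    ← eLpNorm_fourier_eq h1 h2, eLpNorm_two_sq]
  have hc : Continuous (𝓕 g) := by
    exact VectorFourier.fourierIntegral_continuous Real.continuous_fourierChar
      (by exact continuous_inner) h1
  have hp : Real.pi⁻¹ ≠ 0 := inv_ne_zero Real.pi_ne_zero
  have := lintegral_map (μ := (volume : Measure ℝ)) (f := fun w => ‖𝓕 g w‖ₑ ^ 2)
    (g := fun l => Real.pi⁻¹ * l) (by fun_prop) (by fun_prop)
  rw [← this, Real.map_volume_mul_left hp, lintegral_smul_measure]
  simp only [inv_inv, smul_eq_mul]
  gcongr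
  -- The change of variables multiplies the squared norm by π, which is rounded up to 4 = 2².
  rw [abs_of_pos Real.pi_pos]
  calc ENNReal.ofReal Real.pi ≤ ENNReal.ofReal 4 := ENNReal.ofReal_le_ofReal Real.pi_le_four
    _ = 2 ^ 2 := by norm_num

/-! ### Weak derivatives -/

namespace NLSGI

/-- A functional dominated by the norm of `ι v` factors through the range of `ι` and extends by
Hahn-Banach. It serves to extend a functional on test functions to L². -/
theorem exists_clm_comp_eq {V H : Type*} [AddCommGroup V] [Module ℂ V] [NormedAddCommGroup H]
    [NormedSpace ℂ H] (ι : V →ₗ[ℂ] H) (φ : V →ₗ[ℂ] ℂ) {K : ℝ} (hK : 0 ≤ K)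
    (h : ∀ v, ‖φ v‖ ≤ K * ‖ι v‖) : ∃ ψ : H →L[ℂ] ℂ, ‖ψ‖ ≤ K ∧ ∀ v, ψ (ι v) = φ v := by
  obtain ⟨s, hs⟩ := ι.rangeRestrict.exists_rightInverse_of_surjective
    (LinearMap.range_eq_top.2 ι.surjective_rangeRestrict)
  have hs' : ∀ y : LinearMap.range ι, ι (s y) = y := fun y =>
    congrArg Subtype.val (LinearMap.congr_fun hs y)
  have hb : ∀ y : LinearMap.range ι, ‖(φ ∘ₗ s) y‖ ≤ K * ‖y‖ := fun y => by
    simpa [hs' y] using h (s y)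
  obtain ⟨ψ, h1, h2⟩ := exists_extension_norm_eq (LinearMap.range ι)
    ((φ ∘ₗ s).mkContinuous K hb)
  refine ⟨ψ, h2.trans_le (LinearMap.mkContinuous_norm_le _ hK _), fun v => ?_⟩
  have e := h1 ⟨ι v, LinearMap.mem_range_self ι v⟩
  simp only [LinearMap.mkContinuous_apply, LinearMap.comp_apply] at e
  -- The value does not depend on the linear section `s`: the difference of two preimages is killed
  -- by `ι`, hence by `φ`.
  rw [e, ← sub_eq_zero, ← map_sub, ← norm_eq_zero]
  refine le_antisymm ((h _).trans ?_) (norm_nonneg _)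
  rw [map_sub, hs']; simp

/-- Dominated convergence for backward difference quotients with step 1/(n+1). The quotients are
bounded by the Lipschitz constant, and since the step is at most 1 they vanish outside a ball of
radius R + 1. -/
theorem tendsto_integral_slope_mul {θ F : ℝ → ℂ} (hθ : ContDiff ℝ ∞ θ) (hc : HasCompactSupport θ)
    (hF : LocallyIntegrable F) :
    Tendsto (fun n : ℕ => ∫ x, (((n : ℂ) + 1) * (θ x - θ (x - 1 / ((n : ℝ) + 1)))) * F x) atTop
      (𝓝 (∫ x, deriv θ x * F x)) := by
  obtain ⟨C, hC⟩ := (hθ.continuous_deriv (by simp)).bounded_above_of_compact_support hc.deriv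
  obtain ⟨R, hR⟩ := hc.isCompact.isBounded.subset_closedBall 0
  have hd : Differentiable ℝ θ := hθ.differentiable (by simp)
  have hLip : ∀ x y, ‖θ x - θ y‖ ≤ C * ‖x - y‖ := fun x y =>
    Convex.norm_image_sub_le_of_norm_deriv_le (s := univ) (fun z _ => hd z) (fun z _ => hC z)
      convex_univ (mem_univ _) (mem_univ _)
  have hout : ∀ x, x ∉ Metric.closedBall (0 : ℝ) R → θ x = 0 := fun x hx => by
    by_contra hne
    exact hx (hR (subset_tsupport _ hne))
  refine tendsto_integral_of_dominated_convergence
    (fun x => (Metric.closedBall (0 : ℝ) (R + 1)).indicator (fun x => C * ‖F x‖) x) ?_ ?_ ?_ ?_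
  · intro n
    refine (Continuous.aestronglyMeasurable ?_).mul hF.aestronglyMeasurable
    have := hθ.continuous
    fun_prop
  · rw [integrable_indicator_iff measurableSet_closedBall]
    exact ((hF.integrableOn_isCompact (isCompact_closedBall _ _)).norm.const_mul C)
  · intro n
    refine Eventually.of_forall fun x => ?_
    have hn : (0 : ℝ) < (n : ℝ) + 1 := by positivity
    by_cases hx : x ∈ Metric.closedBall (0 : ℝ) (R + 1)
    · rw [indicator_of_mem hx, norm_mul, norm_mul]
      have := hLip x (x - 1 / ((n : ℝ) + 1))
      rw [sub_sub_cancel, Real.norm_of_nonneg (by positivity)] at this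
      have e : ‖(n : ℂ) + 1‖ = (n : ℝ) + 1 := by
        rw [← Nat.cast_succ, Complex.norm_natCast, Nat.cast_succ]
      rw [e]
      gcongr
      calc ((n : ℝ) + 1) * ‖θ x - θ (x - 1 / ((n : ℝ) + 1))‖
          ≤ ((n : ℝ) + 1) * (C * (1 / ((n : ℝ) + 1))) := by gcongr
        _ = C := by field_simp
    · rw [indicator_of_notMem hx]
      have h1 : (1 : ℝ) / ((n : ℝ) + 1) ≤ 1 := by
        rw [div_le_one hn]; linarith [(Nat.cast_nonneg n : (0 : ℝ) ≤ n)]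
      have h0 : (0 : ℝ) < 1 / ((n : ℝ) + 1) := by positivity
      have z1 : θ x = 0 := hout x fun h => hx (by
        rw [mem_closedBall_zero_iff] at h ⊢; linarith)
      have z2 : θ (x - 1 / ((n : ℝ) + 1)) = 0 := hout _ fun h => hx (by
        rw [mem_closedBall_zero_iff, Real.norm_eq_abs, abs_le] at h ⊢
        constructor <;> linarith [h.1, h.2])
      rw [z1, z2]; simp
  · refine Eventually.of_forall fun x => Tendsto.mul_const _ ?_
    have h1 : HasDerivAt θ (deriv θ x) x := (hd x).hasDerivAt
    have h2 := h1.tendsto_slope_zero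
    have h3 : Tendsto (fun n : ℕ => -(1 / ((n : ℝ) + 1))) atTop (𝓝[≠] 0) := by
      rw [tendsto_nhdsWithin_iff]
      refine ⟨by simpa using (tendsto_one_div_add_atTop_nhds_zero_nat (𝕜 := ℝ)).neg, ?_⟩
      refine Eventually.of_forall fun n => ?_
      have : (0 : ℝ) < 1 / ((n : ℝ) + 1) := by positivity
      exact (neg_neg_of_pos this).ne
    refine (h2.comp h3).congr fun n => ?_
    have hn : ((n : ℝ) + 1) ≠ 0 := by positivity
    simp only [Function.comp_apply]
    rw [inv_neg, one_div, inv_inv, neg_smul, ← smul_neg, neg_sub, ← sub_eq_add_neg,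
      Complex.real_smul]
    push_cast; rfl

/-- The difference quotient is moved from `θ` to `F` by translation invariance. Cauchy-Schwarz then
yields a factor K h, and h cancels against the quotient. -/
theorem norm_integral_deriv_mul_le {θ F : ℝ → ℂ} (hθ : ContDiff ℝ ∞ θ) (hc : HasCompactSupport θ)
    (hF : MemLp F 2) {K : ℝ} (hK0 : 0 ≤ K)
    (hK : ∀ h : ℝ, eLpNorm (fun x => F (x + h) - F x) 2 volume ≤ ENNReal.ofReal (K * |h|)) :
    ‖∫ x, deriv θ x * F x‖ ≤ K * (eLpNorm θ 2 volume).toReal := by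
  have hFl : LocallyIntegrable F := hF.locallyIntegrable (by norm_num)
  have hθ2 : MemLp θ 2 := hθ.continuous.memLp_of_hasCompactSupport hc
  refine le_of_tendsto (tendsto_integral_slope_mul hθ hc hFl).norm
    (Eventually.of_forall fun n => ?_)
  set h : ℝ := 1 / ((n : ℝ) + 1) with hh
  have hn : (0 : ℝ) < (n : ℝ) + 1 := by positivity
  have hpos : 0 < h := by positivity
  have hmp := measurePreserving_add_right (volume : Measure ℝ) h
  have hFh : MemLp (fun x => F (x + h)) 2 := hF.comp_measurePreserving hmp
  have hθh : MemLp (fun x => θ (x - h)) 2 := by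
    have := hθ2.comp_measurePreserving (measurePreserving_sub_right (volume : Measure ℝ) h)
    exact this
  have i1 : Integrable fun x => θ x * F x := hθ2.integrable_mul hF
  have i2 : Integrable fun x => θ (x - h) * F x := hθh.integrable_mul hF
  have i3 : Integrable fun x => θ x * F (x + h) := hθ2.integrable_mul hFh
  have e : ∫ x, (((n : ℂ) + 1) * (θ x - θ (x - h))) * F x
      = ((n : ℂ) + 1) * -∫ x, θ x * (F (x + h) - F x) := by
    have e1 : ∫ x, θ (x - h) * F x = ∫ x, θ x * F (x + h) := by
      rw [← integral_add_right_eq_self (fun x => θ (x - h) * F x) h]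
      simp
    calc _ = ∫ x, ((n : ℂ) + 1) * (θ x * F x - θ (x - h) * F x) := by
          congr 1; ext x; ring
      _ = ((n : ℂ) + 1) * ((∫ x, θ x * F x) - ∫ x, θ x * F (x + h)) := by
          rw [integral_const_mul, integral_sub i1 i2, e1]
      _ = _ := by
          rw [← neg_sub, ← integral_sub i3 i1]
          congr 3; ext x; ring
  rw [e, norm_mul, norm_neg]
  have en : ‖(n : ℂ) + 1‖ = (n : ℝ) + 1 := by
    rw [← Nat.cast_succ, Complex.norm_natCast, Nat.cast_succ]
  have hb : ‖∫ x, θ x * (F (x + h) - F x)‖ ≤ (eLpNorm θ 2 volume).toReal * (K * h) := by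
    have h1 : ‖∫ x, θ x * (F (x + h) - F x)‖ₑ ≤ eLpNorm θ 2 volume * ENNReal.ofReal (K * |h|) := by
      refine (enorm_integral_le_lintegral_enorm _).trans ?_
      simp_rw [enorm_mul]
      refine (lintegral_mul_le_eLpNorm_two hθ2.1 (hFh.1.sub hF.1)).trans ?_
      gcongr
      exact hK h
    rw [abs_of_pos hpos] at h1
    have h2 := ENNReal.toReal_mono (ENNReal.mul_ne_top hθ2.2.ne ENNReal.ofReal_ne_top) h1
    rwa [toReal_enorm, ENNReal.toReal_mul, ENNReal.toReal_ofReal (by positivity)] at h2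
  rw [en]
  calc _ ≤ ((n : ℝ) + 1) * ((eLpNorm θ 2 volume).toReal * (K * h)) := by gcongr
    _ = _ := by rw [hh]; field_simp

/-- The space of complex-valued test functions. -/
def testSpace : Submodule ℂ (ℝ → ℂ) where
  carrier := {θ | ContDiff ℝ ∞ θ ∧ HasCompactSupport θ}
  add_mem' h h' := ⟨h.1.add h'.1, h.2.add h'.2⟩
  zero_mem' := ⟨contDiff_const, HasCompactSupport.zero⟩
  smul_mem' c _ h := ⟨contDiff_const.smul h.1, h.2.smul_left (f := fun _ => c)⟩

theorem testSpace_memLp (θ : testSpace) : MemLp (θ : ℝ → ℂ) 2 :=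
  θ.2.1.continuous.memLp_of_hasCompactSupport θ.2.2

/-- The difference quotient characterization of H¹. The distributional derivative is bounded by K in
the L² norm of the test function, hence extends to L² and is represented by an L² function. All H¹
statements in the spectral variable rest on it. -/
theorem IsWeakDeriv.of_translation {F : ℝ → ℂ} (hF : MemLp F 2) {K : ℝ} (hK0 : 0 ≤ K)
    (hK : ∀ h : ℝ, eLpNorm (fun x => F (x + h) - F x) 2 volume ≤ ENNReal.ofReal (K * |h|)) :
    ∃ g, IsWeakDeriv F g ∧ MemLp g 2 ∧ eLpNorm g 2 volume ≤ ENNReal.ofReal K := by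
  have hFl : LocallyIntegrable F := hF.locallyIntegrable (by norm_num)
  have hint : ∀ θ : testSpace, Integrable fun x => deriv (θ : ℝ → ℂ) x * F x := fun θ =>
    ((θ.2.1.continuous_deriv (by simp)).memLp_of_hasCompactSupport (p := 2)
      θ.2.2.deriv).integrable_mul hF
  have hdiff : ∀ θ : testSpace, Differentiable ℝ (θ : ℝ → ℂ) := fun θ =>
    θ.2.1.differentiable (by simp)
  let ι : testSpace →ₗ[ℂ] Lp ℂ 2 (volume : Measure ℝ) :=
    { toFun := fun θ => (testSpace_memLp θ).toLp θ
      map_add' := fun θ η => rfl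
      map_smul' := fun c θ => rfl }
  let φ : testSpace →ₗ[ℂ] ℂ :=
    { toFun := fun θ => -∫ x, deriv (θ : ℝ → ℂ) x * F x
      map_add' := fun θ η => by
        rw [← neg_add, ← integral_add (hint θ) (hint η)]
        congr 2; ext x
        rw [← add_mul]; congr 1
        exact deriv_add (hdiff θ x) (hdiff η x)
      map_smul' := fun c θ => by
        rw [RingHom.id_apply, smul_neg, smul_eq_mul, ← integral_const_mul]
        congr 2; ext x
        rw [← mul_assoc]; congr 1
        exact deriv_const_mul c (hdiff θ x) }
  obtain ⟨ψ, hψ, hψφ⟩ := exists_clm_comp_eq ι φ hK0 fun θ => by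
    have h1 : ‖ι θ‖ = (eLpNorm (θ : ℝ → ℂ) 2 volume).toReal := Lp.norm_toLp _ (testSpace_memLp θ)
    rw [h1]
    change ‖-∫ x, deriv (θ : ℝ → ℂ) x * F x‖ ≤ _
    rw [norm_neg]
    exact norm_integral_deriv_mul_le θ.2.1 θ.2.2 hF hK0 hK
  -- The inner product is conjugate linear in its first argument, so the weak derivative is the
  -- conjugate of the Riesz representative.
  set g₀ := (InnerProductSpace.toDual ℂ (Lp ℂ 2 (volume : Measure ℝ))).symm ψ with hg₀
  have hnorm : eLpNorm (fun x => conj (g₀ x)) 2 volume = eLpNorm g₀ 2 volume :=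
    eLpNorm_congr_norm_ae (Eventually.of_forall fun x => by simp)
  have hmem : MemLp (fun x => conj (g₀ x)) 2 volume :=
    (Lp.memLp g₀).of_le (Complex.continuous_conj.comp_aestronglyMeasurable (Lp.memLp g₀).1)
      (Eventually.of_forall fun x => by simp)
  refine ⟨fun x => conj (g₀ x), ⟨hFl, hmem.locallyIntegrable (by norm_num), fun θ hθ hθc => ?_⟩,
    hmem, ?_⟩
  · have hg₁ : HasCompactSupport (fun x => (θ x : ℂ)) := hθc.comp_left (g := Complex.ofReal) rfl
    have hg₂ : ContDiff ℝ ∞ (fun x => (θ x : ℂ)) := Complex.ofRealCLM.contDiff.comp hθ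
    set η : testSpace := ⟨fun x => (θ x : ℂ), hg₂, hg₁⟩
    have e1 : inner ℂ g₀ (ι η) = ψ (ι η) := by
      rw [hg₀, InnerProductSpace.toDual_symm_apply]
    rw [hψφ, L2.inner_def] at e1
    have e2 : φ η = -∫ x, ((deriv θ x : ℝ) : ℂ) * F x := by
      change -∫ x, deriv (fun x => (θ x : ℂ)) x * F x = _
      congr 2; ext x; congr 1
      exact ((hθ.differentiable (by simp) x).hasDerivAt.ofReal_comp).deriv
    have e3 : ∫ x, inner ℂ (g₀ x) (ι η x) = ∫ x, ((θ x : ℝ) : ℂ) * conj (g₀ x) := by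
      refine integral_congr_ae ((testSpace_memLp η).coeFn_toLp.mono fun x hx => ?_)
      have : ι η x = (θ x : ℂ) := hx
      simp [this]
    rw [e3, e2] at e1
    rw [e1, neg_neg]
  · rw [hnorm, ← ENNReal.ofReal_toReal (Lp.eLpNorm_ne_top g₀)]
    refine ENNReal.ofReal_le_ofReal ?_
    rw [← Lp.norm_def, hg₀, LinearIsometryEquiv.norm_map]
    exact hψ

/-! ### Uniqueness of weak derivatives and continuous representatives -/

theorem IsWeakDeriv.ae_eq {f g g' : ℝ → ℂ} (h : IsWeakDeriv f g) (h' : IsWeakDeriv f g') :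
    g =ᵐ[volume] g' := by
  refine ae_eq_of_integral_contDiff_smul_eq h.2.1 h'.2.1 fun θ hθ hc => ?_
  have := (h.2.2 θ hθ hc).symm.trans (h'.2.2 θ hθ hc)
  simpa [neg_inj, Complex.real_smul] using this

theorem weakDeriv_ae_eq {f g : ℝ → ℂ} (h : IsWeakDeriv f g) : weakDeriv f =ᵐ[volume] g :=
  IsWeakDeriv.ae_eq (Classical.epsilon_spec (p := IsWeakDeriv f) ⟨g, h⟩) h

theorem IsWeakDeriv.congr_ae {f f' g g' : ℝ → ℂ} (h : IsWeakDeriv f g) (hf : f =ᵐ[volume] f')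
    (hg : g =ᵐ[volume] g') : IsWeakDeriv f' g' := by
  refine ⟨h.1.congr hf, h.2.1.congr hg, fun θ hθ hc => ?_⟩
  rw [integral_congr_ae (g := fun x => ((deriv θ x : ℝ) : ℂ) * f x)
      (hf.mono fun x hx => by simp only [hx]),
    integral_congr_ae (f := fun x => ((θ x : ℝ) : ℂ) * g' x)
      (g := fun x => ((θ x : ℝ) : ℂ) * g x) (hg.mono fun x hx => by simp only [hx]),
    h.2.2 θ hθ hc]

theorem integrable_test_mul {θ : ℝ → ℝ} {f : ℝ → ℂ} (hθ : Continuous θ) (hc : HasCompactSupport θ)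
    (hf : LocallyIntegrable f) : Integrable fun x => (θ x : ℂ) * f x := by
  have := hf.integrable_smul_left_of_hasCompactSupport hθ hc
  simpa [Complex.real_smul] using this

theorem IsWeakDeriv.sub {f f' g g' : ℝ → ℂ} (h : IsWeakDeriv f g) (h' : IsWeakDeriv f' g') :
    IsWeakDeriv (fun x => f x - f' x) (fun x => g x - g' x) := by
  refine ⟨h.1.sub h'.1, h.2.1.sub h'.2.1, fun θ hθ hc => ?_⟩
  have hd := hθ.continuous_deriv (by simp)
  simp only [mul_sub]
  rw [integral_sub (integrable_test_mul hd hc.deriv h.1) (integrable_test_mul hd hc.deriv h'.1),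
    integral_sub (integrable_test_mul hθ.continuous hc h.2.1)
      (integrable_test_mul hθ.continuous hc h'.2.1), h.2.2 θ hθ hc, h'.2.2 θ hθ hc]
  ring

theorem _root_.IsPrim.isWeakDeriv {F f : ℝ → ℂ} (h : IsPrim F f) (hf : LocallyIntegrable f) :
    IsWeakDeriv F f := by
  refine ⟨h.continuous.locallyIntegrable, hf, fun θ hθ hc => ?_⟩
  have hθp : IsPrim (fun x => (θ x : ℂ)) (fun x => ((deriv θ x : ℝ) : ℂ)) :=
    IsPrim.of_deriv (fun x => ((hθ.differentiable (by simp) x).hasDerivAt.ofReal_comp))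
      (Complex.continuous_ofReal.comp (hθ.continuous_deriv (by simp)))
  have hp := hθp.mul h
  have i1 := integrable_test_mul (hθ.continuous_deriv (by simp)) hc.deriv h.continuous.locallyIntegrable
  have i2 := integrable_test_mul hθ.continuous hc hf
  obtain ⟨R, hR⟩ := hc.isCompact.isBounded.subset_closedBall 0
  have hz : ∀ x, R < |x| → (θ x : ℂ) * F x = 0 := fun x hx => by
    have : θ x = 0 := by
      by_contra hne
      have := hR (subset_tsupport _ hne)
      rw [mem_closedBall_zero_iff, Real.norm_eq_abs] at this
      linarith
    simp [this]
  have l1 : Tendsto (fun x => (θ x : ℂ) * F x) atBot (𝓝 0) := by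
    refine tendsto_const_nhds.congr' ?_
    filter_upwards [eventually_lt_atBot (-|R|)] with x hx
    exact (hz x (by have := le_abs_self R; have := neg_le_abs x; linarith)).symm
  have l2 : Tendsto (fun x => (θ x : ℂ) * F x) atTop (𝓝 0) := by
    refine tendsto_const_nhds.congr' ?_
    filter_upwards [eventually_gt_atTop |R|] with x hx
    exact (hz x (by have := le_abs_self R; have := le_abs_self x; linarith)).symm
  have e : ∀ x, (θ x : ℂ) * F x = 0 + ∫ y in Iic x, (((deriv θ y : ℝ) : ℂ) * F y + θ y * f y) :=
    fun x => hp.eq_integral_Iic (i1.add i2) l1 x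
  have l3 := tendsto_integral_Iic_atTop (i1.add i2)
  have l4 := tendsto_nhds_unique l3 (l2.congr fun x => by rw [e, zero_add]; rfl)
  have l5 : ∫ y, (((deriv θ y : ℝ) : ℂ) * F y + θ y * f y) = 0 := l4
  rw [integral_add i1 i2] at l5
  exact eq_neg_of_add_eq_zero_left l5

/-- A function with a weak derivative agrees almost everywhere with an indefinite integral of
it. -/
theorem IsWeakDeriv.exists_isPrim {f g : ℝ → ℂ} (h : IsWeakDeriv f g) :
    ∃ F, f =ᵐ[volume] F ∧ IsPrim F g := by
  have hgi : ∀ a b, IntervalIntegrable g volume a b := fun a b =>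
    (h.2.1.integrableOn_isCompact isCompact_uIcc).intervalIntegrable
  set P : ℝ → ℂ := fun x => ∫ t in (0 : ℝ)..x, g t with hP
  have hPp : IsPrim P g := ⟨hgi, fun a b => by
    rw [hP]; exact intervalIntegral.integral_interval_sub_left (hgi _ _) (hgi _ _)⟩
  have hD := h.sub (hPp.isWeakDeriv h.2.1)
  obtain ⟨b⟩ : Nonempty (ContDiffBump (0 : ℝ)) := ⟨⟨1, 2, by norm_num, by norm_num⟩⟩
  set ρ := b.normed volume with hρ
  have hρ1 : ContDiff ℝ ∞ ρ := b.contDiff_normed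
  have hρ2 : HasCompactSupport ρ := b.hasCompactSupport_normed
  have hρi : ∫ x, ρ x = 1 := b.integral_normed
  set c : ℂ := ∫ x, (ρ x : ℂ) * (f x - P x) with hc
  have hconst : (fun x => f x - P x) =ᵐ[volume] fun _ => c := by
    refine ae_eq_of_integral_contDiff_smul_eq hD.1 (locallyIntegrable_const c) fun η hη hηc => ?_
    set s : ℝ := ∫ x, η x with hs
    -- A test function of integral zero is the derivative of a test function. Subtracting a multiple
    -- of the bump `ρ` of unit mass brings `η` to this case, so a function with zero weak derivative
    -- is constant.
    set ζ : ℝ → ℝ := fun x => η x - s * ρ x with hζ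
    have hζ1 : ContDiff ℝ ∞ ζ := hη.sub (contDiff_const.mul hρ1)
    have hζ2 : HasCompactSupport ζ := hηc.sub (hρ2.mul_left)
    have hζi : Integrable ζ := hζ1.continuous.integrable_of_hasCompactSupport hζ2
    have hζ0 : ∫ x, ζ x = 0 := by
      rw [hζ, integral_sub (hη.continuous.integrable_of_hasCompactSupport hηc)
        ((hρ1.continuous.integrable_of_hasCompactSupport hρ2).const_mul s), integral_const_mul,
        hρi]; simp [hs]
    set θ : ℝ → ℝ := fun x => ∫ y in Iic x, ζ y with hθ
    have hθd : ∀ x, HasDerivAt θ (ζ x) x := fun x => by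
      have h1 : HasDerivAt (fun x => (∫ y in Iic (0:ℝ), ζ y) + ∫ y in (0 : ℝ)..x, ζ y) (ζ x) x :=
        (intervalIntegral.integral_hasDerivAt_right (hζi.intervalIntegrable)
          hζ1.continuous.stronglyMeasurable.stronglyMeasurableAtFilter
          hζ1.continuous.continuousAt).const_add _
      refine h1.congr_of_eventuallyEq (Eventually.of_forall fun x => ?_)
      simp only [hθ]
      rw [← intervalIntegral.integral_Iic_sub_Iic hζi.integrableOn hζi.integrableOn]; ring
    have hθderiv : deriv θ = ζ := funext fun x => (hθd x).deriv
    have hθ1 : ContDiff ℝ ∞ θ := by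
      rw [contDiff_infty_iff_deriv, hθderiv]
      exact ⟨fun x => (hθd x).differentiableAt, hζ1⟩
    obtain ⟨R, hR⟩ := hζ2.isCompact.isBounded.subset_closedBall 0
    have hζz : ∀ x, R < |x| → ζ x = 0 := fun x hx => by
      by_contra hne
      have := hR (subset_tsupport _ hne)
      rw [mem_closedBall_zero_iff, Real.norm_eq_abs] at this
      linarith
    have hθ2 : HasCompactSupport θ := by
      refine HasCompactSupport.intro (isCompact_closedBall (0 : ℝ) |R|) fun x hx => ?_
      rw [mem_closedBall_zero_iff, Real.norm_eq_abs, not_le] at hx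
      have hR' := le_abs_self R
      rcases le_total 0 x with h0 | h0
      · have e1 : ∫ y in Ioi x, ζ y = 0 := by
          refine setIntegral_eq_zero_of_forall_eq_zero fun y hy => hζz y ?_
          have : x < y := hy
          rw [abs_of_nonneg h0] at hx
          linarith [le_abs_self y]
        have e2 := intervalIntegral.integral_Iic_add_Ioi (b := x) hζi.integrableOn hζi.integrableOn
        rw [e1, hζ0, add_zero] at e2
        exact e2
      · refine setIntegral_eq_zero_of_forall_eq_zero fun y hy => hζz y ?_
        have : y ≤ x := hy
        rw [abs_of_nonpos h0] at hx
        linarith [neg_le_abs y]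
    have hw := hD.2.2 θ hθ1 hθ2
    rw [hθderiv] at hw
    simp only [sub_self, mul_zero, integral_zero, neg_zero] at hw
    have i1 := integrable_test_mul hη.continuous hηc hD.1
    have i2 := integrable_test_mul hρ1.continuous hρ2 hD.1
    have e : ∫ x, ((ζ x : ℝ) : ℂ) * (f x - P x) = (∫ x, (η x : ℂ) * (f x - P x)) - s * c := by
      rw [hc, ← integral_const_mul, ← integral_sub i1 (i2.const_mul _)]
      congr 1; ext x; rw [hζ]; push_cast; ring
    rw [e, sub_eq_zero] at hw
    simp only [Complex.real_smul]
    rw [hw, integral_mul_const, integral_complex_ofReal]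
  refine ⟨fun x => c + P x, hconst.mono fun x hx => ?_, ?_⟩
  · simp only at hx; rw [← hx]; ring
  · simpa using (IsPrim.const c).add hPp

end NLSGI

/-! ### Volterra systems with an oscillating kernel -/

/-- The exponential `e^{2is}`. -/
noncomputable def osc (s : ℝ) : ℂ := Complex.exp (2 * Complex.I * s)

theorem norm_osc (s : ℝ) : ‖osc s‖ = 1 := by
  have : 2 * Complex.I * (s : ℂ) = ((2 * s : ℝ) : ℂ) * Complex.I := by push_cast; ring
  rw [osc, this, Complex.norm_exp_ofReal_mul_I]

theorem osc_add (s t : ℝ) : osc (s + t) = osc s * osc t := by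
  rw [osc, osc, osc, ← Complex.exp_add]; push_cast; ring_nf

@[simp] theorem osc_zero : osc 0 = 1 := by simp [osc]

theorem osc_neg_mul (s : ℝ) : osc (-s) * osc s = 1 := by
  rw [← osc_add, neg_add_cancel, osc_zero]

@[fun_prop] theorem continuous_osc : Continuous osc := by unfold osc; fun_prop

/-- Bounded and jointly continuous functions of two real variables. -/
structure IsBC (q : ℝ → ℝ → ℂ) : Prop where
  cont : Continuous (Function.uncurry q)
  bdd : ∃ K, ∀ x l, ‖q x l‖ ≤ K

namespace IsBC

variable {p q : ℝ → ℝ → ℂ}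

theorem const (c : ℂ) : IsBC fun _ _ => c := ⟨continuous_const, ‖c‖, fun _ _ => le_rfl⟩

theorem add (hp : IsBC p) (hq : IsBC q) : IsBC fun x l => p x l + q x l := by
  obtain ⟨K, hK⟩ := hp.bdd
  obtain ⟨L, hL⟩ := hq.bdd
  exact ⟨hp.cont.add hq.cont, K + L, fun x l =>
    (norm_add_le _ _).trans (add_le_add (hK x l) (hL x l))⟩

theorem mul (hp : IsBC p) (hq : IsBC q) : IsBC fun x l => p x l * q x l := by
  obtain ⟨K, hK⟩ := hp.bdd
  obtain ⟨L, hL⟩ := hq.bdd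
  exact ⟨hp.cont.mul hq.cont, K * L, fun x l => by
    rw [norm_mul]
    exact mul_le_mul (hK x l) (hL x l) (norm_nonneg _) ((norm_nonneg _).trans (hK x l))⟩

theorem neg (hp : IsBC p) : IsBC fun x l => - p x l := by
  simpa using (IsBC.const (-1)).mul hp

theorem sub (hp : IsBC p) (hq : IsBC q) : IsBC fun x l => p x l - q x l := by
  simpa [sub_eq_add_neg] using hp.add hq.neg

theorem osc {s : ℝ → ℝ → ℝ} (hs : Continuous (Function.uncurry s)) : IsBC fun x l => osc (s x l) :=
  ⟨continuous_osc.comp hs, 1, fun _ _ => (norm_osc _).le⟩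

theorem continuous_left (hq : IsBC q) (l : ℝ) : Continuous fun x => q x l :=
  hq.cont.comp (continuous_id.prodMk continuous_const)

theorem continuous_right (hq : IsBC q) (x : ℝ) : Continuous (q x) :=
  hq.cont.comp (continuous_const.prodMk continuous_id)

theorem integrable_mul (hq : IsBC q) {c : ℝ → ℂ} (hc : Integrable c) (l : ℝ) :
    Integrable fun y => c y * q y l := by
  obtain ⟨K, hK⟩ := hq.bdd
  exact hc.mul_bdd (c := K) (hq.continuous_left l).aestronglyMeasurable
    (Eventually.of_forall fun y => hK y l)

/-- Joint continuity by dominated convergence: the indicator of (-∞, x] is discontinuous in x only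
at y = x, which is a null set. -/
theorem integral_Iic (hq : IsBC q) {c : ℝ → ℂ} (hc : Integrable c) :
    IsBC fun x l => ∫ y in Iic x, c y * q y l := by
  obtain ⟨K, hK⟩ := hq.bdd
  have hb : ∀ y l, ‖c y * q y l‖ ≤ ‖c y‖ * K := fun y l => by
    rw [norm_mul]; gcongr; exact hK y l
  refine ⟨?_, ∫ y, ‖c y‖ * K, fun x l => ?_⟩
  · have e : (Function.uncurry fun x l => ∫ y in Iic x, c y * q y l)
        = fun p : ℝ × ℝ => ∫ y, (Iic p.1).indicator (fun y => c y * q y p.2) y := by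
      ext p; rw [integral_indicator measurableSet_Iic]; rfl
    rw [e, continuous_iff_continuousAt]
    intro p
    refine continuousAt_of_dominated (bound := fun y => ‖c y‖ * K) ?_ ?_ (hc.norm.mul_const K) ?_
    · exact Eventually.of_forall fun p =>
        ((hq.integrable_mul hc p.2).aestronglyMeasurable).indicator measurableSet_Iic
    · exact Eventually.of_forall fun p => Eventually.of_forall fun y =>
        (norm_indicator_le_norm_self _ _).trans (hb y p.2)
    · have hne : ∀ᵐ y : ℝ, y ≠ p.1 := by simp [ae_iff, measure_singleton]
      filter_upwards [hne] with y hy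
      have hcont : ContinuousAt (fun p : ℝ × ℝ => c y * q y p.2) p :=
        ((continuous_const.mul (hq.continuous_right y)).comp continuous_snd).continuousAt
      rcases lt_or_gt_of_ne hy with h | h
      · refine hcont.congr ?_
        filter_upwards [continuous_fst.continuousAt.eventually (lt_mem_nhds h)] with p' hp'
        rw [indicator_of_mem (show y ∈ Iic p'.1 from le_of_lt hp')]
      · refine (continuousAt_const (y := (0 : ℂ))).congr ?_
        filter_upwards [continuous_fst.continuousAt.eventually (gt_mem_nhds h)] with p' hp'
        rw [indicator_of_notMem (show y ∉ Iic p'.1 from not_le.2 hp')]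
  · refine (norm_integral_le_of_norm_le (hc.norm.mul_const K).integrableOn
      (Eventually.of_forall fun y => hb y l)).trans ?_
    exact setIntegral_le_integral (hc.norm.mul_const K) (Eventually.of_forall fun y =>
      (norm_nonneg _).trans (hb y l))

end IsBC

/-- The Volterra operator `∫_{-∞}^x e^{2iσl(x-y)} c(y) q(y,l) dy`. -/
noncomputable def volt (σ : ℝ) (c : ℝ → ℂ) (q : ℝ → ℝ → ℂ) (x l : ℝ) : ℂ :=
  ∫ y in Iic x, osc (σ * l * (x - y)) * (c y * q y l)

/-- The phase is split so that x occurs only in an outer unimodular factor and in the limit of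
integration, the form to which `IsBC.integral_Iic` applies. -/
theorem volt_eq (σ : ℝ) (c : ℝ → ℂ) (q : ℝ → ℝ → ℂ) (x l : ℝ) :
    volt σ c q x l = osc (σ * l * x) * ∫ y in Iic x, c y * (osc (-(σ * l * y)) * q y l) := by
  rw [volt, ← integral_const_mul]
  congr 1; ext y
  rw [mul_sub, sub_eq_add_neg, osc_add]; ring

theorem volt_isBC {c : ℝ → ℂ} {q : ℝ → ℝ → ℂ} (σ : ℝ) (hc : Integrable c) (hq : IsBC q) :
    IsBC (volt σ c q) := by
  have : volt σ c q = fun x l => osc (σ * l * x) *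
      ∫ y in Iic x, c y * (osc (-(σ * l * y)) * q y l) := by
    ext x l; exact volt_eq σ c q x l
  rw [this]
  refine IsBC.mul (IsBC.osc (by unfold Function.uncurry; fun_prop)) (IsBC.integral_Iic ?_ hc)
  exact (IsBC.osc (by unfold Function.uncurry; fun_prop)).mul hq

theorem volt_integrable {c : ℝ → ℂ} {q : ℝ → ℝ → ℂ} (σ : ℝ) (hc : Integrable c) (hq : IsBC q)
    (x l : ℝ) : Integrable fun y => osc (σ * l * (x - y)) * (c y * q y l) := by
  refine (hq.integrable_mul hc l).bdd_mul (c := 1) ?_ (Eventually.of_forall fun y => ?_)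
  · exact Continuous.aestronglyMeasurable (by fun_prop)
  · rw [norm_osc]

theorem volt_sub_right {c : ℝ → ℂ} {p q : ℝ → ℝ → ℂ} (σ : ℝ) (hc : Integrable c) (hp : IsBC p)
    (hq : IsBC q) (x l : ℝ) :
    volt σ c (fun x l => p x l - q x l) x l = volt σ c p x l - volt σ c q x l := by
  rw [volt, volt, volt, ← integral_sub (volt_integrable σ hc hp x l).integrableOn
    (volt_integrable σ hc hq x l).integrableOn]
  congr 1; ext y; ring

theorem volt_sub_left {c d : ℝ → ℂ} {q : ℝ → ℝ → ℂ} (σ : ℝ) (hc : Integrable c)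
    (hd : Integrable d) (hq : IsBC q) (x l : ℝ) :
    volt σ (fun y => c y - d y) q x l = volt σ c q x l - volt σ d q x l := by
  rw [volt, volt, volt, ← integral_sub (volt_integrable σ hc hq x l).integrableOn
    (volt_integrable σ hd hq x l).integrableOn]
  congr 1; ext y; ring

theorem volt_mul_right (σ : ℝ) (c e : ℝ → ℂ) (q : ℝ → ℝ → ℂ) (x l : ℝ) :
    volt σ c (fun y l => e y * q y l) x l = volt σ (fun y => c y * e y) q x l := by
  unfold volt; congr 1; ext y; ring

/-- The square integral norm in the spectral variable. -/
noncomputable def specNorm (ν : Measure ℝ) (q : ℝ → ℝ → ℂ) (x : ℝ) : ENNReal := eLpNorm (q x) 2 ν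

/-- Minkowski's inequality, the oscillating factor having modulus one. The coefficient is replaced
by a strongly measurable version, because the kernel has to be jointly measurable. -/
theorem specNorm_volt_le {ν : Measure ℝ} [SFinite ν] {c : ℝ → ℂ} {q : ℝ → ℝ → ℂ} (σ : ℝ)
    (hc : AEStronglyMeasurable c) (hq : IsBC q) (x : ℝ) :
    specNorm ν (volt σ c q) x ≤ ∫⁻ y in Iic x, ‖c y‖ₑ * specNorm ν q y := by
  have hmk := hc.ae_eq_mk
  set c' := hc.mk c with hc'
  have hcm : StronglyMeasurable c' := hc.stronglyMeasurable_mk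
  have e : volt σ c q x = fun l => ∫ y in Iic x, osc (σ * l * (x - y)) * (c' y * q y l) := by
    ext l
    exact integral_congr_ae (ae_restrict_of_ae (hmk.mono fun y hy => by simp only [hy]))
  rw [specNorm, e]
  refine (eLpNorm_two_integral_le ?_).trans (le_of_eq ?_)
  · refine StronglyMeasurable.mul (Continuous.stronglyMeasurable ?_)
      (StronglyMeasurable.mul (hcm.comp_measurable measurable_fst) hq.cont.stronglyMeasurable)
    fun_prop
  · refine lintegral_congr_ae (ae_restrict_of_ae (hmk.mono fun y hy => ?_))
    beta_reduce
    rw [hy]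
    have : eLpNorm (fun l => osc (σ * l * (x - y)) * (c' y * q y l)) 2 ν
        = eLpNorm (fun l => c' y • q y l) 2 ν :=
      eLpNorm_congr_norm_ae (Eventually.of_forall fun l => by
        rw [norm_mul, norm_osc, one_mul, smul_eq_mul])
    rw [this]
    exact eLpNorm_const_smul (c' y) (q y) 2 ν

theorem specNorm_add_le {ν : Measure ℝ} {p q : ℝ → ℝ → ℂ} (hp : IsBC p) (hq : IsBC q) (x : ℝ) :
    specNorm ν (fun x l => p x l + q x l) x ≤ specNorm ν p x + specNorm ν q x :=
  eLpNorm_add_le (hp.continuous_right x).aestronglyMeasurable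
    (hq.continuous_right x).aestronglyMeasurable (by norm_num)

theorem specNorm_sub_le {ν : Measure ℝ} {p q : ℝ → ℝ → ℂ} (hp : IsBC p) (hq : IsBC q) (x : ℝ) :
    specNorm ν (fun x l => p x l - q x l) x ≤ specNorm ν p x + specNorm ν q x :=
  eLpNorm_sub_le (hp.continuous_right x).aestronglyMeasurable
    (hq.continuous_right x).aestronglyMeasurable (by norm_num)

/-- This supplies the a priori bound without which Gronwall's inequality says nothing. It is the
reason for working with finite measures in the spectral variable. -/
theorem specNorm_bdd {ν : Measure ℝ} [IsFiniteMeasure ν] {q : ℝ → ℝ → ℂ} (hq : IsBC q) :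
    ∃ K : ℝ, 0 ≤ K ∧ ∀ x, specNorm ν q x ≤ ENNReal.ofReal K := by
  obtain ⟨K, hK⟩ := hq.bdd
  set C := ν univ ^ (1 / 2 : ℝ) * ENNReal.ofReal K with hC
  have hfin : C ≠ ⊤ := ENNReal.mul_ne_top
    (ENNReal.rpow_ne_top_of_nonneg (by norm_num) (measure_ne_top _ _)) ENNReal.ofReal_ne_top
  refine ⟨C.toReal, ENNReal.toReal_nonneg, fun x => ?_⟩
  rw [ENNReal.ofReal_toReal hfin]
  refine (eLpNorm_le_of_ae_bound (Eventually.of_forall fun l => hK x l)).trans (le_of_eq ?_)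
  rw [hC]; norm_num

/-- The a priori estimate for Volterra systems. -/
theorem specNorm_le_of_volt {ν : Measure ℝ} [IsFiniteMeasure ν] {a b c d : ℝ → ℂ}
    (ha : Integrable a) (hb : Integrable b) (hc : Integrable c) (hd : Integrable d)
    {q₁ q₂ F₁ F₂ : ℝ → ℝ → ℂ} (h₁ : IsBC q₁) (h₂ : IsBC q₂) (hF₁ : IsBC F₁) (hF₂ : IsBC F₂)
    {x₀ M : ℝ} (hM : 0 ≤ M)
    (e₁ : ∀ x ≤ x₀, ∀ᵐ l ∂ν, q₁ x l = F₁ x l + (volt 0 a q₁ x l + volt 0 b q₂ x l))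
    (e₂ : ∀ x ≤ x₀, ∀ᵐ l ∂ν, q₂ x l = F₂ x l + (volt 1 c q₁ x l + volt 1 d q₂ x l))
    (hFM : ∀ x ≤ x₀, specNorm ν F₁ x + specNorm ν F₂ x ≤ ENNReal.ofReal M) :
    ∀ x ≤ x₀, specNorm ν q₁ x + specNorm ν q₂ x ≤ ENNReal.ofReal
      (M * Real.exp (∫ y, (‖a y‖ + ‖b y‖ + ‖c y‖ + ‖d y‖))) := by
  set m : ℝ → ℝ := fun y => ‖a y‖ + ‖b y‖ + ‖c y‖ + ‖d y‖ with hm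
  have hmi : Integrable m := ((ha.norm.add hb.norm).add hc.norm).add hd.norm
  have hm0 : ∀ y, 0 ≤ m y := fun y => by positivity
  obtain ⟨K₁, hK₁, hK₁'⟩ := specNorm_bdd (ν := ν) h₁
  obtain ⟨K₂, hK₂, hK₂'⟩ := specNorm_bdd (ν := ν) h₂
  -- Both components are estimated together, since each equation contains both of them.
  set N : ℝ → ENNReal := fun x => specNorm ν q₁ x + specNorm ν q₂ x with hN
  have hmain := gronwall hmi hm0 (N := N) (x₀ := x₀) (K := K₁ + K₂) hM
    (fun x _ => by
      rw [ENNReal.ofReal_add hK₁ hK₂]; exact add_le_add (hK₁' x) (hK₂' x)) ?_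
  · intro x hx
    refine (hmain x hx).trans (ENNReal.ofReal_le_ofReal ?_)
    gcongr
    exact cumul_le_integral hmi hm0 x
  · intro x hx
    have step : ∀ {σ : ℝ} {a b : ℝ → ℂ} {F q : ℝ → ℝ → ℂ}, Integrable a → Integrable b → IsBC F →
        (∀ᵐ l ∂ν, q x l = F x l + (volt σ a q₁ x l + volt σ b q₂ x l)) →
        specNorm ν q x ≤ specNorm ν F x + ((∫⁻ y in Iic x, ‖a y‖ₑ * specNorm ν q₁ y) +
          ∫⁻ y in Iic x, ‖b y‖ₑ * specNorm ν q₂ y) := by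
      intro σ a b F q ha hb hF e
      have e' : specNorm ν q x
          = specNorm ν (fun x l => F x l + (volt σ a q₁ x l + volt σ b q₂ x l)) x :=
        eLpNorm_congr_ae e
      rw [e']
      refine (specNorm_add_le hF ((volt_isBC σ ha h₁).add (volt_isBC σ hb h₂)) x).trans ?_
      gcongr
      refine (specNorm_add_le (volt_isBC σ ha h₁) (volt_isBC σ hb h₂) x).trans ?_
      exact add_le_add (specNorm_volt_le σ ha.1 h₁ x) (specNorm_volt_le σ hb.1 h₂ x)
    have s₁ := step ha hb hF₁ (e₁ x hx)
    have s₂ := step hc hd hF₂ (e₂ x hx)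
    have hq : ∀ {q : ℝ → ℝ → ℂ}, IsBC q → Measurable (specNorm ν q) := fun {q} hq => by
      unfold specNorm
      simp_rw [eLpNorm_two_eq]
      exact ((hq.cont.measurable.enorm.pow_const 2).lintegral_prod_right').pow_const _
    have key : (∫⁻ y in Iic x, ‖a y‖ₑ * specNorm ν q₁ y) + (∫⁻ y in Iic x, ‖b y‖ₑ * specNorm ν q₂ y)
        + ((∫⁻ y in Iic x, ‖c y‖ₑ * specNorm ν q₁ y) + ∫⁻ y in Iic x, ‖d y‖ₑ * specNorm ν q₂ y)
        ≤ ∫⁻ y in Iic x, ENNReal.ofReal (m y) * N y := by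
      have hA : ∀ {a : ℝ → ℂ} {q : ℝ → ℝ → ℂ}, Integrable a → IsBC q →
          AEMeasurable (fun y => ‖a y‖ₑ * specNorm ν q y) (volume.restrict (Iic x)) :=
        fun ha h => (ha.1.enorm.mul (hq h).aemeasurable).restrict
      have h₁₂ : AEMeasurable (fun y => ‖a y‖ₑ * specNorm ν q₁ y + ‖b y‖ₑ * specNorm ν q₂ y)
          (volume.restrict (Iic x)) := (hA ha h₁).add (hA hb h₂)
      rw [← lintegral_add_left' (hA ha h₁), ← lintegral_add_left' (hA hc h₁),
        ← lintegral_add_left' h₁₂]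
      refine lintegral_mono fun y => ?_
      have em : ENNReal.ofReal (m y) = ‖a y‖ₑ + ‖b y‖ₑ + ‖c y‖ₑ + ‖d y‖ₑ := by
        rw [hm]
        simp only
        rw [ENNReal.ofReal_add (by positivity) (by positivity), ENNReal.ofReal_add (by positivity)
          (by positivity), ENNReal.ofReal_add (by positivity) (by positivity)]
        simp only [ofReal_norm]
      rw [em, hN]
      calc _ = (‖a y‖ₑ + ‖c y‖ₑ) * specNorm ν q₁ y + (‖b y‖ₑ + ‖d y‖ₑ) * specNorm ν q₂ y := by
            ring
        _ ≤ (‖a y‖ₑ + ‖b y‖ₑ + ‖c y‖ₑ + ‖d y‖ₑ) * specNorm ν q₁ y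
            + (‖a y‖ₑ + ‖b y‖ₑ + ‖c y‖ₑ + ‖d y‖ₑ) * specNorm ν q₂ y := by
            gcongr ?_ * _ + ?_ * _
            · rw [add_assoc, add_assoc]; gcongr; rw [add_comm, add_assoc]; exact le_self_add
            · gcongr; exact le_trans le_add_self (le_add_right le_rfl)
        _ = _ := by ring
    calc N x ≤ _ := add_le_add s₁ s₂
      _ = (specNorm ν F₁ x + specNorm ν F₂ x) + _ := add_add_add_comm _ _ _ _
      _ ≤ _ := add_le_add (hFM x hx) key

/-- Bounded continuous solutions of the Volterra system with coefficients `a, b, c, d`. -/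
structure IsSol (a b c d : ℝ → ℂ) (q₁ q₂ : ℝ → ℝ → ℂ) : Prop where
  bc₁ : IsBC q₁
  bc₂ : IsBC q₂
  eq₁ : ∀ x l, q₁ x l = 1 + (volt 0 a q₁ x l + volt 0 b q₂ x l)
  eq₂ : ∀ x l, q₂ x l = volt 1 c q₁ x l + volt 1 d q₂ x l

/-- After the substitution q = e^{2μ} p with μ = ∫_{-∞}^x m, the system is a fixed point equation
whose map contracts by 1/2 in the supremum norm. So no smallness of the coefficients is needed, and
continuity in (x, l) comes with the function space. -/
theorem exists_isSol {a b c d : ℝ → ℂ} (ha : Integrable a) (hb : Integrable b)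
    (hc : Integrable c) (hd : Integrable d) : ∃ q₁ q₂, IsSol a b c d q₁ q₂ := by
  set m : ℝ → ℝ := fun y => ‖a y‖ + ‖b y‖ + ‖c y‖ + ‖d y‖ with hm
  have hmi : Integrable m := ((ha.norm.add hb.norm).add hc.norm).add hd.norm
  have hm0 : ∀ y, 0 ≤ m y := fun y => by positivity
  have hμ := continuous_cumul hmi
  set e : ℝ → ℂ := fun y => (Real.exp (2 * cumul m y) : ℂ) with he
  set w : ℝ → ℂ := fun y => (Real.exp (-(2 * cumul m y)) : ℂ) with hw
  have hec : Continuous e := by rw [he]; fun_prop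
  have hwc : Continuous w := by rw [hw]; fun_prop
  have hew : ∀ y, e y * w y = 1 := fun y => by
    rw [he, hw]; simp only; rw [← Complex.ofReal_mul, ← Real.exp_add]; simp
  have hwn : ∀ y, ‖w y‖ = Real.exp (-(2 * cumul m y)) := fun y => by
    rw [hw]; simp only; rw [Complex.norm_real, Real.norm_eq_abs, Real.abs_exp]
  have hen : ∀ y, ‖e y‖ = Real.exp (2 * cumul m y) := fun y => by
    rw [he]; simp only; rw [Complex.norm_real, Real.norm_eq_abs, Real.abs_exp]
  have hi : ∀ {a : ℝ → ℂ}, Integrable a → Integrable fun y => a y * e y := fun {a} ha => by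
    refine ha.mul_bdd (c := Real.exp (2 * ∫ y, m y)) hec.aestronglyMeasurable
      (Eventually.of_forall fun y => ?_)
    rw [hen]
    exact Real.exp_le_exp.2 (by have := cumul_le_integral hmi hm0 y; linarith)
  have hwBC : IsBC fun x _ => w x := ⟨hwc.comp continuous_fst, 1, fun x _ => by
    rw [hwn]; exact Real.exp_le_one_iff.2 (by have := cumul_nonneg hm0 x; linarith)⟩
  have heBC : IsBC fun x _ => e x := ⟨hec.comp continuous_fst, Real.exp (2 * ∫ y, m y),
    fun x _ => by
      rw [hen]; exact Real.exp_le_exp.2 (by have := cumul_le_integral hmi hm0 x; linarith)⟩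
  have bcf₁ : ∀ q : BoundedContinuousFunction (ℝ × ℝ) (ℂ × ℂ), IsBC fun x l => (q (x, l)).1 :=
    fun q => ⟨continuous_fst.comp q.continuous, ‖q‖, fun x l =>
      (norm_fst_le _).trans (q.norm_coe_le_norm _)⟩
  have bcf₂ : ∀ q : BoundedContinuousFunction (ℝ × ℝ) (ℂ × ℂ), IsBC fun x l => (q (x, l)).2 :=
    fun q => ⟨continuous_snd.comp q.continuous, ‖q‖, fun x l =>
      (norm_snd_le _).trans (q.norm_coe_le_norm _)⟩
  set T₁ : BoundedContinuousFunction (ℝ × ℝ) (ℂ × ℂ) → ℝ → ℝ → ℂ := fun q x l =>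
    w x * (1 + (volt 0 (fun y => a y * e y) (fun x l => (q (x, l)).1) x l
      + volt 0 (fun y => b y * e y) (fun x l => (q (x, l)).2) x l)) with hT₁
  set T₂ : BoundedContinuousFunction (ℝ × ℝ) (ℂ × ℂ) → ℝ → ℝ → ℂ := fun q x l =>
    w x * (volt 1 (fun y => c y * e y) (fun x l => (q (x, l)).1) x l
      + volt 1 (fun y => d y * e y) (fun x l => (q (x, l)).2) x l) with hT₂
  have hT₁' : ∀ q, IsBC (T₁ q) := fun q => hwBC.mul ((IsBC.const 1).add
    ((volt_isBC 0 (hi ha) (bcf₁ q)).add (volt_isBC 0 (hi hb) (bcf₂ q))))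
  have hT₂' : ∀ q, IsBC (T₂ q) := fun q => hwBC.mul
    ((volt_isBC 1 (hi hc) (bcf₁ q)).add (volt_isBC 1 (hi hd) (bcf₂ q)))
  have hTb : ∀ q, ∃ K, ∀ p : ℝ × ℝ, ‖(T₁ q p.1 p.2, T₂ q p.1 p.2)‖ ≤ K := fun q => by
    obtain ⟨K, hK⟩ := (hT₁' q).bdd
    obtain ⟨L, hL⟩ := (hT₂' q).bdd
    exact ⟨max K L, fun p => max_le_max (hK _ _) (hL _ _)⟩
  let T : BoundedContinuousFunction (ℝ × ℝ) (ℂ × ℂ) → BoundedContinuousFunction (ℝ × ℝ) (ℂ × ℂ) :=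
    fun q => BoundedContinuousFunction.ofNormedAddCommGroup
      (fun p => (T₁ q p.1 p.2, T₂ q p.1 p.2)) ((hT₁' q).cont.prodMk (hT₂' q).cont) _
      (hTb q).choose_spec
  have hdiff : ∀ (σ : ℝ) {a b : ℝ → ℂ} (_ : Integrable a) (_ : Integrable b)
      (_ : ∀ y, ‖a y‖ + ‖b y‖ ≤ m y) (p q : BoundedContinuousFunction (ℝ × ℝ) (ℂ × ℂ)) (x l : ℝ),
      ‖w x * ((volt σ (fun y => a y * e y) (fun x l => (p (x, l)).1) x l
        + volt σ (fun y => b y * e y) (fun x l => (p (x, l)).2) x l)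
        - (volt σ (fun y => a y * e y) (fun x l => (q (x, l)).1) x l
        + volt σ (fun y => b y * e y) (fun x l => (q (x, l)).2) x l))‖ ≤ 1 / 2 * dist p q := by
    intro σ a b ha hb hab p q x l
    have hd1 : ∀ y l, ‖(p (y, l)).1 - (q (y, l)).1‖ ≤ dist p q := fun y l => by
      rw [← dist_eq_norm]
      exact (le_max_left _ _).trans
        (BoundedContinuousFunction.dist_coe_le_dist (f := p) (g := q) (y, l))
    have hd2 : ∀ y l, ‖(p (y, l)).2 - (q (y, l)).2‖ ≤ dist p q := fun y l => by
      rw [← dist_eq_norm]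
      exact (le_max_right _ _).trans
        (BoundedContinuousFunction.dist_coe_le_dist (f := p) (g := q) (y, l))
    rw [add_sub_add_comm, ← volt_sub_right σ (hi ha) (bcf₁ p) (bcf₁ q),
      ← volt_sub_right σ (hi hb) (bcf₂ p) (bcf₂ q), volt, volt, ← integral_add
      (volt_integrable σ (hi ha) ((bcf₁ p).sub (bcf₁ q)) x l).integrableOn
      (volt_integrable σ (hi hb) ((bcf₂ p).sub (bcf₂ q)) x l).integrableOn, norm_mul, hwn]
    have hbound : ∀ y, ‖osc (σ * l * (x - y)) * (a y * e y * ((p (y, l)).1 - (q (y, l)).1))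
        + osc (σ * l * (x - y)) * (b y * e y * ((p (y, l)).2 - (q (y, l)).2))‖
        ≤ dist p q * (m y * Real.exp (2 * cumul m y)) := fun y => by
      refine (norm_add_le _ _).trans ?_
      rw [norm_mul, norm_mul, norm_mul, norm_mul, norm_mul, norm_mul, norm_osc, hen, one_mul,
        one_mul]
      calc _ ≤ ‖a y‖ * Real.exp (2 * cumul m y) * dist p q
            + ‖b y‖ * Real.exp (2 * cumul m y) * dist p q := by
            gcongr
            · exact hd1 y l
            · exact hd2 y l
        _ = dist p q * ((‖a y‖ + ‖b y‖) * Real.exp (2 * cumul m y)) := by ring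
        _ ≤ _ := by gcongr; exact hab y
    have hint := (integrable_mul_exp_cumul hmi hm0 two_pos.le).const_mul (dist p q)
    have h1 := norm_integral_le_of_norm_le (μ := volume.restrict (Iic x)) hint.integrableOn
      (Eventually.of_forall hbound)
    rw [integral_const_mul] at h1
    -- The integral of m e^{2μ} equals (e^{2μ} - 1)/2, and the outer factor e^{-2μ} leaves less than
    -- 1/2.
    have h2 := integral_Iic_mul_exp_cumul hmi hm0 two_pos.le x
    calc _ ≤ Real.exp (-(2 * cumul m x)) * (dist p q *
          ∫ y in Iic x, m y * Real.exp (2 * cumul m y)) := by gcongr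
      _ = Real.exp (-(2 * cumul m x)) * (dist p q * ((Real.exp (2 * cumul m x) - 1) / 2)) := by
          rw [← h2]; ring
      _ = 1 / 2 * dist p q * (1 - Real.exp (-(2 * cumul m x))) := by
          have : Real.exp (-(2 * cumul m x)) * Real.exp (2 * cumul m x) = 1 := by
            rw [← Real.exp_add]; simp
          linear_combination dist p q / 2 * this
      _ ≤ 1 / 2 * dist p q * 1 := by
          gcongr
          linarith [Real.exp_pos (-(2 * cumul m x))]
      _ = _ := mul_one _
  have hT : ContractingWith (1 / 2) T := by
    refine ⟨by rw [← NNReal.coe_lt_coe]; norm_num, LipschitzWith.of_dist_le_mul fun p q => ?_⟩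
    have hh : ((1 / 2 : NNReal) : ℝ) = 1 / 2 := by norm_num
    rw [hh, BoundedContinuousFunction.dist_le (by positivity)]
    rintro ⟨x, l⟩
    refine max_le ?_ ?_
    · change dist (T₁ p x l) (T₁ q x l) ≤ _
      rw [dist_eq_norm]
      have := hdiff 0 ha hb (fun y => by
        rw [hm]; simp only; linarith [norm_nonneg (c y), norm_nonneg (d y)]) p q x l
      refine (le_of_eq (congrArg norm ?_)).trans this
      simp only [hT₁]; ring
    · change dist (T₂ p x l) (T₂ q x l) ≤ _
      rw [dist_eq_norm]
      have := hdiff 1 hc hd (fun y => by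
        rw [hm]; simp only; linarith [norm_nonneg (a y), norm_nonneg (b y)]) p q x l
      refine (le_of_eq (congrArg norm ?_)).trans this
      simp only [hT₂]; ring
  set p := ContractingWith.fixedPoint T hT with hp
  have hfix : T p = p := hT.fixedPoint_isFixedPt
  have h1 : ∀ x l, (p (x, l)).1 = T₁ p x l := fun x l => by
    conv_lhs => rw [← hfix]
    rfl
  have h2 : ∀ x l, (p (x, l)).2 = T₂ p x l := fun x l => by
    conv_lhs => rw [← hfix]
    rfl
  refine ⟨fun x l => e x * (p (x, l)).1, fun x l => e x * (p (x, l)).2,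
    heBC.mul (bcf₁ p), heBC.mul (bcf₂ p), fun x l => ?_, fun x l => ?_⟩
  · rw [volt_mul_right 0 a e, volt_mul_right 0 b e, h1, hT₁, ← mul_assoc, hew, one_mul]
  · rw [volt_mul_right 1 c e, volt_mul_right 1 d e, h2, hT₂, ← mul_assoc, hew, one_mul]

/-- With a Dirac measure the L² estimates in the spectral variable become pointwise ones, so one a
priori inequality serves both purposes. -/
theorem specNorm_dirac (q : ℝ → ℝ → ℂ) (hq : IsBC q) (x l : ℝ) :
    specNorm (Measure.dirac l) q x = ‖q x l‖ₑ := by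
  rw [specNorm, eLpNorm_two_eq, lintegral_dirac', ← ENNReal.rpow_natCast, ← ENNReal.rpow_mul]
  · norm_num
  · exact ((hq.continuous_right x).measurable.enorm.pow_const 2)

/-- Uniqueness for Volterra systems at a fixed value of the spectral variable. -/
theorem volt_unique {a b c d : ℝ → ℂ} (ha : Integrable a) (hb : Integrable b)
    (hc : Integrable c) (hd : Integrable d) {p₁ p₂ q₁ q₂ : ℝ → ℝ → ℂ} (hp₁ : IsBC p₁)
    (hp₂ : IsBC p₂) (hq₁ : IsBC q₁) (hq₂ : IsBC q₂) {l : ℝ} {c₁ c₂ : ℂ}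
    (ep₁ : ∀ x, p₁ x l = c₁ + (volt 0 a p₁ x l + volt 0 b p₂ x l))
    (ep₂ : ∀ x, p₂ x l = c₂ + (volt 1 c p₁ x l + volt 1 d p₂ x l))
    (eq₁ : ∀ x, q₁ x l = c₁ + (volt 0 a q₁ x l + volt 0 b q₂ x l))
    (eq₂ : ∀ x, q₂ x l = c₂ + (volt 1 c q₁ x l + volt 1 d q₂ x l)) (x : ℝ) :
    p₁ x l = q₁ x l ∧ p₂ x l = q₂ x l := by
  -- The difference of two solutions solves the homogeneous system, so the a priori estimate applies
  -- with forcing zero, at the single point `l`.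
  have h := specNorm_le_of_volt (ν := Measure.dirac l) ha hb hc hd (hp₁.sub hq₁) (hp₂.sub hq₂)
    (IsBC.const 0) (IsBC.const 0) (x₀ := x) le_rfl ?_ ?_ ?_ x le_rfl
  · rw [zero_mul, ENNReal.ofReal_zero, nonpos_iff_eq_zero, add_eq_zero,
      specNorm_dirac _ (hp₁.sub hq₁), specNorm_dirac _ (hp₂.sub hq₂), enorm_eq_zero, enorm_eq_zero,
      sub_eq_zero, sub_eq_zero] at h
    exact h
  · intro y _
    rw [ae_dirac_eq]
    change _ = _
    rw [volt_sub_right 0 ha hp₁ hq₁, volt_sub_right 0 hb hp₂ hq₂, ep₁, eq₁]; ring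
  · intro y _
    rw [ae_dirac_eq]
    change _ = _
    rw [volt_sub_right 1 hc hp₁ hq₁, volt_sub_right 1 hd hp₂ hq₂, ep₂, eq₂]; ring
  · intro y _
    simp [specNorm]

/-! ### Weighted square integrable functions -/

/-- The weight `(1 + x²)^{-1/2}`. -/
noncomputable def invWeight (x : ℝ) : ℝ := (Real.sqrt (1 + x ^ 2))⁻¹

theorem one_le_sqrt_one_add_sq (x : ℝ) : 1 ≤ Real.sqrt (1 + x ^ 2) := by
  rw [Real.one_le_sqrt]; nlinarith [sq_nonneg x]

theorem abs_le_sqrt_one_add_sq (x : ℝ) : |x| ≤ Real.sqrt (1 + x ^ 2) :=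
  Real.abs_le_sqrt (by linarith)

theorem invWeight_pos (x : ℝ) : 0 < invWeight x :=
  inv_pos.2 (lt_of_lt_of_le one_pos (one_le_sqrt_one_add_sq x))

theorem invWeight_le_one (x : ℝ) : invWeight x ≤ 1 :=
  inv_le_one_of_one_le₀ (one_le_sqrt_one_add_sq x)

theorem continuous_invWeight : Continuous invWeight :=
  Continuous.inv₀ (by fun_prop) fun x => (lt_of_lt_of_le one_pos (one_le_sqrt_one_add_sq x)).ne'

theorem invWeight_mono {x y : ℝ} (hxy : x ≤ y) (hy : y ≤ 0) : invWeight x ≤ invWeight y := by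
  refine inv_anti₀ (lt_of_lt_of_le one_pos (one_le_sqrt_one_add_sq y)) (Real.sqrt_le_sqrt ?_)
  nlinarith

/-- The squared norm is the integral of 1/(1 + x²), equal to π and at most 4. -/
theorem eLpNorm_invWeight_le : eLpNorm invWeight 2 volume ≤ 2 := by
  rw [← ENNReal.pow_le_pow_left_iff (two_ne_zero), eLpNorm_two_sq]
  have h : ∀ x, ‖invWeight x‖ₑ ^ 2 = ENNReal.ofReal ((1 + x ^ 2)⁻¹) := fun x => by
    rw [Real.enorm_of_nonneg (invWeight_pos x).le, ← ENNReal.ofReal_pow (invWeight_pos x).le,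
      invWeight, inv_pow, Real.sq_sqrt (by positivity)]
  simp_rw [h]
  rw [← ofReal_integral_eq_lintegral_ofReal integrable_inv_one_add_sq
    (Eventually.of_forall fun x => by positivity), integral_univ_inv_one_add_sq]
  calc ENNReal.ofReal Real.pi ≤ ENNReal.ofReal 4 := ENNReal.ofReal_le_ofReal Real.pi_le_four
    _ = 2 ^ 2 := by norm_num

namespace NLSGI.MemL21

variable {f g : ℝ → ℂ}

theorem eq_invWeight_mul (f : ℝ → ℂ) : f = fun x => (invWeight x : ℂ) * weighted f x := by
  ext x
  have := (lt_of_lt_of_le one_pos (one_le_sqrt_one_add_sq x)).ne'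
  rw [weighted, ← mul_assoc, ← Complex.ofReal_mul, invWeight, inv_mul_cancel₀ this]; simp

theorem aestronglyMeasurable (h : MemL21 f) : AEStronglyMeasurable f := by
  rw [eq_invWeight_mul f]
  exact (Complex.continuous_ofReal.comp continuous_invWeight).aestronglyMeasurable.mul h.1

theorem norm_le_weighted (f : ℝ → ℂ) (x : ℝ) : ‖f x‖ ≤ ‖weighted f x‖ := by
  rw [weighted, norm_mul, Complex.norm_real, Real.norm_of_nonneg (Real.sqrt_nonneg _)]
  exact le_mul_of_one_le_left (norm_nonneg _) (one_le_sqrt_one_add_sq x)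

theorem memLp (h : MemL21 f) : MemLp f 2 :=
  h.of_le h.aestronglyMeasurable (Eventually.of_forall (norm_le_weighted f))

theorem eLpNorm_weighted (h : MemL21 f) :
    eLpNorm (weighted f) 2 volume = ENNReal.ofReal (l21Norm f) :=
  (ENNReal.ofReal_toReal h.2.ne).symm

theorem eLpNorm_le (h : MemL21 f) : eLpNorm f 2 volume ≤ ENNReal.ofReal (l21Norm f) := by
  rw [← h.eLpNorm_weighted]
  exact eLpNorm_mono (norm_le_weighted f)

/-- Cauchy-Schwarz against `invWeight`: the embedding of L^{2,1} in L¹ with constant 2. -/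
theorem lintegral_le (h : MemL21 f) : ∫⁻ x, ‖f x‖ₑ ≤ ENNReal.ofReal (2 * l21Norm f) := by
  have e : ∀ x, ‖f x‖ₑ = ‖invWeight x‖ₑ * ‖weighted f x‖ₑ := fun x => by
    conv_lhs => rw [eq_invWeight_mul f]
    rw [enorm_mul]; simp [enorm_eq_nnnorm]
  simp_rw [e]
  refine (lintegral_mul_le_eLpNorm_two continuous_invWeight.aestronglyMeasurable h.1).trans ?_
  rw [h.eLpNorm_weighted, ENNReal.ofReal_mul two_pos.le]
  gcongr
  simpa using eLpNorm_invWeight_le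

theorem integrable (h : MemL21 f) : Integrable f :=
  ⟨h.aestronglyMeasurable, lt_of_le_of_lt h.lintegral_le ENNReal.ofReal_lt_top⟩

theorem integral_norm_le (h : MemL21 f) : ∫ x, ‖f x‖ ≤ 2 * l21Norm f := by
  rw [integral_norm_eq_lintegral_enorm h.integrable.1]
  exact ENNReal.toReal_le_of_le_ofReal (mul_nonneg two_pos.le ENNReal.toReal_nonneg) h.lintegral_le

theorem sub (hf : MemL21 f) (hg : MemL21 g) : MemL21 fun x => f x - g x := by
  have : weighted (fun x => f x - g x) = fun x => weighted f x - weighted g x := by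
    ext x; simp only [weighted]; ring
  rw [MemL21, this]
  exact MemLp.sub hf hg

theorem add (hf : MemL21 f) (hg : MemL21 g) : MemL21 fun x => f x + g x := by
  have : weighted (fun x => f x + g x) = fun x => weighted f x + weighted g x := by
    ext x; simp only [weighted]; ring
  rw [MemL21, this]
  exact MemLp.add hf hg

theorem zero : MemL21 fun _ => 0 := by
  have : weighted (fun _ => 0) = fun _ => 0 := by ext x; simp [weighted]
  rw [MemL21, this]
  exact MemLp.zero

theorem of_norm_le {K : ℝ} (hg : AEStronglyMeasurable g) (hf : MemL21 f)
    (h : ∀ᵐ x, ‖g x‖ ≤ K * ‖f x‖) : MemL21 g := by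
  refine MemLp.of_le_mul (c := K) hf ?_ (h.mono fun x hx => ?_)
  · exact (Continuous.aestronglyMeasurable (by fun_prop)).mul hg
  · rw [weighted, weighted, norm_mul, norm_mul, mul_left_comm]
    gcongr

end NLSGI.MemL21

namespace NLSGI

theorem l21Norm_nonneg (f : ℝ → ℂ) : 0 ≤ l21Norm f := ENNReal.toReal_nonneg

theorem l21Norm_zero : l21Norm (fun _ => 0) = 0 := by
  have : weighted (fun _ => 0) = fun _ => 0 := by ext x; simp [weighted]
  rw [l21Norm, this, l2Norm]; simp

theorem l21Norm_le_of_norm_le {f g : ℝ → ℂ} {K : ℝ} (hK : 0 ≤ K) (hf : MemL21 f)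
    (h : ∀ᵐ x, ‖g x‖ ≤ K * ‖f x‖) : l21Norm g ≤ K * l21Norm f := by
  refine ENNReal.toReal_le_of_le_ofReal (mul_nonneg hK (l21Norm_nonneg f)) ?_
  rw [ENNReal.ofReal_mul hK, ← hf.eLpNorm_weighted]
  refine eLpNorm_le_mul_eLpNorm_of_ae_le_mul (h.mono fun x hx => ?_) 2
  rw [weighted, weighted, norm_mul, norm_mul, mul_left_comm]
  gcongr

end NLSGI

/-- The `L²` norm on the half-line `(-∞, x]`. -/
noncomputable def tail (c : ℝ → ℂ) (x : ℝ) : ENNReal := eLpNorm c 2 (volume.restrict (Iic x))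

theorem tail_mono (c : ℝ → ℂ) {x y : ℝ} (h : x ≤ y) : tail c x ≤ tail c y :=
  eLpNorm_mono_measure _ (Measure.restrict_mono (Iic_subset_Iic.2 h) le_rfl)

theorem tail_le_eLpNorm (c : ℝ → ℂ) (x : ℝ) : tail c x ≤ eLpNorm c 2 volume :=
  eLpNorm_mono_measure _ Measure.restrict_le_self

/-- To the left of x ≤ 0 the weight is at least its value at x. This is the source of all decay in
x, and the reason why estimates stop at x = 0; the right half-line is reached by reflection. -/
theorem tail_le {c : ℝ → ℂ} (hc : MemL21 c) {x : ℝ} (hx : x ≤ 0) :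
    tail c x ≤ ENNReal.ofReal (invWeight x * l21Norm c) := by
  have h : tail c x ≤ ENNReal.ofReal (invWeight x) * tail (weighted c) x := by
    refine eLpNorm_le_mul_eLpNorm_of_ae_le_mul ?_ 2
    filter_upwards [ae_restrict_mem measurableSet_Iic] with y hy
    have hy' : y ≤ x := hy
    conv_lhs => rw [MemL21.eq_invWeight_mul c]
    rw [norm_mul, Complex.norm_real, Real.norm_of_nonneg (invWeight_pos y).le]
    gcongr
    exact invWeight_mono hy' hx
  refine h.trans ?_
  rw [ENNReal.ofReal_mul (invWeight_pos x).le]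
  gcongr
  rw [← hc.eLpNorm_weighted]
  exact tail_le_eLpNorm _ _

theorem tail_zero_le {c : ℝ → ℂ} (hc : MemL21 c) : tail c 0 ≤ ENNReal.ofReal (l21Norm c) :=
  (tail_le_eLpNorm c 0).trans hc.eLpNorm_le

/-! ### Estimates of the forcing terms -/

section forcing

variable {ν : Measure ℝ} [SFinite ν] {c : ℝ → ℂ} {q : ℝ → ℝ → ℂ}

/-- If q decays like `invWeight`, Cauchy-Schwarz in y requires only an unweighted L² norm of the
coefficient. This is what remains after a modulation difference or a derivative. -/
theorem specNorm_volt_le_of_weight (σ : ℝ) (hc : AEStronglyMeasurable c) (hq : IsBC q)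
    {K D x₀ : ℝ} (hK : 0 ≤ K) (hx₀ : x₀ ≤ 0)
    (hqK : ∀ y ≤ 0, specNorm ν q y ≤ ENNReal.ofReal (K * invWeight y))
    (hcD : tail c x₀ ≤ ENNReal.ofReal D) {x : ℝ} (hx : x ≤ x₀) :
    specNorm ν (volt σ c q) x ≤ ENNReal.ofReal (2 * K * D) := by
  refine (specNorm_volt_le σ hc hq x).trans ?_
  calc ∫⁻ y in Iic x, ‖c y‖ₑ * specNorm ν q y
      ≤ ∫⁻ y in Iic x, ENNReal.ofReal K * (‖c y‖ₑ * ‖invWeight y‖ₑ) := by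
        refine setLIntegral_mono' measurableSet_Iic fun y hy => ?_
        have hy' : y ≤ 0 := le_trans hy (hx.trans hx₀)
        refine (mul_le_mul_right (hqK y hy') _).trans (le_of_eq ?_)
        rw [ENNReal.ofReal_mul hK, Real.enorm_of_nonneg (invWeight_pos y).le]; ring
    _ = ENNReal.ofReal K * ∫⁻ y in Iic x, ‖c y‖ₑ * ‖invWeight y‖ₑ :=
        lintegral_const_mul' _ _ ENNReal.ofReal_ne_top
    _ ≤ ENNReal.ofReal K * (ENNReal.ofReal D * 2) := by
        gcongr
        refine (lintegral_mul_le_eLpNorm_two hc.restrict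
          continuous_invWeight.aestronglyMeasurable).trans ?_
        gcongr
        · exact (tail_mono c hx).trans hcD
        · exact (eLpNorm_mono_measure _ Measure.restrict_le_self).trans eLpNorm_invWeight_le
    _ = _ := by
        rw [mul_assoc, ENNReal.ofReal_mul two_pos.le, ENNReal.ofReal_mul hK]
        simp only [ENNReal.ofReal_ofNat]; ring

/-- The complementary estimate: when q is only bounded in y, the coefficient has to be in L¹. -/
theorem specNorm_volt_le_of_bound (σ : ℝ) (hc : AEStronglyMeasurable c) (hq : IsBC q)
    {K D x₀ : ℝ} (hK : 0 ≤ K) (hqK : ∀ y ≤ x₀, specNorm ν q y ≤ ENNReal.ofReal K)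
    (hcD : ∫⁻ y, ‖c y‖ₑ ≤ ENNReal.ofReal D) {x : ℝ} (hx : x ≤ x₀) :
    specNorm ν (volt σ c q) x ≤ ENNReal.ofReal (K * D) := by
  refine (specNorm_volt_le σ hc hq x).trans ?_
  calc ∫⁻ y in Iic x, ‖c y‖ₑ * specNorm ν q y
      ≤ ∫⁻ y in Iic x, ENNReal.ofReal K * ‖c y‖ₑ := by
        refine setLIntegral_mono' measurableSet_Iic fun y hy => ?_
        rw [mul_comm]
        gcongr
        exact hqK y (le_trans hy hx)
    _ = ENNReal.ofReal K * ∫⁻ y in Iic x, ‖c y‖ₑ :=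
        lintegral_const_mul' _ _ ENNReal.ofReal_ne_top
    _ ≤ ENNReal.ofReal K * ENNReal.ofReal D := by
        gcongr
        exact (setLIntegral_le_lintegral _ _).trans hcD
    _ = _ := (ENNReal.ofReal_mul hK).symm

end forcing

/-- Up to a unimodular factor the first Picard iterate is the Fourier transform of a truncation of
`c`. Square integrability in l originates here, the constant 1 itself not being square integrable.
-/
theorem specNorm_volt_one_le {ν : Measure ℝ} {c : ℝ → ℂ} (hν : ν ≤ volume) (hc : Integrable c) (hc2 : MemLp c 2) {D x₀ : ℝ}
    (hcD : tail c x₀ ≤ ENNReal.ofReal D) {x : ℝ} (hx : x ≤ x₀) :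
    specNorm ν (volt 1 c fun _ _ => 1) x ≤ ENNReal.ofReal (2 * D) := by
  refine (eLpNorm_mono_measure _ hν).trans ?_
  have e : eLpNorm (volt 1 c (fun _ _ => 1) x) 2 volume = eLpNorm (fun l : ℝ =>
      ∫ y : ℝ, Complex.exp (2 * Complex.I * (l * (-y))) * (Iic x).indicator c y) 2 volume := by
    refine eLpNorm_congr_norm_ae (Eventually.of_forall fun l => ?_)
    rw [volt_eq, norm_mul, norm_osc, one_mul, ← integral_indicator measurableSet_Iic]
    congr 2; ext y
    by_cases hy : y ∈ Iic x
    · rw [indicator_of_mem hy, indicator_of_mem hy, mul_one, mul_comm, osc]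
      push_cast; ring_nf
    · rw [indicator_of_notMem hy, indicator_of_notMem hy, mul_zero]
  rw [e]
  refine (eLpNorm_exp_integral_le (hc.indicator measurableSet_Iic)
    (hc2.indicator measurableSet_Iic)).trans ?_
  rw [ENNReal.ofReal_mul two_pos.le, eLpNorm_indicator_eq_eLpNorm_restrict measurableSet_Iic]
  simp only [ENNReal.ofReal_ofNat]
  gcongr
  exact (tail_mono c hx).trans hcD

/-! ### Off-diagonal systems and their dependence on the coefficients -/

theorem volt_add_right {c : ℝ → ℂ} {p q : ℝ → ℝ → ℂ} (σ : ℝ) (hc : Integrable c) (hp : IsBC p)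
    (hq : IsBC q) (x l : ℝ) :
    volt σ c (fun x l => p x l + q x l) x l = volt σ c p x l + volt σ c q x l := by
  rw [volt, volt, volt, ← integral_add (volt_integrable σ hc hp x l).integrableOn
    (volt_integrable σ hc hq x l).integrableOn]
  congr 1; ext y; ring

/-- Bounded continuous solutions of `p₁ = 1 + ∫ f p₂`, `p₂ = ∫ e^{2il(x-y)} g p₁`. -/
structure IsJost (f g : ℝ → ℂ) (p₁ p₂ : ℝ → ℝ → ℂ) : Prop where
  bc₁ : IsBC p₁
  bc₂ : IsBC p₂
  eq₁ : ∀ x l, p₁ x l = 1 + volt 0 f p₂ x l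
  eq₂ : ∀ x l, p₂ x l = volt 1 g p₁ x l

/-- A pair of coefficients in `L^{2,1}` with norms at most `B`. -/
structure BddPair (B : ℝ) (f g : ℝ → ℂ) : Prop where
  memf : MemL21 f
  memg : MemL21 g
  lef : l21Norm f ≤ B
  leg : l21Norm g ≤ B

@[simp] theorem volt_zero_left (σ : ℝ) (q : ℝ → ℝ → ℂ) (x l : ℝ) :
    volt σ (fun _ => 0) q x l = 0 := by simp [volt]

theorem IsJost.of_isSol {f g : ℝ → ℂ} {p₁ p₂ : ℝ → ℝ → ℂ}
    (h : IsSol (fun _ => 0) f g (fun _ => 0) p₁ p₂) : IsJost f g p₁ p₂ :=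
  ⟨h.bc₁, h.bc₂, fun x l => by rw [h.eq₁ x l]; simp, fun x l => by rw [h.eq₂ x l]; simp⟩

theorem isJost_zero : IsJost (fun _ => 0) (fun _ => 0) (fun _ _ => 1) (fun _ _ => 0) :=
  ⟨IsBC.const 1, IsBC.const 0, fun x l => by simp, fun x l => by simp⟩

theorem bddPair_zero {B : ℝ} (hB : 0 ≤ B) : BddPair B (fun _ => 0) (fun _ => 0) :=
  ⟨MemL21.zero, MemL21.zero, by rwa [l21Norm_zero], by rwa [l21Norm_zero]⟩

theorem BddPair.nonneg {B : ℝ} {f g : ℝ → ℂ} (h : BddPair B f g) : 0 ≤ B :=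
  (l21Norm_nonneg f).trans h.lef

theorem IsJost.unique {f g : ℝ → ℂ} (hf : Integrable f) (hg : Integrable g)
    {p₁ p₂ q₁ q₂ : ℝ → ℝ → ℂ} (hp : IsJost f g p₁ p₂) (hq : IsJost f g q₁ q₂) (x l : ℝ) :
    p₁ x l = q₁ x l ∧ p₂ x l = q₂ x l := by
  have h0 : Integrable (fun _ : ℝ => (0 : ℂ)) := integrable_zero _ _ _
  refine volt_unique h0 hf hg h0 hp.bc₁ hp.bc₂ hq.bc₁ hq.bc₂ (c₁ := 1) (c₂ := 0) ?_ ?_ ?_ ?_ x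
  · intro x; rw [hp.eq₁]; simp
  · intro x; rw [hp.eq₂]; simp
  · intro x; rw [hq.eq₁]; simp
  · intro x; rw [hq.eq₂]; simp

/-- The exponent 4B bounds the sum of the two L¹ norms, each at most 2B. -/
theorem specNorm_le_of_offDiag {ν : Measure ℝ} [IsFiniteMeasure ν] {B : ℝ} {f g : ℝ → ℂ}
    (hfg : BddPair B f g) {q₁ q₂ F₁ F₂ : ℝ → ℝ → ℂ} (h₁ : IsBC q₁) (h₂ : IsBC q₂)
    (hF₁ : IsBC F₁) (hF₂ : IsBC F₂) {x₀ M N : ℝ} (hM : 0 ≤ M) (hN : 0 ≤ N)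
    (e₁ : ∀ x l, q₁ x l = F₁ x l + volt 0 f q₂ x l)
    (e₂ : ∀ x l, q₂ x l = F₂ x l + volt 1 g q₁ x l)
    (hFM : ∀ x ≤ x₀, specNorm ν F₁ x ≤ ENNReal.ofReal M)
    (hFN : ∀ x ≤ x₀, specNorm ν F₂ x ≤ ENNReal.ofReal N) {x : ℝ} (hx : x ≤ x₀) :
    specNorm ν q₁ x ≤ ENNReal.ofReal ((M + N) * Real.exp (4 * B)) ∧
    specNorm ν q₂ x ≤ ENNReal.ofReal ((M + N) * Real.exp (4 * B)) := by
  have h0 : Integrable (fun _ : ℝ => (0 : ℂ)) := integrable_zero _ _ _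
  have hf := hfg.memf.integrable
  have hg := hfg.memg.integrable
  have h := specNorm_le_of_volt (ν := ν) h0 hf hg h0 h₁ h₂ hF₁ hF₂ (x₀ := x₀) (add_nonneg hM hN)
    (fun x _ => Eventually.of_forall fun l => by rw [e₁]; simp)
    (fun x _ => Eventually.of_forall fun l => by rw [e₂]; simp)
    (fun x hx => by
      rw [ENNReal.ofReal_add hM hN]; exact add_le_add (hFM x hx) (hFN x hx)) x hx
  have hint : ∫ y, (‖(0 : ℂ)‖ + ‖f y‖ + ‖g y‖ + ‖(0 : ℂ)‖) ≤ 4 * B := by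
    simp only [norm_zero, zero_add, add_zero]
    rw [integral_add hf.norm hg.norm]
    linarith [hfg.memf.integral_norm_le, hfg.memg.integral_norm_le, hfg.lef, hfg.leg]
  have h' : specNorm ν q₁ x + specNorm ν q₂ x ≤ ENNReal.ofReal ((M + N) * Real.exp (4 * B)) :=
    h.trans (ENNReal.ofReal_le_ofReal (by gcongr))
  exact ⟨le_self_add.trans h', le_add_self.trans h'⟩

/-- The constant of the decay estimate for `p - e₁`. -/
noncomputable def decayConst (B : ℝ) : ℝ := 2 * B * Real.exp (4 * B)

/-- The constant of the first difference estimate. -/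
noncomputable def diffConst (B : ℝ) : ℝ := (2 + 4 * decayConst B) * Real.exp (4 * B)

theorem decayConst_nonneg {B : ℝ} (hB : 0 ≤ B) : 0 ≤ decayConst B := by
  unfold decayConst; positivity

theorem diffConst_nonneg {B : ℝ} (hB : 0 ≤ B) : 0 ≤ diffConst B := by
  have := decayConst_nonneg hB
  unfold diffConst; positivity

section

variable {ν : Measure ℝ} [IsFiniteMeasure ν] {B : ℝ}

/-- After subtraction of (1, 0) the only source is the first Picard iterate. Gronwall's inequality
is used on (-∞, x] with the same x at which the tail of `g` is taken, and the tail gives the decay.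
-/
theorem specNorm_jost_sub_one_le (hν : ν ≤ volume) {f g : ℝ → ℂ} (hfg : BddPair B f g)
    {p₁ p₂ : ℝ → ℝ → ℂ} (hp : IsJost f g p₁ p₂) {x : ℝ} (hx : x ≤ 0) :
    specNorm ν (fun x l => p₁ x l - 1) x ≤ ENNReal.ofReal (decayConst B * invWeight x) ∧
    specNorm ν p₂ x ≤ ENNReal.ofReal (decayConst B * invWeight x) := by
  have hB := hfg.nonneg
  have hw := (invWeight_pos x).le
  have hf := hfg.memf.integrable
  have hg := hfg.memg.integrable
  have hone := IsBC.const 1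
  have := specNorm_le_of_offDiag (ν := ν) hfg (hp.bc₁.sub hone) hp.bc₂ (IsBC.const 0)
    (volt_isBC 1 hg hone) (x₀ := x) (M := 0) (N := 2 * (invWeight x * B)) le_rfl (by positivity)
    (fun x l => by rw [hp.eq₁]; ring)
    (fun x l => by rw [volt_sub_right 1 hg hp.bc₁ hone, hp.eq₂]; ring)
    (fun x _ => by simp [specNorm])
    (fun y hy => specNorm_volt_one_le hν hg hfg.memg.memLp
      ((tail_le hfg.memg hx).trans (ENNReal.ofReal_le_ofReal (by gcongr; exact hfg.leg))) hy)
    le_rfl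
  have e : (0 + 2 * (invWeight x * B)) * Real.exp (4 * B) = decayConst B * invWeight x := by
    unfold decayConst; ring
  rwa [e] at this

/-- First differences. -/
theorem specNorm_jost_sub_le (hν : ν ≤ volume) {f g f' g' : ℝ → ℂ} (hfg : BddPair B f g)
    (hfg' : BddPair B f' g') {p₁ p₂ p₁' p₂' : ℝ → ℝ → ℂ} (hp : IsJost f g p₁ p₂)
    (hp' : IsJost f' g' p₁' p₂') {D x : ℝ} (hD : 0 ≤ D) (hx : x ≤ 0)
    (hf : tail (fun y => f y - f' y) x ≤ ENNReal.ofReal D)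
    (hg : tail (fun y => g y - g' y) x ≤ ENNReal.ofReal D) :
    specNorm ν (fun x l => p₁ x l - p₁' x l) x ≤ ENNReal.ofReal (diffConst B * D) ∧
    specNorm ν (fun x l => p₂ x l - p₂' x l) x ≤ ENNReal.ofReal (diffConst B * D) := by
  have hB := hfg.nonneg
  have hK := decayConst_nonneg hB
  have if1 := hfg.memf.integrable
  have ig1 := hfg.memg.integrable
  have if2 := hfg'.memf.integrable
  have ig2 := hfg'.memg.integrable
  have hone := IsBC.const 1
  have dg := (hfg.memg.sub hfg'.memg)
  -- The source (g - g') p₁ is split as (g - g') plus (g - g')(p₁ - 1): the first part is handled by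
  -- Plancherel, the second by the decay of p₁ - 1. In both cases an unweighted tail of the
  -- difference suffices.
  have b1 := volt_isBC 1 (ig1.sub ig2) hone
  have b2 := volt_isBC 1 (ig1.sub ig2) (hp.bc₁.sub hone)
  have := specNorm_le_of_offDiag (ν := ν) hfg' (hp.bc₁.sub hp'.bc₁) (hp.bc₂.sub hp'.bc₂)
    (volt_isBC 0 (if1.sub if2) hp.bc₂) (b1.add b2) (x₀ := x)
    (M := 2 * decayConst B * D) (N := 2 * D + 2 * decayConst B * D) (by positivity) (by positivity)
    (fun x l => by
      rw [volt_sub_right 0 if2 hp.bc₂ hp'.bc₂]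
      change _ = volt 0 (fun y => f y - f' y) p₂ x l + _
      rw [volt_sub_left 0 if1 if2 hp.bc₂, hp.eq₁, hp'.eq₁]; ring)
    (fun x l => by
      rw [volt_sub_right 1 ig2 hp.bc₁ hp'.bc₁, volt_sub_right 1 (ig1.sub ig2) hp.bc₁ hone]
      change _ = volt 1 (fun y => g y - g' y) _ x l + (volt 1 (fun y => g y - g' y) p₁ x l -
        volt 1 (fun y => g y - g' y) _ x l) + _
      rw [volt_sub_left 1 ig1 ig2 hp.bc₁, hp.eq₂, hp'.eq₂]; ring)
    (fun y hy => specNorm_volt_le_of_weight 0 (if1.sub if2).1 hp.bc₂ hK hx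
      (fun z hz => (specNorm_jost_sub_one_le hν hfg hp hz).2) hf hy)
    (fun y hy => by
      refine (specNorm_add_le b1 b2 y).trans ?_
      rw [ENNReal.ofReal_add (by positivity) (by positivity)]
      exact add_le_add (specNorm_volt_one_le hν (ig1.sub ig2) dg.memLp hg hy)
        (specNorm_volt_le_of_weight 1 (ig1.sub ig2).1 (hp.bc₁.sub hone) hK hx
          (fun z hz => (specNorm_jost_sub_one_le hν hfg hp hz).1) hg hy))
    le_rfl
  have e : (2 * decayConst B * D + (2 * D + 2 * decayConst B * D)) * Real.exp (4 * B)
      = diffConst B * D := by unfold diffConst; ring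
  rwa [e] at this

/-- First differences with respect to the norm of `L^{2,1}`. -/
theorem specNorm_jost_sub_le_weight (hν : ν ≤ volume) {f g f' g' : ℝ → ℂ} (hfg : BddPair B f g)
    (hfg' : BddPair B f' g') {p₁ p₂ p₁' p₂' : ℝ → ℝ → ℂ} (hp : IsJost f g p₁ p₂)
    (hp' : IsJost f' g' p₁' p₂') {η x : ℝ} (hη : 0 ≤ η) (hx : x ≤ 0)
    (hf : l21Norm (fun y => f y - f' y) ≤ η) (hg : l21Norm (fun y => g y - g' y) ≤ η) :
    specNorm ν (fun x l => p₁ x l - p₁' x l) x ≤ ENNReal.ofReal (diffConst B * η * invWeight x) ∧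
    specNorm ν (fun x l => p₂ x l - p₂' x l) x ≤ ENNReal.ofReal (diffConst B * η * invWeight x) := by
  have hw := (invWeight_pos x).le
  have := specNorm_jost_sub_le hν hfg hfg' hp hp' (D := invWeight x * η) (by positivity) hx
    ((tail_le (hfg.memf.sub hfg'.memf) hx).trans (ENNReal.ofReal_le_ofReal (by gcongr)))
    ((tail_le (hfg.memg.sub hfg'.memg) hx).trans (ENNReal.ofReal_le_ofReal (by gcongr)))
  rwa [mul_comm (invWeight x), ← mul_assoc] at this

/-- The constant of the second difference estimate. -/
noncomputable def diff2Const (B : ℝ) : ℝ :=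
  (2 + 12 * decayConst B + 8 * diffConst B) * Real.exp (4 * B)

theorem diff2Const_nonneg {B : ℝ} (hB : 0 ≤ B) : 0 ≤ diff2Const B := by
  have := decayConst_nonneg hB
  have := diffConst_nonneg hB
  unfold diff2Const; positivity

/-- Second differences. -/
theorem specNorm_jost_diff2_le (hν : ν ≤ volume) {f g f₁ g₁ f₂ g₂ f₃ g₃ : ℝ → ℂ}
    (h : BddPair B f g) (h₁ : BddPair B f₁ g₁) (h₂ : BddPair B f₂ g₂) (h₃ : BddPair B f₃ g₃)
    {p q r s p' q' r' s' : ℝ → ℝ → ℂ} (hp : IsJost f g p p') (hq : IsJost f₁ g₁ q q')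
    (hr : IsJost f₂ g₂ r r') (hs : IsJost f₃ g₃ s s') {η δ ε : ℝ} (hη : 0 ≤ η) (hδ : 0 ≤ δ)
    (hε : 0 ≤ ε)
    (hf₁ : tail (fun y => f₁ y - f y) 0 ≤ ENNReal.ofReal η)
    (hg₁ : tail (fun y => g₁ y - g y) 0 ≤ ENNReal.ofReal η)
    (hf₂ : l21Norm (fun y => f₂ y - f y) ≤ δ) (hg₂ : l21Norm (fun y => g₂ y - g y) ≤ δ)
    (hf₃ : tail (fun y => (f₃ y - f₁ y) - (f₂ y - f y)) 0 ≤ ENNReal.ofReal ε)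
    (hg₃ : tail (fun y => (g₃ y - g₁ y) - (g₂ y - g y)) 0 ≤ ENNReal.ofReal ε) :
    specNorm ν (fun x l => (s x l - q x l) - (r x l - p x l)) 0
      ≤ ENNReal.ofReal (diff2Const B * (ε + η * δ)) ∧
    specNorm ν (fun x l => (s' x l - q' x l) - (r' x l - p' x l)) 0
      ≤ ENNReal.ofReal (diff2Const B * (ε + η * δ)) := by
  have hB := h.nonneg
  have hK := decayConst_nonneg hB
  have hC := diffConst_nonneg hB
  have hone := IsBC.const 1
  set K := decayConst B with hKdef
  set C := diffConst B with hCdef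
  have If := h.memf.integrable
  have Ig := h.memg.integrable
  have If₁ := h₁.memf.integrable
  have Ig₁ := h₁.memg.integrable
  have If₂ := h₂.memf.integrable
  have Ig₂ := h₂.memg.integrable
  have If₃ := h₃.memf.integrable
  have Ig₃ := h₃.memg.integrable
  have mg := ((h₃.memg.sub h₁.memg).sub (h₂.memg.sub h.memg)).memLp
  have decay : ∀ {f g : ℝ → ℂ} {p p' : ℝ → ℝ → ℂ}, BddPair B f g → IsJost f g p p' → ∀ y ≤ 0,
      specNorm ν (fun x l => p x l - 1) y ≤ ENNReal.ofReal (K * invWeight y) ∧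
      specNorm ν p' y ≤ ENNReal.ofReal (K * invWeight y) := fun h hp y hy =>
    specNorm_jost_sub_one_le hν h hp hy
  have three : ∀ {a b c : ℝ → ℝ → ℂ}, IsBC a → IsBC b → IsBC c →
      (∀ y ≤ 0, specNorm ν a y ≤ ENNReal.ofReal (K * invWeight y)) →
      (∀ y ≤ 0, specNorm ν b y ≤ ENNReal.ofReal (K * invWeight y)) →
      (∀ y ≤ 0, specNorm ν c y ≤ ENNReal.ofReal (K * invWeight y)) → ∀ y ≤ 0,
      specNorm ν (fun x l => a x l + b x l - c x l) y
        ≤ ENNReal.ofReal (3 * K * invWeight y) := by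
    intro a b c ha hb hc ea eb ec y hy
    have hw := (invWeight_pos y).le
    refine (specNorm_sub_le (ha.add hb) hc y).trans ?_
    refine (add_le_add (specNorm_add_le ha hb y) le_rfl).trans ?_
    refine (add_le_add (add_le_add (ea y hy) (eb y hy)) (ec y hy)).trans (le_of_eq ?_)
    rw [← ENNReal.ofReal_add (by positivity) (by positivity),
      ← ENNReal.ofReal_add (by positivity) (by positivity)]
    congr 1; ring
  have first : ∀ y ≤ 0, specNorm ν (fun x l => q x l - p x l) y ≤ ENNReal.ofReal (C * η) ∧
      specNorm ν (fun x l => q' x l - p' x l) y ≤ ENNReal.ofReal (C * η) := fun y hy =>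
    specNorm_jost_sub_le hν h₁ h hq hp hη hy ((tail_mono _ hy).trans hf₁)
      ((tail_mono _ hy).trans hg₁)
  have second : ∀ y ≤ 0,
      specNorm ν (fun x l => r x l - p x l) y ≤ ENNReal.ofReal (C * δ * invWeight y) ∧
      specNorm ν (fun x l => r' x l - p' x l) y ≤ ENNReal.ofReal (C * δ * invWeight y) :=
    fun y hy => specNorm_jost_sub_le_weight hν h₂ h hr hp hδ hy hf₂ hg₂
  have L1 : ∀ {c : ℝ → ℂ}, MemL21 c → l21Norm c ≤ δ → ∫⁻ y, ‖c y‖ₑ ≤ ENNReal.ofReal (2 * δ) :=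
    fun hc hcδ => hc.lintegral_le.trans (ENNReal.ofReal_le_ofReal (by gcongr))
  have i1 := (If₃.sub If₁).sub (If₂.sub If)
  have i2 := (Ig₃.sub Ig₁).sub (Ig₂.sub Ig)
  -- The sources come from writing f₃s' - f₁q' - f₂r' + fp' as f₃(s' - q' - r' + p') + (f₃ - f₁ - f₂
  -- + f)(q' + r' - p') + (f₂ - f)(q' - p') + (f₁ - f)(r' - p'), and likewise for the other
  -- component, where a 1 is split off for Plancherel's identity.
  have c1 : IsBC fun x l => q' x l + r' x l - p' x l := (hq.bc₂.add hr.bc₂).sub hp.bc₂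
  have c2 : IsBC fun x l => (q x l - 1) + (r x l - 1) - (p x l - 1) :=
    ((hq.bc₁.sub hone).add (hr.bc₁.sub hone)).sub (hp.bc₁.sub hone)
  have v1 := volt_isBC 0 i1 c1
  have v2 := volt_isBC 0 (If₂.sub If) (hq.bc₂.sub hp.bc₂)
  have v3 := volt_isBC 0 (If₁.sub If) (hr.bc₂.sub hp.bc₂)
  have u0 := volt_isBC 1 i2 hone
  have u1 := volt_isBC 1 i2 c2
  have u2 := volt_isBC 1 (Ig₂.sub Ig) (hq.bc₁.sub hp.bc₁)
  have u3 := volt_isBC 1 (Ig₁.sub Ig) (hr.bc₁.sub hp.bc₁)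
  have w1 := fun y (hy : y ≤ 0) => specNorm_volt_le_of_weight (ν := ν) 0 i1.1 c1
    (K := 3 * K) (by positivity) le_rfl (three hq.bc₂ hr.bc₂ hp.bc₂
      (fun y hy => (decay h₁ hq y hy).2) (fun y hy => (decay h₂ hr y hy).2)
      (fun y hy => (decay h hp y hy).2)) hf₃ hy
  -- The pairing of estimates is forced. The difference f₂ - f is small in L^{2,1}, hence in L¹, and
  -- may multiply the non-decaying q' - p'; the difference f₁ - f is small only in unweighted L² and
  -- needs the decay of r' - p'.
  have w2 := fun y (hy : y ≤ 0) => specNorm_volt_le_of_bound (ν := ν) 0 (If₂.sub If).1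
    (hq.bc₂.sub hp.bc₂) (K := C * η) (by positivity) (fun y hy => (first y hy).2)
    (L1 (h₂.memf.sub h.memf) hf₂) hy
  have w3 := fun y (hy : y ≤ 0) => specNorm_volt_le_of_weight (ν := ν) 0 (If₁.sub If).1
    (hr.bc₂.sub hp.bc₂) (K := C * δ) (by positivity) le_rfl (fun y hy => (second y hy).2) hf₁ hy
  have z0 := fun y (hy : y ≤ 0) => specNorm_volt_one_le hν i2 mg hg₃ hy
  have z1 := fun y (hy : y ≤ 0) => specNorm_volt_le_of_weight (ν := ν) 1 i2.1 c2
    (K := 3 * K) (by positivity) le_rfl (three (hq.bc₁.sub hone) (hr.bc₁.sub hone)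
      (hp.bc₁.sub hone) (fun y hy => (decay h₁ hq y hy).1) (fun y hy => (decay h₂ hr y hy).1)
      (fun y hy => (decay h hp y hy).1)) hg₃ hy
  have z2 := fun y (hy : y ≤ 0) => specNorm_volt_le_of_bound (ν := ν) 1 (Ig₂.sub Ig).1
    (hq.bc₁.sub hp.bc₁) (K := C * η) (by positivity) (fun y hy => (first y hy).1)
    (L1 (h₂.memg.sub h.memg) hg₂) hy
  have z3 := fun y (hy : y ≤ 0) => specNorm_volt_le_of_weight (ν := ν) 1 (Ig₁.sub Ig).1
    (hr.bc₁.sub hp.bc₁) (K := C * δ) (by positivity) le_rfl (fun y hy => (second y hy).1) hg₁ hy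
  have := specNorm_le_of_offDiag (ν := ν) h₃ ((hs.bc₁.sub hq.bc₁).sub (hr.bc₁.sub hp.bc₁))
    ((hs.bc₂.sub hq.bc₂).sub (hr.bc₂.sub hp.bc₂)) ((v1.add v2).add v3) ((u0.add u1).add (u2.add u3))
    (x₀ := 0) (M := 2 * (3 * K) * ε + C * η * (2 * δ) + 2 * (C * δ) * η)
    (N := 2 * ε + 2 * (3 * K) * ε + (C * η * (2 * δ) + 2 * (C * δ) * η))
    (by positivity) (by positivity) ?_ ?_ ?_ ?_ le_rfl
  · refine ⟨this.1.trans (ENNReal.ofReal_le_ofReal ?_), this.2.trans (ENNReal.ofReal_le_ofReal ?_)⟩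
    all_goals
      unfold diff2Const
      rw [← hKdef, ← hCdef, mul_right_comm _ (Real.exp (4 * B))]
      refine mul_le_mul_of_nonneg_right ?_ (Real.exp_pos _).le
      nlinarith [mul_nonneg hK (mul_nonneg hη hδ), mul_nonneg hC hε, mul_nonneg hη hδ]
  · intro x l
    rw [volt_sub_right 0 If₃ (hs.bc₂.sub hq.bc₂) (hr.bc₂.sub hp.bc₂),
      volt_sub_right 0 If₃ hs.bc₂ hq.bc₂, volt_sub_right 0 If₃ hr.bc₂ hp.bc₂,
      volt_sub_right 0 (If₂.sub If) hq.bc₂ hp.bc₂, volt_sub_right 0 (If₁.sub If) hr.bc₂ hp.bc₂]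
    have ev : ∀ {t : ℝ → ℝ → ℂ}, IsBC t → ∀ {a b : ℝ → ℂ}, Integrable a → Integrable b →
        volt 0 (a - b) t x l = volt 0 a t x l - volt 0 b t x l :=
      fun ht _ _ ha hb => volt_sub_left 0 ha hb ht x l
    rw [ev c1 (If₃.sub If₁) (If₂.sub If), ev c1 If₃ If₁, ev c1 If₂ If, ev hq.bc₂ If₂ If,
      ev hp.bc₂ If₂ If, ev hr.bc₂ If₁ If, ev hp.bc₂ If₁ If]
    have es : ∀ {a : ℝ → ℂ}, Integrable a → volt 0 a (fun x l => q' x l + r' x l - p' x l) x l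
        = volt 0 a q' x l + volt 0 a r' x l - volt 0 a p' x l := fun ha => by
      rw [volt_sub_right 0 ha (hq.bc₂.add hr.bc₂) hp.bc₂, volt_add_right 0 ha hq.bc₂ hr.bc₂]
    rw [es If, es If₁, es If₂, es If₃, hs.eq₁, hq.eq₁, hr.eq₁, hp.eq₁]
    ring
  · intro x l
    rw [volt_sub_right 1 Ig₃ (hs.bc₁.sub hq.bc₁) (hr.bc₁.sub hp.bc₁),
      volt_sub_right 1 Ig₃ hs.bc₁ hq.bc₁, volt_sub_right 1 Ig₃ hr.bc₁ hp.bc₁,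
      volt_sub_right 1 (Ig₂.sub Ig) hq.bc₁ hp.bc₁, volt_sub_right 1 (Ig₁.sub Ig) hr.bc₁ hp.bc₁]
    have ev : ∀ {t : ℝ → ℝ → ℂ}, IsBC t → ∀ {a b : ℝ → ℂ}, Integrable a → Integrable b →
        volt 1 (a - b) t x l = volt 1 a t x l - volt 1 b t x l :=
      fun ht _ _ ha hb => volt_sub_left 1 ha hb ht x l
    rw [ev hone (Ig₃.sub Ig₁) (Ig₂.sub Ig), ev hone Ig₃ Ig₁, ev hone Ig₂ Ig,
      ev c2 (Ig₃.sub Ig₁) (Ig₂.sub Ig), ev c2 Ig₃ Ig₁, ev c2 Ig₂ Ig, ev hq.bc₁ Ig₂ Ig,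
      ev hp.bc₁ Ig₂ Ig, ev hr.bc₁ Ig₁ Ig, ev hp.bc₁ Ig₁ Ig]
    have es : ∀ {a : ℝ → ℂ}, Integrable a →
        volt 1 a (fun x l => (q x l - 1) + (r x l - 1) - (p x l - 1)) x l
        = volt 1 a q x l + volt 1 a r x l - volt 1 a p x l - volt 1 a (fun _ _ => 1) x l :=
      fun ha => by
      rw [volt_sub_right 1 ha ((hq.bc₁.sub hone).add (hr.bc₁.sub hone)) (hp.bc₁.sub hone),
        volt_add_right 1 ha (hq.bc₁.sub hone) (hr.bc₁.sub hone), volt_sub_right 1 ha hq.bc₁ hone,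
        volt_sub_right 1 ha hr.bc₁ hone, volt_sub_right 1 ha hp.bc₁ hone]
      ring
    rw [es Ig, es Ig₁, es Ig₂, es Ig₃, hs.eq₂, hq.eq₂, hr.eq₂, hp.eq₂]
    ring
  · intro y hy
    refine (specNorm_add_le (v1.add v2) v3 y).trans ?_
    refine (add_le_add (specNorm_add_le v1 v2 y) le_rfl).trans ?_
    rw [ENNReal.ofReal_add (by positivity) (by positivity),
      ENNReal.ofReal_add (by positivity) (by positivity)]
    exact add_le_add (add_le_add (w1 y hy) (w2 y hy)) (w3 y hy)
  · intro y hy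
    refine (specNorm_add_le (u0.add u1) (u2.add u3) y).trans ?_
    refine (add_le_add (specNorm_add_le u0 u1 y) (specNorm_add_le u2 u3 y)).trans ?_
    rw [ENNReal.ofReal_add (by positivity) (by positivity),
      ENNReal.ofReal_add (by positivity) (by positivity),
      ENNReal.ofReal_add (by positivity) (by positivity)]
    exact add_le_add (add_le_add (z0 y hy) (z1 y hy)) (add_le_add (z2 y hy) (z3 y hy))

end

/-! ### Pointwise estimates in the spectral variable -/

theorem IsJost.norm_le {B : ℝ} {f g : ℝ → ℂ} (hfg : BddPair B f g) {p₁ p₂ : ℝ → ℝ → ℂ}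
    (hp : IsJost f g p₁ p₂) (x l : ℝ) :
    ‖p₁ x l‖ ≤ Real.exp (4 * B) ∧ ‖p₂ x l‖ ≤ Real.exp (4 * B) := by
  have h := specNorm_le_of_offDiag (ν := Measure.dirac l) hfg hp.bc₁ hp.bc₂ (IsBC.const 1)
    (IsBC.const 0) (x₀ := x) (M := 1) (N := 0) zero_le_one le_rfl hp.eq₁
    (fun x l => by rw [hp.eq₂]; ring)
    (fun y _ => by rw [specNorm_dirac _ (IsBC.const 1)]; simp)
    (fun y _ => by rw [specNorm_dirac _ (IsBC.const 0)]; simp) le_rfl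
  rw [specNorm_dirac _ hp.bc₁, specNorm_dirac _ hp.bc₂, add_zero, one_mul, ← ofReal_norm,
    ← ofReal_norm] at h
  exact ⟨(ENNReal.ofReal_le_ofReal_iff (Real.exp_pos _).le).1 h.1,
    (ENNReal.ofReal_le_ofReal_iff (Real.exp_pos _).le).1 h.2⟩

theorem IsJost.norm_sub_le {B : ℝ} {f g f' g' : ℝ → ℂ} (hfg : BddPair B f g)
    (hfg' : BddPair B f' g') {p₁ p₂ p₁' p₂' : ℝ → ℝ → ℂ} (hp : IsJost f g p₁ p₂)
    (hp' : IsJost f' g' p₁' p₂') {η : ℝ} (hη : 0 ≤ η)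
    (hf : l21Norm (fun y => f y - f' y) ≤ η) (hg : l21Norm (fun y => g y - g' y) ≤ η) (x l : ℝ) :
    ‖p₁ x l - p₁' x l‖ ≤ 4 * η * Real.exp (4 * B) * Real.exp (4 * B) ∧
    ‖p₂ x l - p₂' x l‖ ≤ 4 * η * Real.exp (4 * B) * Real.exp (4 * B) := by
  have if1 := hfg.memf.integrable
  have ig1 := hfg.memg.integrable
  have if2 := hfg'.memf.integrable
  have ig2 := hfg'.memg.integrable
  have L1 : ∀ {c : ℝ → ℂ}, MemL21 c → l21Norm c ≤ η → ∫⁻ y, ‖c y‖ₑ ≤ ENNReal.ofReal (2 * η) :=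
    fun hc hcδ => hc.lintegral_le.trans (ENNReal.ofReal_le_ofReal (by gcongr))
  have hb : ∀ {p : ℝ → ℝ → ℂ}, IsBC p → (∀ x l, ‖p x l‖ ≤ Real.exp (4 * B)) → ∀ y ≤ x,
      specNorm (Measure.dirac l) p y ≤ ENNReal.ofReal (Real.exp (4 * B)) := fun hp h y _ => by
    rw [specNorm_dirac _ hp, ← ofReal_norm]
    exact ENNReal.ofReal_le_ofReal (h y l)
  have h := specNorm_le_of_offDiag (ν := Measure.dirac l) hfg' (hp.bc₁.sub hp'.bc₁)
    (hp.bc₂.sub hp'.bc₂) (volt_isBC 0 (if1.sub if2) hp.bc₂) (volt_isBC 1 (ig1.sub ig2) hp.bc₁)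
    (x₀ := x) (M := Real.exp (4 * B) * (2 * η)) (N := Real.exp (4 * B) * (2 * η))
    (by positivity) (by positivity)
    (fun x l => by
      rw [volt_sub_right 0 if2 hp.bc₂ hp'.bc₂]
      change _ = volt 0 (fun y => f y - f' y) p₂ x l + _
      rw [volt_sub_left 0 if1 if2 hp.bc₂, hp.eq₁, hp'.eq₁]; ring)
    (fun x l => by
      rw [volt_sub_right 1 ig2 hp.bc₁ hp'.bc₁]
      change _ = volt 1 (fun y => g y - g' y) p₁ x l + _
      rw [volt_sub_left 1 ig1 ig2 hp.bc₁, hp.eq₂, hp'.eq₂]; ring)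
    (fun y hy => specNorm_volt_le_of_bound 0 (if1.sub if2).1 hp.bc₂ (Real.exp_pos _).le
      (hb hp.bc₂ fun x l => (hp.norm_le hfg x l).2) (L1 (hfg.memf.sub hfg'.memf) hf) hy)
    (fun y hy => specNorm_volt_le_of_bound 1 (ig1.sub ig2).1 hp.bc₁ (Real.exp_pos _).le
      (hb hp.bc₁ fun x l => (hp.norm_le hfg x l).1) (L1 (hfg.memg.sub hfg'.memg) hg) hy)
    le_rfl
  rw [specNorm_dirac _ (hp.bc₁.sub hp'.bc₁), specNorm_dirac _ (hp.bc₂.sub hp'.bc₂), ← ofReal_norm,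
    ← ofReal_norm, ENNReal.ofReal_le_ofReal_iff (by positivity),
    ENNReal.ofReal_le_ofReal_iff (by positivity)] at h
  have e : (Real.exp (4 * B) * (2 * η) + Real.exp (4 * B) * (2 * η)) * Real.exp (4 * B)
      = 4 * η * Real.exp (4 * B) * Real.exp (4 * B) := by ring
  rwa [e] at h

/-! ### Modulation of the coefficients -/

/-- The coefficient `e^{2ihy} f(y)`. -/
noncomputable def modulate (h : ℝ) (f : ℝ → ℂ) (y : ℝ) : ℂ := osc (h * y) * f y

theorem norm_modulate (h : ℝ) (f : ℝ → ℂ) (y : ℝ) : ‖modulate h f y‖ = ‖f y‖ := by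
  rw [modulate, norm_mul, norm_osc, one_mul]

theorem memL21_modulate {f : ℝ → ℂ} (hf : MemL21 f) (h : ℝ) : MemL21 (modulate h f) :=
  MemL21.of_norm_le (K := 1)
    ((Continuous.aestronglyMeasurable (by fun_prop)).mul hf.aestronglyMeasurable) hf
    (Eventually.of_forall fun y => by rw [norm_modulate, one_mul])

theorem l21Norm_modulate_le {f : ℝ → ℂ} (hf : MemL21 f) (h : ℝ) :
    l21Norm (modulate h f) ≤ l21Norm f := by
  simpa using l21Norm_le_of_norm_le zero_le_one hf
    (Eventually.of_forall fun y => by rw [norm_modulate, one_mul])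

theorem BddPair.modulate {B : ℝ} {f g : ℝ → ℂ} (hfg : BddPair B f g) (h k : ℝ) :
    BddPair B (modulate h f) (modulate k g) :=
  ⟨memL21_modulate hfg.memf h, memL21_modulate hfg.memg k,
    (l21Norm_modulate_le hfg.memf h).trans hfg.lef, (l21Norm_modulate_le hfg.memg k).trans hfg.leg⟩

theorem norm_osc_sub_one_le (s : ℝ) : ‖osc s - 1‖ ≤ 2 * |s| := by
  have := Real.norm_exp_I_mul_ofReal_sub_one_le (x := 2 * s)
  have e : osc s = Complex.exp (Complex.I * ((2 * s : ℝ) : ℂ)) := by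
    rw [osc]; push_cast; ring_nf
  rw [e]
  refine this.trans (le_of_eq ?_)
  rw [Real.norm_eq_abs, abs_mul, abs_two]

/-- Since |e^{2ihy} - 1| ≤ 2|h||y|, the Lipschitz bound in h consumes the weight of L^{2,1} and
leaves an unweighted norm. -/
theorem tail_modulate_sub_le {f : ℝ → ℂ} (hf : MemL21 f) (h : ℝ) {K : ℝ} (hK : l21Norm f ≤ K)
    (x : ℝ) : tail (fun y => modulate h f y - f y) x ≤ ENNReal.ofReal (2 * |h| * K) := by
  refine (tail_le_eLpNorm _ x).trans ?_
  have : eLpNorm (fun y => modulate h f y - f y) 2 volume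
      ≤ ENNReal.ofReal (2 * |h|) * eLpNorm (weighted f) 2 volume := by
    refine eLpNorm_le_mul_eLpNorm_of_ae_le_mul (Eventually.of_forall fun y => ?_) 2
    have e : modulate h f y - f y = (osc (h * y) - 1) * f y := by rw [modulate]; ring
    rw [e, norm_mul, weighted, norm_mul, Complex.norm_real,
      Real.norm_of_nonneg (Real.sqrt_nonneg _), ← mul_assoc]
    gcongr
    refine (norm_osc_sub_one_le _).trans ?_
    rw [abs_mul, ← mul_assoc]
    gcongr
    exact abs_le_sqrt_one_add_sq y
  refine this.trans ?_
  rw [hf.eLpNorm_weighted, ENNReal.ofReal_mul (p := 2 * |h|) (by positivity)]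
  gcongr

/-- A shift of the spectral variable is a modulation of the coefficients. -/
theorem IsJost.shift {f g : ℝ → ℂ} {p₁ p₂ : ℝ → ℝ → ℂ} (hp : IsJost f g p₁ p₂) (h : ℝ) :
    IsJost (modulate h f) (modulate (-h) g) (fun x l => p₁ x (l + h))
      (fun x l => osc (-(h * x)) * p₂ x (l + h)) := by
  have sh : ∀ {p : ℝ → ℝ → ℂ}, IsBC p → IsBC fun x l => p x (l + h) := fun {p} hp => by
    obtain ⟨K, hK⟩ := hp.bdd
    exact ⟨hp.cont.comp (f := fun y : ℝ × ℝ => (y.1, y.2 + h)) (by fun_prop), K,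
      fun x l => hK x _⟩
  refine ⟨sh hp.bc₁, (IsBC.osc (by unfold Function.uncurry; fun_prop)).mul (sh hp.bc₂),
    fun x l => ?_, fun x l => ?_⟩
  · rw [hp.eq₁, volt, volt]
    congr 2; ext y
    have := osc_neg_mul (h * y)
    simp only [zero_mul, modulate]
    linear_combination (-(f y * p₂ y (l + h)) * osc 0) * this
  · rw [hp.eq₂, volt, volt, ← integral_const_mul]
    congr 1; ext y
    simp only [modulate]
    have e : osc (-(h * x)) * osc (1 * (l + h) * (x - y)) = osc (1 * l * (x - y)) * osc (-h * y) := by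
      rw [← osc_add, ← osc_add]; ring_nf
    linear_combination (g y * p₁ y (l + h)) * e

/-! ### Bounded functions with square integrable difference quotients -/

/-- Continuous functions bounded by `K` whose difference quotients are bounded by `K` in `L²`. -/
structure HB (X : ℝ → ℂ) (K : ℝ) : Prop where
  cont : Continuous X
  bdd : ∀ l, ‖X l‖ ≤ K
  lip : ∀ h : ℝ, eLpNorm (fun l => X (l + h) - X l) 2 volume ≤ ENNReal.ofReal (K * |h|)

namespace HB

variable {X Y : ℝ → ℂ} {K L : ℝ}

theorem nonneg (hX : HB X K) : 0 ≤ K := (norm_nonneg _).trans (hX.bdd 0)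

theorem mono (hX : HB X K) (h : K ≤ L) : HB X L :=
  ⟨hX.cont, fun l => (hX.bdd l).trans h, fun t => (hX.lip t).trans
    (ENNReal.ofReal_le_ofReal (by gcongr))⟩

theorem const (c : ℂ) : HB (fun _ => c) ‖c‖ :=
  ⟨continuous_const, fun _ => le_rfl, fun h => by simp⟩

theorem cont_shift (hX : HB X K) (h : ℝ) : Continuous fun l => X (l + h) :=
  hX.cont.comp (by fun_prop)

theorem add (hX : HB X K) (hY : HB Y L) : HB (fun l => X l + Y l) (K + L) := by
  refine ⟨hX.cont.add hY.cont, fun l => (norm_add_le _ _).trans (add_le_add (hX.bdd l) (hY.bdd l)),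
    fun h => ?_⟩
  have e : (fun l => X (l + h) + Y (l + h) - (X l + Y l))
      = (fun l => X (l + h) - X l) + fun l => Y (l + h) - Y l := by ext l; simp; ring
  rw [e, add_mul, ENNReal.ofReal_add (mul_nonneg hX.nonneg (abs_nonneg h))
    (mul_nonneg hY.nonneg (abs_nonneg h))]
  exact (eLpNorm_add_le ((hX.cont_shift h).sub hX.cont).aestronglyMeasurable
    ((hY.cont_shift h).sub hY.cont).aestronglyMeasurable (by norm_num)).trans
    (add_le_add (hX.lip h) (hY.lip h))

/-- The Leibniz rule for translates, each term being a bounded factor times an L² difference. So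
this class is an algebra, and Wronskians stay in it. -/
theorem mul (hX : HB X K) (hY : HB Y L) : HB (fun l => X l * Y l) (2 * K * L) := by
  have hK := hX.nonneg
  have hL := hY.nonneg
  refine ⟨hX.cont.mul hY.cont, fun l => ?_, fun h => ?_⟩
  · rw [norm_mul]
    calc _ ≤ K * L := mul_le_mul (hX.bdd l) (hY.bdd l) (norm_nonneg _) hK
      _ ≤ _ := by nlinarith [mul_nonneg hK hL]
  · have e : (fun l => X (l + h) * Y (l + h) - X l * Y l)
        = (fun l => X (l + h) * (Y (l + h) - Y l)) + fun l => (X (l + h) - X l) * Y l := by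
      ext l; simp; ring
    have cX := (hX.cont_shift h).sub hX.cont
    have cY := (hY.cont_shift h).sub hY.cont
    rw [e]
    refine (eLpNorm_add_le ((hX.cont_shift h).mul cY).aestronglyMeasurable
      (cX.mul hY.cont).aestronglyMeasurable (by norm_num)).trans ?_
    have h1 : eLpNorm (fun l => X (l + h) * (Y (l + h) - Y l)) 2 volume
        ≤ ENNReal.ofReal K * ENNReal.ofReal (L * |h|) := by
      refine (eLpNorm_le_mul_eLpNorm_of_ae_le_mul (Eventually.of_forall fun l => ?_) 2).trans
        (mul_le_mul_right (hY.lip h) _)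
      rw [norm_mul]; gcongr; exact hX.bdd _
    have h2 : eLpNorm (fun l => (X (l + h) - X l) * Y l) 2 volume
        ≤ ENNReal.ofReal L * ENNReal.ofReal (K * |h|) := by
      refine (eLpNorm_le_mul_eLpNorm_of_ae_le_mul (Eventually.of_forall fun l => ?_) 2).trans
        (mul_le_mul_right (hX.lip h) _)
      rw [norm_mul, mul_comm]; gcongr; exact hY.bdd _
    refine (add_le_add h1 h2).trans (le_of_eq ?_)
    rw [← ENNReal.ofReal_mul hK, ← ENNReal.ofReal_mul hL, ← ENNReal.ofReal_add (by positivity)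
      (by positivity)]
    congr 1; ring

theorem neg (hX : HB X K) : HB (fun l => - X l) K := by
  refine ⟨hX.cont.neg, fun l => by rw [norm_neg]; exact hX.bdd l, fun h => ?_⟩
  refine le_trans (le_of_eq (eLpNorm_congr_norm_ae (Eventually.of_forall fun l => ?_))) (hX.lip h)
  rw [← norm_neg]; congr 1; ring

theorem sub (hX : HB X K) (hY : HB Y L) : HB (fun l => X l - Y l) (K + L) := by
  simpa [sub_eq_add_neg] using hX.add hY.neg

theorem comp_neg (hX : HB X K) : HB (fun l => X (-l)) K := by
  refine ⟨hX.cont.comp continuous_neg, fun l => hX.bdd _, fun h => ?_⟩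
  have hm : MeasurePreserving (fun l : ℝ => -l) volume volume := Measure.measurePreserving_neg _
  have := hX.lip (-h)
  rw [abs_neg, ← eLpNorm_comp_measurePreserving (g := fun l => X (l + -h) - X l)
    ((hX.cont_shift _).sub hX.cont).aestronglyMeasurable hm] at this
  refine le_trans (le_of_eq ?_) this
  congr 1; ext l; simp only [Function.comp_apply]; congr 2; ring

theorem comp_add (hX : HB X K) (t : ℝ) : HB (fun l => X (l + t)) K := by
  refine ⟨hX.cont_shift t, fun l => hX.bdd _, fun h => ?_⟩
  have := hX.lip h
  rw [← eLpNorm_comp_measurePreserving (g := fun l => X (l + h) - X l)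
    ((hX.cont_shift _).sub hX.cont).aestronglyMeasurable
    (measurePreserving_add_right (volume : Measure ℝ) t)] at this
  refine le_trans (le_of_eq ?_) this
  congr 1; ext l; simp only [Function.comp_apply]; congr 2; ring

theorem inv (hX : HB X K) {c : ℝ} (hc : 0 < c) (h : ∀ l, c ≤ ‖X l‖) :
    HB (fun l => (X l)⁻¹) (c⁻¹ + K * c⁻¹ ^ 2) := by
  have hK := hX.nonneg
  have hne : ∀ l, X l ≠ 0 := fun l => norm_pos_iff.1 (hc.trans_le (h l))
  have hci : ∀ l, ‖(X l)⁻¹‖ ≤ c⁻¹ := fun l => by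
    rw [norm_inv]; exact inv_anti₀ hc (h l)
  refine ⟨hX.cont.inv₀ hne, fun l => (hci l).trans (le_add_of_nonneg_right (by positivity)),
    fun t => ?_⟩
  have : eLpNorm (fun l => (X (l + t))⁻¹ - (X l)⁻¹) 2 volume
      ≤ ENNReal.ofReal (c⁻¹ ^ 2) * ENNReal.ofReal (K * |t|) := by
    refine (eLpNorm_le_mul_eLpNorm_of_ae_le_mul (Eventually.of_forall fun l => ?_) 2).trans
        (mul_le_mul_right (hX.lip t) _)
    have e : (X (l + t))⁻¹ - (X l)⁻¹ = -((X (l + t))⁻¹ * (X l)⁻¹ * (X (l + t) - X l)) := by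
      have := hne l
      have := hne (l + t)
      field_simp
      ring
    rw [e, norm_neg, norm_mul, norm_mul, sq]
    gcongr
    · exact hci _
    · exact hci _
  refine this.trans ?_
  rw [← ENNReal.ofReal_mul (by positivity)]
  refine ENNReal.ofReal_le_ofReal ?_
  have : 0 ≤ c⁻¹ * |t| := by positivity
  nlinarith

end HB

/-! ### The values of the Jost functions at the origin -/

/-- Three bounds for the difference of two Jost solutions at x = 0, in the supremum norm, in L² and
for translates in L². The translates need second differences. -/
theorem exists_jost_diff_const {B : ℝ} (hB : 0 ≤ B) : ∃ C : ℝ, 0 ≤ C ∧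
    ∀ {f g f' g' : ℝ → ℂ} {p₁ p₂ p₁' p₂' : ℝ → ℝ → ℂ} {η : ℝ}, BddPair B f g → BddPair B f' g' →
      IsJost f g p₁ p₂ → IsJost f' g' p₁' p₂' → 0 ≤ η →
      l21Norm (fun y => f y - f' y) ≤ η → l21Norm (fun y => g y - g' y) ≤ η →
      (HB (fun l => p₁ 0 l - p₁' 0 l) (C * η) ∧ HB (fun l => p₂ 0 l - p₂' 0 l) (C * η)) ∧
      eLpNorm (fun l => p₁ 0 l - p₁' 0 l) 2 volume ≤ ENNReal.ofReal (C * η) ∧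
      eLpNorm (fun l => p₂ 0 l - p₂' 0 l) 2 volume ≤ ENNReal.ofReal (C * η) := by
  have hC := diffConst_nonneg hB
  have hC2 := diff2Const_nonneg hB
  set C := diffConst B + diff2Const B * (2 + 2 * B) + 4 * Real.exp (4 * B) * Real.exp (4 * B)
    with hCdef
  have l1 : diffConst B ≤ C := by
    have : 0 ≤ diff2Const B * (2 + 2 * B) + 4 * Real.exp (4 * B) * Real.exp (4 * B) := by positivity
    linarith
  have l2 : diff2Const B * (2 + 2 * B) ≤ C := by
    have : 0 ≤ diffConst B + 4 * Real.exp (4 * B) * Real.exp (4 * B) := by positivity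
    linarith
  have l3 : 4 * Real.exp (4 * B) * Real.exp (4 * B) ≤ C := by
    have : 0 ≤ diffConst B + diff2Const B * (2 + 2 * B) := by positivity
    linarith
  refine ⟨C, hC.trans l1, ?_⟩
  intro f g f' g' p₁ p₂ p₁' p₂' η hfg hfg' hp hp' hη hf hg
  have hν : ∀ n : ℕ, (volume.restrict (Icc (-(n : ℝ)) n)) ≤ (volume : Measure ℝ) :=
    fun n => Measure.restrict_le_self
  have hn := fun x l => hp.norm_sub_le hfg hfg' hp' hη hf hg x l
  have hsup : 4 * η * Real.exp (4 * B) * Real.exp (4 * B) ≤ C * η := by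
    have := mul_le_mul_of_nonneg_right l3 hη
    linarith
  have hL2 := fun n : ℕ => specNorm_jost_sub_le (hν n) hfg hfg' hp hp' hη le_rfl
    ((tail_zero_le (hfg.memf.sub hfg'.memf)).trans (ENNReal.ofReal_le_ofReal hf))
    ((tail_zero_le (hfg.memg.sub hfg'.memg)).trans (ENNReal.ofReal_le_ofReal hg))
  -- A translate in l solves the modulated system, so the four solutions are those of two
  -- potentials, each with and without modulation. Modulation has size 2|h|B and the mixed
  -- difference size 2|h|η, both in unweighted L²; the potentials differ by η in L^{2,1}.
  have hdiff : ∀ (h : ℝ) (n : ℕ), _ := fun h n => by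
    have m1 := hfg.memf.sub hfg'.memf
    have m2 := hfg.memg.sub hfg'.memg
    have e : ∀ (k : ℝ) (f f' : ℝ → ℂ), (fun y => modulate k f y - modulate k f' y - (f y - f' y))
        = fun y => modulate k (fun y => f y - f' y) y - (f y - f' y) := fun k f f' => by
      ext y; simp only [modulate]; ring
    refine specNorm_jost_diff2_le (hν n) hfg' (hfg'.modulate h (-h)) hfg (hfg.modulate h (-h))
      hp' (hp'.shift h) hp (hp.shift h) (η := 2 * |h| * B) (δ := η) (ε := 2 * |h| * η)
      (by positivity) hη (by positivity) (tail_modulate_sub_le hfg'.memf h hfg'.lef 0) ?_ hf hg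
      ?_ ?_
    · simpa using tail_modulate_sub_le hfg'.memg (-h) hfg'.leg 0
    · rw [e]; exact tail_modulate_sub_le m1 h hf 0
    · rw [e]; simpa using tail_modulate_sub_le m2 (-h) hg 0
  have hlip : ∀ h : ℝ, diff2Const B * (2 * |h| * η + 2 * |h| * B * η) ≤ C * η * |h| := fun h => by
    have := mul_le_mul_of_nonneg_right l2 (mul_nonneg hη (abs_nonneg h))
    linarith
  refine ⟨⟨⟨(hp.bc₁.sub hp'.bc₁).continuous_right 0, fun l => (hn 0 l).1.trans hsup, fun h => ?_⟩,
    ⟨(hp.bc₂.sub hp'.bc₂).continuous_right 0, fun l => (hn 0 l).2.trans hsup, fun h => ?_⟩⟩,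
    ?_, ?_⟩
  · refine (eLpNorm_two_le_of_restrict fun n => ?_).trans (ENNReal.ofReal_le_ofReal (hlip h))
    exact (hdiff h n).1
  · refine (eLpNorm_two_le_of_restrict fun n => ?_).trans (ENNReal.ofReal_le_ofReal (hlip h))
    refine le_trans (le_of_eq ?_) (hdiff h n).2
    -- The unimodular factor which the shift puts on the second component equals 1 at x = 0.
    rw [specNorm]; congr 1; ext l; simp
  · exact eLpNorm_two_le_of_restrict fun n => (hL2 n).1.trans
      (ENNReal.ofReal_le_ofReal (by gcongr))
  · exact eLpNorm_two_le_of_restrict fun n => (hL2 n).2.trans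
      (ENNReal.ofReal_le_ofReal (by gcongr))

/-! ### Pairs of functions and Lipschitz estimates -/

/-- Two functions with `HB` bound `K` whose difference has the bound `K η`. -/
structure HBPair (X X' : ℝ → ℂ) (K η : ℝ) : Prop where
  hb : HB X K
  hb' : HB X' K
  sub : HB (fun l => X l - X' l) (K * η)

/-- Two continuous functions with `L²` norms at most `K` whose difference has norm at most
`K η`. -/
structure L2Pair (Y Y' : ℝ → ℂ) (K η : ℝ) : Prop where
  cont : Continuous Y
  cont' : Continuous Y'
  le : eLpNorm Y 2 volume ≤ ENNReal.ofReal K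
  le' : eLpNorm Y' 2 volume ≤ ENNReal.ofReal K
  sub_le : eLpNorm (fun l => Y l - Y' l) 2 volume ≤ ENNReal.ofReal (K * η)

theorem eLpNorm_mul_le_of_bound {X Y : ℝ → ℂ} {K L : ℝ} (hK : 0 ≤ K) (hX : ∀ l, ‖X l‖ ≤ K)
    (hY : eLpNorm Y 2 volume ≤ ENNReal.ofReal L) :
    eLpNorm (fun l => X l * Y l) 2 volume ≤ ENNReal.ofReal (K * L) := by
  rw [ENNReal.ofReal_mul hK]
  refine (eLpNorm_le_mul_eLpNorm_of_ae_le_mul (Eventually.of_forall fun l => ?_) 2).trans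
    (mul_le_mul_right hY _)
  rw [norm_mul]; gcongr; exact hX _

theorem eLpNorm_add_le_ofReal {X Y : ℝ → ℂ} {K L : ℝ} (hK : 0 ≤ K) (hL : 0 ≤ L)
    (cX : Continuous X) (cY : Continuous Y) (hX : eLpNorm X 2 volume ≤ ENNReal.ofReal K)
    (hY : eLpNorm Y 2 volume ≤ ENNReal.ofReal L) :
    eLpNorm (fun l => X l + Y l) 2 volume ≤ ENNReal.ofReal (K + L) := by
  rw [ENNReal.ofReal_add hK hL]
  exact (eLpNorm_add_le cX.aestronglyMeasurable cY.aestronglyMeasurable (by norm_num)).trans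
    (add_le_add hX hY)

namespace HBPair

variable {X X' Y Y' : ℝ → ℂ} {K L η : ℝ}

theorem nonneg (h : HBPair X X' K η) : 0 ≤ K := h.hb.nonneg

theorem mono (h : HBPair X X' K η) (hη : 0 ≤ η) (hKL : K ≤ L) : HBPair X X' L η :=
  ⟨h.hb.mono hKL, h.hb'.mono hKL, h.sub.mono (by gcongr)⟩

theorem comp_neg (h : HBPair X X' K η) : HBPair (fun l => X (-l)) (fun l => X' (-l)) K η :=
  ⟨h.hb.comp_neg, h.hb'.comp_neg, h.sub.comp_neg⟩

theorem mul (hX : HBPair X X' K η) (hY : HBPair Y Y' L η) :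
    HBPair (fun l => X l * Y l) (fun l => X' l * Y' l) (4 * K * L) η := by
  have hK := hX.nonneg
  have hL := hY.nonneg
  have hKL : 0 ≤ K * L := mul_nonneg hK hL
  refine ⟨(hX.hb.mul hY.hb).mono (by linarith), (hX.hb'.mul hY.hb').mono (by linarith), ?_⟩
  have := ((hX.sub.mul hY.hb).add (hX.hb'.mul hY.sub))
  have e : (fun l => X l * Y l - X' l * Y' l)
      = fun l => (X l - X' l) * Y l + X' l * (Y l - Y' l) := by ext l; ring
  rw [e]
  exact this.mono (by linarith)

theorem subPair (hX : HBPair X X' K η) (hY : HBPair Y Y' L η) :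
    HBPair (fun l => X l - Y l) (fun l => X' l - Y' l) (K + L) η := by
  refine ⟨hX.hb.sub hY.hb, hX.hb'.sub hY.hb', ?_⟩
  have e : (fun l => X l - Y l - (X' l - Y' l)) = fun l => (X l - X' l) - (Y l - Y' l) := by
    ext l; ring
  rw [e, add_mul]
  exact hX.sub.sub hY.sub

theorem inv (hX : HBPair X X' K η) (hη : 0 ≤ η) {c : ℝ} (hc : 0 < c) (h : ∀ l, c ≤ ‖X l‖)
    (h' : ∀ l, c ≤ ‖X' l‖) :
    HBPair (fun l => (X l)⁻¹) (fun l => (X' l)⁻¹)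
      ((c⁻¹ + K * c⁻¹ ^ 2) + 4 * K * (c⁻¹ + K * c⁻¹ ^ 2) ^ 2) η := by
  have hK := hX.nonneg
  have h1 := hX.hb.inv hc h
  have h2 := hX.hb'.inv hc h'
  set M := c⁻¹ + K * c⁻¹ ^ 2 with hM
  have hM0 : 0 ≤ M := h1.nonneg
  have hKM : 0 ≤ 4 * K * M ^ 2 := by positivity
  refine ⟨h1.mono (by linarith), h2.mono (by linarith), ?_⟩
  have := ((h1.mul h2).mul hX.sub).neg
  have e : (fun l => (X l)⁻¹ - (X' l)⁻¹) = fun l => -((X l)⁻¹ * (X' l)⁻¹ * (X l - X' l)) := by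
    ext l
    have n1 : X l ≠ 0 := norm_pos_iff.1 (hc.trans_le (h l))
    have n2 : X' l ≠ 0 := norm_pos_iff.1 (hc.trans_le (h' l))
    field_simp
    ring
  rw [e]
  refine this.mono ?_
  have := mul_nonneg hM0 hη
  nlinarith

theorem mul_l2 (hX : HBPair X X' K η) (hY : L2Pair Y Y' L η) (hL : 0 ≤ L) (hη : 0 ≤ η) :
    L2Pair (fun l => X l * Y l) (fun l => X' l * Y' l) (2 * K * L) η := by
  have hK := hX.nonneg
  have hKL : 0 ≤ K * L := mul_nonneg hK hL
  refine ⟨hX.hb.cont.mul hY.cont, hX.hb'.cont.mul hY.cont',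
    (eLpNorm_mul_le_of_bound hK hX.hb.bdd hY.le).trans (ENNReal.ofReal_le_ofReal (by linarith)),
    (eLpNorm_mul_le_of_bound hK hX.hb'.bdd hY.le').trans (ENNReal.ofReal_le_ofReal (by linarith)),
    ?_⟩
  have e : (fun l => X l * Y l - X' l * Y' l)
      = fun l => (X l - X' l) * Y l + X' l * (Y l - Y' l) := by ext l; ring
  rw [e]
  refine (eLpNorm_add_le_ofReal (by positivity) (by positivity) (hX.sub.cont.mul hY.cont)
    (hX.hb'.cont.mul (hY.cont.sub hY.cont'))
    (eLpNorm_mul_le_of_bound hX.sub.nonneg hX.sub.bdd hY.le)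
    (eLpNorm_mul_le_of_bound hK hX.hb'.bdd hY.sub_le)).trans (ENNReal.ofReal_le_ofReal ?_)
  linarith

end HBPair

namespace L2Pair

variable {X X' Y Y' : ℝ → ℂ} {K L η : ℝ}

theorem mono (h : L2Pair X X' K η) (hη : 0 ≤ η) (hKL : K ≤ L) : L2Pair X X' L η :=
  ⟨h.cont, h.cont', h.le.trans (ENNReal.ofReal_le_ofReal hKL),
    h.le'.trans (ENNReal.ofReal_le_ofReal hKL),
    h.sub_le.trans (ENNReal.ofReal_le_ofReal (by gcongr))⟩

theorem neg (h : L2Pair X X' K η) : L2Pair (fun l => - X l) (fun l => - X' l) K η := by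
  refine ⟨h.cont.neg, h.cont'.neg, ?_, ?_, ?_⟩
  · exact (le_of_eq (eLpNorm_neg _ _ _)).trans h.le
  · exact (le_of_eq (eLpNorm_neg _ _ _)).trans h.le'
  · refine (le_of_eq (eLpNorm_congr_norm_ae (Eventually.of_forall fun l => ?_))).trans h.sub_le
    rw [← norm_neg]; congr 1; ring

theorem add (hX : L2Pair X X' K η) (hY : L2Pair Y Y' L η) (hK : 0 ≤ K) (hL : 0 ≤ L)
    (hη : 0 ≤ η) : L2Pair (fun l => X l + Y l) (fun l => X' l + Y' l) (K + L) η := by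
  refine ⟨hX.cont.add hY.cont, hX.cont'.add hY.cont',
    eLpNorm_add_le_ofReal hK hL hX.cont hY.cont hX.le hY.le,
    eLpNorm_add_le_ofReal hK hL hX.cont' hY.cont' hX.le' hY.le', ?_⟩
  have e : (fun l => X l + Y l - (X' l + Y' l)) = fun l => (X l - X' l) + (Y l - Y' l) := by
    ext l; ring
  rw [e, add_mul]
  exact eLpNorm_add_le_ofReal (by positivity) (by positivity) (hX.cont.sub hX.cont')
    (hY.cont.sub hY.cont') hX.sub_le hY.sub_le

theorem subPair (hX : L2Pair X X' K η) (hY : L2Pair Y Y' L η) (hK : 0 ≤ K) (hL : 0 ≤ L)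
    (hη : 0 ≤ η) : L2Pair (fun l => X l - Y l) (fun l => X' l - Y' l) (K + L) η := by
  simpa [sub_eq_add_neg] using hX.add hY.neg hK hL hη

theorem comp_mp {φ : ℝ → ℝ} (h : L2Pair X X' K η) (hc : Continuous φ)
    (hφ : MeasurePreserving φ volume volume) :
    L2Pair (fun l => X (φ l)) (fun l => X' (φ l)) K η := by
  refine ⟨h.cont.comp hc, h.cont'.comp hc, ?_, ?_, ?_⟩
  · exact (le_of_eq (eLpNorm_comp_measurePreserving h.cont.aestronglyMeasurable hφ)).trans h.le
  · exact (le_of_eq (eLpNorm_comp_measurePreserving h.cont'.aestronglyMeasurable hφ)).trans h.le'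
  · exact (le_of_eq (eLpNorm_comp_measurePreserving (g := fun l => X l - X' l)
      (h.cont.sub h.cont').aestronglyMeasurable hφ)).trans h.sub_le

end L2Pair

/-! ### The chosen Jost solutions -/

/-- The Jost solution of the off-diagonal system. -/
noncomputable def jost (f g : ℝ → ℂ) : (ℝ → ℝ → ℂ) × (ℝ → ℝ → ℂ) :=
  Classical.epsilon fun p => IsJost f g p.1 p.2

theorem isJost_jost {f g : ℝ → ℂ} (hf : Integrable f) (hg : Integrable g) :
    IsJost f g (jost f g).1 (jost f g).2 := by
  have h0 : Integrable (fun _ : ℝ => (0 : ℂ)) := integrable_zero _ _ _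
  obtain ⟨q₁, q₂, h⟩ := exists_isSol h0 hf hg h0
  exact Classical.epsilon_spec (p := fun p : (ℝ → ℝ → ℂ) × (ℝ → ℝ → ℂ) => IsJost f g p.1 p.2)
    ⟨(q₁, q₂), IsJost.of_isSol h⟩

theorem BddPair.isJost {B : ℝ} {f g : ℝ → ℂ} (h : BddPair B f g) :
    IsJost f g (jost f g).1 (jost f g).2 := isJost_jost h.memf.integrable h.memg.integrable

/-- The first component of the Jost solution at the origin. -/
noncomputable def jostA (f g : ℝ → ℂ) (l : ℝ) : ℂ := (jost f g).1 0 l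

/-- The second component of the Jost solution at the origin. -/
noncomputable def jostB (f g : ℝ → ℂ) (l : ℝ) : ℂ := (jost f g).2 0 l

/-- Two pairs of coefficients whose distance in `L^{2,1}` is at most `η`. -/
structure ClosePairs (B η : ℝ) (f g f' g' : ℝ → ℂ) : Prop where
  fst : BddPair B f g
  snd : BddPair B f' g'
  lef : l21Norm (fun y => f y - f' y) ≤ η
  leg : l21Norm (fun y => g y - g' y) ≤ η

theorem ClosePairs.nonneg {B η : ℝ} {f g f' g' : ℝ → ℂ} (h : ClosePairs B η f g f' g') : 0 ≤ η :=
  (l21Norm_nonneg _).trans h.lef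

/-- Bounds for a single potential follow from the difference estimate by comparison with the zero
potential, whose Jost solution is (1, 0). The second component is therefore in L², whereas the first
is only 1 plus such a function. -/
theorem exists_jost_const {B : ℝ} (hB : 0 ≤ B) : ∃ C : ℝ, 0 ≤ C ∧
    ∀ {f g f' g' : ℝ → ℂ} {η : ℝ}, ClosePairs B η f g f' g' →
      HBPair (jostA f g) (jostA f' g') C η ∧ HBPair (jostB f g) (jostB f' g') C η ∧
      L2Pair (jostB f g) (jostB f' g') C η := by
  obtain ⟨C, hC, h⟩ := exists_jost_diff_const hB
  have single : ∀ {f g : ℝ → ℂ}, BddPair B f g → HB (jostA f g) (1 + C * B) ∧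
      HB (jostB f g) (C * B) ∧ eLpNorm (jostB f g) 2 volume ≤ ENNReal.ofReal (C * B) := by
    intro f g hfg
    have := h hfg (bddPair_zero hB) hfg.isJost isJost_zero hB (by simpa using hfg.lef)
      (by simpa using hfg.leg)
    simp only [sub_zero] at this
    refine ⟨?_, this.1.2, this.2.2⟩
    have h1 := (HB.const 1).add this.1.1
    simp only [add_sub_cancel, norm_one] at h1
    exact h1
  have hCB : 0 ≤ C * B := mul_nonneg hC hB
  refine ⟨1 + C * B + C, by positivity, ?_⟩
  intro f g f' g' η hc
  have hη := hc.nonneg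
  obtain ⟨a1, b1, c1⟩ := single hc.fst
  obtain ⟨a2, b2, c2⟩ := single hc.snd
  have hd := h hc.fst hc.snd hc.fst.isJost hc.snd.isJost hη hc.lef hc.leg
  have hle : C * η ≤ (1 + C * B + C) * η := by gcongr; linarith
  exact ⟨⟨a1.mono (by linarith), a2.mono (by linarith), hd.1.1.mono hle⟩,
    ⟨b1.mono (by linarith), b2.mono (by linarith), hd.1.2.mono hle⟩,
    ⟨b1.cont, b2.cont, c1.trans (ENNReal.ofReal_le_ofReal (by linarith)),
      c2.trans (ENNReal.ofReal_le_ofReal (by linarith)),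
      hd.2.2.trans (ENNReal.ofReal_le_ofReal hle)⟩⟩

/-! ### Decay in the spectral variable -/

/-- Coefficients such that the second one has a derivative in `L²`. -/
structure DiffPair (B : ℝ) (f g g₁ : ℝ → ℂ) : Prop where
  bdd : BddPair B f g
  prim : IsPrim g g₁
  mem : MemLp g₁ 2
  le : eLpNorm g₁ 2 volume ≤ ENNReal.ofReal B
  bot : Tendsto g atBot (𝓝 0)
  top : Tendsto g atTop (𝓝 0)

/-- The remainder of the expansion of the Jost function at the origin for large `l`. -/
noncomputable def jostR (f g : ℝ → ℂ) (l : ℝ) : ℂ :=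
  2 * Complex.I * l * jostB f g l + g 0 * jostA f g l

theorem isPrim_osc (l : ℝ) :
    IsPrim (fun y => osc (-(l * y))) (fun y => -(2 * Complex.I * l) * osc (-(l * y))) := by
  refine IsPrim.of_deriv (fun y => ?_) (by fun_prop)
  have h1 : HasDerivAt (fun y : ℝ => 2 * Complex.I * ((-(l * y) : ℝ) : ℂ)) (-(2 * Complex.I * l)) y := by
    have : HasDerivAt (fun y : ℝ => -(2 * Complex.I * l) * (y : ℂ)) (-(2 * Complex.I * l) * 1) y :=
      (Complex.ofRealCLM.hasDerivAt (x := y)).const_mul _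
    rw [mul_one] at this
    refine this.congr_of_eventuallyEq (Eventually.of_forall fun y => ?_)
    push_cast; ring
  exact h1.cexp.congr_deriv (mul_comm _ _)

theorem IsJost.isPrim_fst {f g : ℝ → ℂ} (hf : Integrable f) {p₁ p₂ : ℝ → ℝ → ℂ}
    (hp : IsJost f g p₁ p₂) (l : ℝ) : IsPrim (fun x => p₁ x l) fun x => f x * p₂ x l := by
  refine IsPrim.of_Iic (c := 1) (hp.bc₂.integrable_mul hf l) fun x => ?_
  rw [hp.eq₁, volt]
  simp

/-- The truncated remainder. -/
noncomputable def truncR (n : ℕ) (f g g₁ : ℝ → ℂ) (p₁ p₂ : ℝ → ℝ → ℂ) (x l : ℝ) : ℂ :=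
  volt 1 ((Ioc (-(n : ℝ)) 0).indicator g₁) p₁ x l +
    volt 1 ((Ioc (-(n : ℝ)) 0).indicator fun y => g y * f y) p₂ x l

theorem integrable_indicator_Ioc {c : ℝ → ℂ} (h : ∀ a b, IntervalIntegrable c volume a b) (n : ℕ) :
    Integrable ((Ioc (-(n : ℝ)) 0).indicator c) := by
  rw [integrable_indicator_iff measurableSet_Ioc]
  exact (h (-(n : ℝ)) 0).1

theorem volt_indicator_Ioc {c : ℝ → ℂ} {p : ℝ → ℝ → ℂ} (n : ℕ) (l : ℝ) :
    volt 1 ((Ioc (-(n : ℝ)) 0).indicator c) p 0 l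
      = ∫ y in (-(n : ℝ))..0, osc (-(l * y)) * (c y * p y l) := by
  rw [intervalIntegral.integral_of_le (by simp), volt, ← integral_indicator measurableSet_Iic,
    ← integral_indicator measurableSet_Ioc]
  congr 1; ext y
  by_cases hy : y ∈ Ioc (-(n : ℝ)) 0
  · rw [indicator_of_mem (show y ∈ Iic (0 : ℝ) from hy.2), indicator_of_mem hy,
      indicator_of_mem hy]
    congr 2; ring
  · rw [indicator_of_notMem hy]
    by_cases h0 : y ∈ Iic (0 : ℝ)
    · rw [indicator_of_mem h0, indicator_of_notMem hy]; ring
    · rw [indicator_of_notMem h0]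

/-- Integration by parts of e^{-2ily} g p₁ over [-n, 0]; the boundary term at -n disappears because
g tends to zero. The truncation is there because g₁ is only in L² and its integral over the
half-line need not converge absolutely. -/
theorem tendsto_truncR {B : ℝ} {f g g₁ : ℝ → ℂ} (h : DiffPair B f g g₁) (l : ℝ) :
    Tendsto (fun n : ℕ => truncR n f g g₁ (jost f g).1 (jost f g).2 0 l) atTop
      (𝓝 (jostR f g l)) := by
  have hf := h.bdd.memf.integrable
  have hg := h.bdd.memg.integrable
  have hp := h.bdd.isJost
  set p₁ := (jost f g).1 with hp₁
  set p₂ := (jost f g).2 with hp₂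
  have hprim := ((isPrim_osc l).mul (h.prim.mul (hp.isPrim_fst hf l)))
  have hgf : ∀ a b, IntervalIntegrable (fun y => g y * f y) volume a b := fun a b =>
    (hf.intervalIntegrable).continuousOn_mul h.prim.continuous.continuousOn
  have hos : Continuous fun y : ℝ => osc (-(l * y)) := by fun_prop
  have i1 : ∀ a b, IntervalIntegrable (fun y => osc (-(l * y)) * (g₁ y * p₁ y l)) volume a b :=
    fun a b => ((h.prim.1 a b).mul_continuousOn
      (hp.bc₁.continuous_left l).continuousOn).continuousOn_mul hos.continuousOn
  have i2 : ∀ a b, IntervalIntegrable (fun y => osc (-(l * y)) * (g y * f y * p₂ y l)) volume a b :=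
    fun a b => ((hgf a b).mul_continuousOn
      (hp.bc₂.continuous_left l).continuousOn).continuousOn_mul hos.continuousOn
  have i3 : Integrable fun y => osc (-(l * y)) * (g y * p₁ y l) := by
    have := volt_integrable 1 hg hp.bc₁ 0 l
    refine this.congr (Eventually.of_forall fun y => ?_)
    simp only; congr 2; ring
  have e : ∀ n : ℕ, truncR n f g g₁ p₁ p₂ 0 l
      = 2 * Complex.I * l * (∫ y in (-(n : ℝ))..0, osc (-(l * y)) * (g y * p₁ y l))
        + (g 0 * p₁ 0 l - osc (-(l * -(n : ℝ))) * (g (-(n : ℝ)) * p₁ (-(n : ℝ)) l)) := fun n => by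
    have h1 := hprim.2 (-(n : ℝ)) 0
    beta_reduce at h1
    rw [mul_zero, neg_zero, osc_zero, one_mul] at h1
    rw [h1, truncR, volt_indicator_Ioc, volt_indicator_Ioc,
      ← intervalIntegral.integral_add (i1 _ _) (i2 _ _), ← intervalIntegral.integral_const_mul,
      ← intervalIntegral.integral_add (i3.intervalIntegrable.const_mul _) (hprim.1 _ _)]
    congr 1; ext y; ring
  have hneg : Tendsto (fun n : ℕ => -(n : ℝ)) atTop atBot :=
    tendsto_neg_atTop_atBot.comp tendsto_natCast_atTop_atTop
  have l1 : Tendsto (fun n : ℕ => ∫ y in (-(n : ℝ))..0, osc (-(l * y)) * (g y * p₁ y l)) atTop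
      (𝓝 (p₂ 0 l)) := by
    have := intervalIntegral_tendsto_integral_Iic 0 i3.integrableOn hneg
    convert this using 2
    rw [hp.eq₂, volt]
    congr 1; ext y; congr 2; ring
  have l2 : Tendsto (fun n : ℕ => osc (-(l * -(n : ℝ))) * (g (-(n : ℝ)) * p₁ (-(n : ℝ)) l)) atTop
      (𝓝 0) := by
    obtain ⟨K, hK⟩ := hp.bc₁.bdd
    have l3 : Tendsto (fun n : ℕ => ‖g (-(n : ℝ))‖ * K) atTop (𝓝 0) := by
      simpa using ((h.bot.comp hneg).norm).mul_const K
    refine squeeze_zero_norm (fun n => ?_) l3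
    rw [norm_mul, norm_osc, one_mul, norm_mul]
    gcongr
    exact hK _ _
  have := (l1.const_mul (2 * Complex.I * l)).add (l2.const_sub (g 0 * p₁ 0 l))
  rw [sub_zero] at this
  exact this.congr fun n => (e n).symm

theorem tail_indicator_le (n : ℕ) (c : ℝ → ℂ) (x : ℝ) :
    tail ((Ioc (-(n : ℝ)) 0).indicator c) x ≤ eLpNorm c 2 volume :=
  (tail_le_eLpNorm _ x).trans (eLpNorm_indicator_le c)

theorem lintegral_enorm_indicator_Ioc_le (n : ℕ) (c : ℝ → ℂ) :
    ∫⁻ y, ‖(Ioc (-(n : ℝ)) 0).indicator c y‖ₑ ≤ ∫⁻ y, ‖c y‖ₑ :=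
  lintegral_mono fun y => enorm_indicator_le_enorm_self c y

theorem specNorm_add_le_ofReal {ν : Measure ℝ} {p q : ℝ → ℝ → ℂ} (hp : IsBC p) (hq : IsBC q)
    {x K L : ℝ} (hK : 0 ≤ K) (hL : 0 ≤ L) (h₁ : specNorm ν p x ≤ ENNReal.ofReal K)
    (h₂ : specNorm ν q x ≤ ENNReal.ofReal L) :
    specNorm ν (fun x l => p x l + q x l) x ≤ ENNReal.ofReal (K + L) := by
  rw [ENNReal.ofReal_add hK hL]
  exact (specNorm_add_le hp hq x).trans (add_le_add h₁ h₂)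

/-- The truncated remainders are bounded uniformly in n. The part with the derivative of g is
treated like a Jost source in L². The product g f is in L¹ by Cauchy-Schwarz, so p₂ need only be
bounded there. -/
theorem eLpNorm_jostR_sub_le {B : ℝ} {f g g₁ f' g' g₁' : ℝ → ℂ} {η : ℝ}
    (h : DiffPair B f g g₁) (h' : DiffPair B f' g' g₁') (hc : ClosePairs B η f g f' g')
    (h₁ : eLpNorm (fun y => g₁ y - g₁' y) 2 volume ≤ ENNReal.ofReal η) :
    eLpNorm (fun l => jostR f g l - jostR f' g' l) 2 volume ≤ ENNReal.ofReal
      ((2 + 2 * decayConst B + 2 * diffConst B * B + 2 * decayConst B * B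
        + diffConst B * B * B) * η) := by
  have hB := h.bdd.nonneg
  have hη := hc.nonneg
  have hK := decayConst_nonneg hB
  have hC := diffConst_nonneg hB
  set K := decayConst B with hKdef
  set C := diffConst B with hCdef
  have hf := h.bdd.memf.integrable
  have hg := h.bdd.memg.integrable
  have hf' := h'.bdd.memf.integrable
  have hg' := h'.bdd.memg.integrable
  have hp := h.bdd.isJost
  have hp' := h'.bdd.isJost
  have hone := IsBC.const 1
  refine eLpNorm_two_le_of_restrict fun m => ?_
  set ν := (volume : Measure ℝ).restrict (Icc (-(m : ℝ)) m) with hνdef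
  have hν : ν ≤ volume := Measure.restrict_le_self
  set p₁ := (jost f g).1
  set p₂ := (jost f g).2
  set p₁' := (jost f' g').1
  set p₂' := (jost f' g').2
  set I : ℕ → (ℝ → ℂ) → ℝ → ℂ := fun n c => (Ioc (-(n : ℝ)) 0).indicator c with hI
  have igf : ∀ a b, IntervalIntegrable (fun y => g y * f y) volume a b := fun a b =>
    (hf.intervalIntegrable).continuousOn_mul h.prim.continuous.continuousOn
  have igf' : ∀ a b, IntervalIntegrable (fun y => g' y * f' y) volume a b := fun a b =>
    (hf'.intervalIntegrable).continuousOn_mul h'.prim.continuous.continuousOn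
  have j1 := fun n => integrable_indicator_Ioc h.prim.1 n
  have j1' := fun n => integrable_indicator_Ioc h'.prim.1 n
  have j2 := fun n => integrable_indicator_Ioc igf n
  have j2' := fun n => integrable_indicator_Ioc igf' n
  have d1 := fun n => integrable_indicator_Ioc (fun a b => (h.prim.1 a b).sub (h'.prim.1 a b)) n
  have d2 := fun n => integrable_indicator_Ioc (fun a b => (igf a b).sub (igf' a b)) n
  have bound : ∀ n : ℕ, eLpNorm (fun l => truncR n f g g₁ p₁ p₂ 0 l - truncR n f' g' g₁' p₁' p₂' 0 l)
      2 ν ≤ ENNReal.ofReal ((2 + 2 * K + 2 * C * B + 2 * K * B + C * B * B) * η) := by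
    intro n
    have v0 := volt_isBC 1 (d1 n) hone
    have v1 := volt_isBC 1 (d1 n) (hp.bc₁.sub hone)
    have v2 := volt_isBC 1 (j1' n) (hp.bc₁.sub hp'.bc₁)
    have v3 := volt_isBC 1 (d2 n) hp.bc₂
    have v4 := volt_isBC 1 (j2' n) (hp.bc₂.sub hp'.bc₂)
    have e : (fun l => truncR n f g g₁ p₁ p₂ 0 l - truncR n f' g' g₁' p₁' p₂' 0 l) = fun l =>
        ((volt 1 (I n fun y => g₁ y - g₁' y) (fun _ _ => 1) 0 l
        + volt 1 (I n fun y => g₁ y - g₁' y) (fun x l => p₁ x l - 1) 0 l)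
        + volt 1 (I n g₁') (fun x l => p₁ x l - p₁' x l) 0 l)
        + (volt 1 (I n fun y => g y * f y - g' y * f' y) p₂ 0 l
        + volt 1 (I n fun y => g' y * f' y) (fun x l => p₂ x l - p₂' x l) 0 l) := by
      ext l
      have e1 : volt 1 (I n fun y => g₁ y - g₁' y) p₁ 0 l
          = volt 1 (I n g₁) p₁ 0 l - volt 1 (I n g₁') p₁ 0 l := by
        rw [← volt_sub_left 1 (j1 n) (j1' n) hp.bc₁]
        exact congrArg (fun c => volt 1 c p₁ 0 l) (indicator_sub _ _ _)
      have e2 : volt 1 (I n fun y => g y * f y - g' y * f' y) p₂ 0 l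
          = volt 1 (I n fun y => g y * f y) p₂ 0 l - volt 1 (I n fun y => g' y * f' y) p₂ 0 l := by
        rw [← volt_sub_left 1 (j2 n) (j2' n) hp.bc₂]
        exact congrArg (fun c => volt 1 c p₂ 0 l) (indicator_sub _ _ _)
      rw [volt_sub_right 1 (d1 n) hp.bc₁ hone, volt_sub_right 1 (j1' n) hp.bc₁ hp'.bc₁,
        volt_sub_right 1 (j2' n) hp.bc₂ hp'.bc₂, e1, e2, truncR, truncR]
      ring
    have decay := fun y (hy : y ≤ 0) => specNorm_jost_sub_one_le hν h.bdd hp hy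
    have diff := fun y (hy : y ≤ 0) =>
      specNorm_jost_sub_le_weight hν h.bdd h'.bdd hp hp' hη hy hc.lef hc.leg
    have w1 : ∀ y, invWeight y ≤ 1 := invWeight_le_one
    have m1 : MemLp (I n fun y => g₁ y - g₁' y) 2 := (h.mem.sub h'.mem).indicator measurableSet_Ioc
    have b0 := specNorm_volt_one_le hν (d1 n) m1 (x₀ := 0) ((tail_indicator_le n _ 0).trans h₁)
      le_rfl
    have b1 := specNorm_volt_le_of_weight (ν := ν) 1 (d1 n).1 (hp.bc₁.sub hone) hK le_rfl
      (fun y hy => (decay y hy).1) ((tail_indicator_le n _ 0).trans h₁) le_rfl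
    have b2 := specNorm_volt_le_of_weight (ν := ν) 1 (j1' n).1 (hp.bc₁.sub hp'.bc₁)
      (K := C * η) (by positivity) le_rfl (fun y hy => (diff y hy).1)
      ((tail_indicator_le n _ 0).trans h'.le) le_rfl
    have L : ∫⁻ y, ‖g y * f y - g' y * f' y‖ₑ ≤ ENNReal.ofReal (2 * B * η) := by
      have mf := hc.fst.memf.sub hc.snd.memf
      have mg := hc.fst.memg.sub hc.snd.memg
      calc ∫⁻ y, ‖g y * f y - g' y * f' y‖ₑ
          ≤ ∫⁻ y, (‖g y - g' y‖ₑ * ‖f y‖ₑ + ‖g' y‖ₑ * ‖f y - f' y‖ₑ) := by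
            refine lintegral_mono fun y => ?_
            have e : g y * f y - g' y * f' y = (g y - g' y) * f y + g' y * (f y - f' y) := by ring
            rw [e, ← enorm_mul, ← enorm_mul]
            exact enorm_add_le _ _
        _ = (∫⁻ y, ‖g y - g' y‖ₑ * ‖f y‖ₑ) + ∫⁻ y, ‖g' y‖ₑ * ‖f y - f' y‖ₑ :=
            lintegral_add_left' (mg.aestronglyMeasurable.enorm.mul
              h.bdd.memf.aestronglyMeasurable.enorm) _
        _ ≤ ENNReal.ofReal η * ENNReal.ofReal B + ENNReal.ofReal B * ENNReal.ofReal η := by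
            gcongr
            · refine (lintegral_mul_le_eLpNorm_two (f := fun y => g y - g' y)
                mg.aestronglyMeasurable h.bdd.memf.aestronglyMeasurable).trans ?_
              gcongr
              · exact mg.eLpNorm_le.trans (ENNReal.ofReal_le_ofReal hc.leg)
              · exact h.bdd.memf.eLpNorm_le.trans (ENNReal.ofReal_le_ofReal h.bdd.lef)
            · refine (lintegral_mul_le_eLpNorm_two (g := fun y => f y - f' y)
                h'.bdd.memg.aestronglyMeasurable mf.aestronglyMeasurable).trans ?_
              gcongr
              · exact h'.bdd.memg.eLpNorm_le.trans (ENNReal.ofReal_le_ofReal h'.bdd.leg)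
              · exact mf.eLpNorm_le.trans (ENNReal.ofReal_le_ofReal hc.lef)
        _ = _ := by
            rw [← ENNReal.ofReal_mul hη, ← ENNReal.ofReal_mul hB, ← ENNReal.ofReal_add
              (by positivity) (by positivity)]
            congr 1; ring
    have L' : ∫⁻ y, ‖g' y * f' y‖ₑ ≤ ENNReal.ofReal (B * B) := by
      simp_rw [enorm_mul]
      refine (lintegral_mul_le_eLpNorm_two h'.bdd.memg.aestronglyMeasurable
        h'.bdd.memf.aestronglyMeasurable).trans ?_
      rw [ENNReal.ofReal_mul hB]
      gcongr
      · exact h'.bdd.memg.eLpNorm_le.trans (ENNReal.ofReal_le_ofReal h'.bdd.leg)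
      · exact h'.bdd.memf.eLpNorm_le.trans (ENNReal.ofReal_le_ofReal h'.bdd.lef)
    have b3 := specNorm_volt_le_of_bound (ν := ν) 1 (d2 n).1 hp.bc₂ hK (x₀ := 0)
      (fun y hy => (decay y hy).2.trans (ENNReal.ofReal_le_ofReal
        (mul_le_of_le_one_right hK (w1 y)))) ((lintegral_enorm_indicator_Ioc_le n _).trans L) le_rfl
    have b4 := specNorm_volt_le_of_bound (ν := ν) 1 (j2' n).1 (hp.bc₂.sub hp'.bc₂) (K := C * η)
      (by positivity) (x₀ := 0) (fun y hy => (diff y hy).2.trans (ENNReal.ofReal_le_ofReal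
        (mul_le_of_le_one_right (by positivity) (w1 y))))
        ((lintegral_enorm_indicator_Ioc_le n _).trans L') le_rfl
    rw [e]
    have total := specNorm_add_le_ofReal ((v0.add v1).add v2) (v3.add v4) (by positivity)
      (by positivity) (specNorm_add_le_ofReal (v0.add v1) v2 (by positivity) (by positivity)
        (specNorm_add_le_ofReal v0 v1 (by positivity) (by positivity) b0 b1) b2)
      (specNorm_add_le_ofReal v3 v4 (by positivity) (by positivity) b3 b4)
    refine total.trans (ENNReal.ofReal_le_ofReal (le_of_eq ?_))
    ring
  have tr : ∀ (n : ℕ) {f g g₁ : ℝ → ℂ} {p₁ p₂ : ℝ → ℝ → ℂ}, IsBC p₁ → IsBC p₂ →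
      Integrable ((Ioc (-(n : ℝ)) 0).indicator g₁) →
      Integrable ((Ioc (-(n : ℝ)) 0).indicator fun y => g y * f y) →
      Continuous fun l => truncR n f g g₁ p₁ p₂ 0 l := fun n _ _ _ _ _ b1 b2 i1 i2 =>
    ((volt_isBC 1 i1 b1).add (volt_isBC 1 i2 b2)).continuous_right 0
  -- Fatou's lemma: pointwise convergence in l suffices to carry the uniform bound to the limit.
  have hlim := Lp.eLpNorm_lim_le_liminf_eLpNorm (μ := ν) (p := 2)
    (f := fun (n : ℕ) l => truncR n f g g₁ p₁ p₂ 0 l - truncR n f' g' g₁' p₁' p₂' 0 l)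
    (fun n => ((tr n hp.bc₁ hp.bc₂ (j1 n) (j2 n)).sub
      (tr n hp'.bc₁ hp'.bc₂ (j1' n) (j2' n))).aestronglyMeasurable)
    (fun l => jostR f g l - jostR f' g' l)
    (Eventually.of_forall fun l => (tendsto_truncR h l).sub (tendsto_truncR h' l))
  refine hlim.trans ?_
  exact liminf_le_of_le (by isBoundedDefault) fun b hb => by
    obtain ⟨n, hn⟩ := hb.exists
    exact hn.trans (bound n)

/-! ### Scattering functions of the off-diagonal system -/

/-- The coefficient of the reflected system. -/
def reflect (f : ℝ → ℂ) : ℝ → ℂ := fun x => -f (-x)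

theorem weighted_reflect (f : ℝ → ℂ) : weighted (reflect f) = fun x => -weighted f (-x) := by
  ext x; simp [weighted, reflect]

theorem reflect_sub (f g : ℝ → ℂ) :
    (fun y => reflect f y - reflect g y) = reflect fun y => f y - g y := by
  ext y; simp only [reflect]; ring

theorem eLpNorm_comp_neg_two {f : ℝ → ℂ} (hf : AEStronglyMeasurable f) :
    eLpNorm (fun x => f (-x)) 2 volume = eLpNorm f 2 volume :=
  eLpNorm_comp_measurePreserving hf (Measure.measurePreserving_neg volume)

theorem NLSGI.MemL21.reflect {f : ℝ → ℂ} (h : MemL21 f) : MemL21 (reflect f) := by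
  rw [MemL21, weighted_reflect]
  exact (h.comp_measurePreserving (Measure.measurePreserving_neg volume)).neg

theorem l21Norm_reflect {f : ℝ → ℂ} (h : MemL21 f) : l21Norm (reflect f) = l21Norm f := by
  rw [l21Norm, l21Norm, weighted_reflect, l2Norm, l2Norm]
  congr 1
  exact (eLpNorm_neg (fun x => weighted f (-x)) 2 volume).trans (eLpNorm_comp_neg_two h.1)

theorem BddPair.reflect {B : ℝ} {f g : ℝ → ℂ} (h : BddPair B f g) :
    BddPair B (reflect f) (reflect g) :=
  ⟨MemL21.reflect h.memf, MemL21.reflect h.memg, (l21Norm_reflect h.memf).trans_le h.lef,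
    (l21Norm_reflect h.memg).trans_le h.leg⟩

theorem BddPair.swap {B : ℝ} {f g : ℝ → ℂ} (h : BddPair B f g) : BddPair B g f :=
  ⟨h.memg, h.memf, h.leg, h.lef⟩

theorem ClosePairs.reflect {B η : ℝ} {f g f' g' : ℝ → ℂ} (h : ClosePairs B η f g f' g') :
    ClosePairs B η (reflect f) (reflect g) (reflect f') (reflect g') := by
  refine ⟨h.fst.reflect, h.snd.reflect, ?_, ?_⟩
  · rw [reflect_sub, l21Norm_reflect (h.fst.memf.sub h.snd.memf)]; exact h.lef
  · rw [reflect_sub, l21Norm_reflect (h.fst.memg.sub h.snd.memg)]; exact h.leg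

theorem ClosePairs.swap {B η : ℝ} {f g f' g' : ℝ → ℂ} (h : ClosePairs B η f g f' g') :
    ClosePairs B η g f g' f' :=
  ⟨h.fst.swap, h.snd.swap, h.leg, h.lef⟩

theorem DiffPair.reflect {B : ℝ} {f g g₁ : ℝ → ℂ} (h : DiffPair B f g g₁) :
    DiffPair B (reflect f) (reflect g) fun x => g₁ (-x) := by
  refine ⟨h.bdd.reflect, ?_, h.mem.comp_measurePreserving (Measure.measurePreserving_neg volume),
    (eLpNorm_comp_neg_two h.mem.1).trans_le h.le, ?_, ?_⟩
  · have := h.prim.comp_neg.neg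
    simp only [neg_neg] at this
    exact this
  · rw [← neg_zero]
    exact (h.top.comp tendsto_neg_atBot_atTop).neg
  · rw [← neg_zero]
    exact (h.bot.comp tendsto_neg_atTop_atBot).neg

/-- The diagonal scattering function of the system with coefficients `f`, `g`. -/
noncomputable def scatDiag (f g : ℝ → ℂ) (l : ℝ) : ℂ :=
  jostA f g l * jostA (reflect g) (reflect f) l - jostB f g l * jostB (reflect g) (reflect f) l

/-- The off-diagonal scattering function of the system with coefficients `f`, `g`. -/
noncomputable def scatOff (f g : ℝ → ℂ) (l : ℝ) : ℂ :=
  jostA (reflect f) (reflect g) (-l) * jostB f g l - jostB (reflect f) (reflect g) (-l) * jostA f g l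

/-- The quotient of the scattering functions. -/
noncomputable def scatQuot (f g : ℝ → ℂ) (l : ℝ) : ℂ := (scatDiag f g l)⁻¹ * scatOff f g l

theorem measurePreserving_neg_real : MeasurePreserving (fun l : ℝ => -l) volume volume :=
  Measure.measurePreserving_neg volume

/-- Every term of `scatOff` contains exactly one second component, which is in L², and one first
component, which is bounded. Hence `scatOff` is in L², while `scatDiag` is only bounded. -/
theorem exists_scat_const {B : ℝ} (hB : 0 ≤ B) : ∃ C : ℝ, 0 ≤ C ∧
    ∀ {f g f' g' : ℝ → ℂ} {η : ℝ}, ClosePairs B η f g f' g' →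
      HBPair (scatDiag f g) (scatDiag f' g') C η ∧ HBPair (scatOff f g) (scatOff f' g') C η ∧
      L2Pair (scatOff f g) (scatOff f' g') C η := by
  obtain ⟨C, hC, h⟩ := exists_jost_const hB
  refine ⟨4 * C * C + 4 * C * C, by positivity, fun {f g f' g' η} hc => ?_⟩
  have hη := hc.nonneg
  obtain ⟨a, b, b2⟩ := h hc
  obtain ⟨a', b', -⟩ := h hc.reflect.swap
  obtain ⟨r, s, s2⟩ := h hc.reflect
  refine ⟨(a.mul a').subPair (b.mul b'), (r.comp_neg.mul b).subPair (s.comp_neg.mul a), ?_⟩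
  have h1 := r.comp_neg.mul_l2 b2 hC hη
  have h2 := a.mul_l2 (s2.comp_mp continuous_neg measurePreserving_neg_real) hC hη
  have h3 := h1.subPair h2 (by positivity) (by positivity) hη
  refine L2Pair.mono ?_ hη (show 2 * C * C + 2 * C * C ≤ _ by nlinarith)
  convert h3 using 3
  · rw [scatOff]; ring
  · rw [scatOff]; ring

theorem diffPair_zero {B : ℝ} (hB : 0 ≤ B) :
    DiffPair B (fun _ => 0) (fun _ => 0) fun _ => 0 :=
  ⟨bddPair_zero hB, IsPrim.const 0, MemLp.zero', by simp, tendsto_const_nhds, tendsto_const_nhds⟩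

theorem jostR_zero : jostR (fun _ => 0) (fun _ => 0) = fun _ => 0 := by
  ext l
  have h := (bddPair_zero le_rfl).isJost
  have := (IsJost.unique (integrable_zero _ _ _) (integrable_zero _ _ _) h isJost_zero 0 l).2
  simp [jostR, jostB, this]

theorem continuous_jostR {B : ℝ} {f g : ℝ → ℂ} (h : BddPair B f g) : Continuous (jostR f g) := by
  have h1 : Continuous (jostA f g) := h.isJost.bc₁.continuous_right 0
  have h2 : Continuous (jostB f g) := h.isJost.bc₂.continuous_right 0
  unfold jostR
  fun_prop

theorem exists_jostR_const {B : ℝ} (hB : 0 ≤ B) : ∃ C : ℝ, 0 ≤ C ∧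
    ∀ {f g g₁ f' g' g₁' : ℝ → ℂ} {η : ℝ}, DiffPair B f g g₁ → DiffPair B f' g' g₁' →
      ClosePairs B η f g f' g' →
      eLpNorm (fun y => g₁ y - g₁' y) 2 volume ≤ ENNReal.ofReal η →
      L2Pair (jostR f g) (jostR f' g') C η := by
  have hK := decayConst_nonneg hB
  have hD := diffConst_nonneg hB
  obtain ⟨C, hC⟩ : ∃ C, C = 2 + 2 * decayConst B + 2 * diffConst B * B + 2 * decayConst B * B
        + diffConst B * B * B := ⟨_, rfl⟩
  have hC0 : 0 ≤ C := by rw [hC]; positivity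
  have single : ∀ {f g g₁ : ℝ → ℂ}, DiffPair B f g g₁ →
      eLpNorm (jostR f g) 2 volume ≤ ENNReal.ofReal (C * B) := fun {f g g₁} h => by
    have := eLpNorm_jostR_sub_le (η := B) h (diffPair_zero hB)
      ⟨h.bdd, bddPair_zero hB, by simpa using h.bdd.lef, by simpa using h.bdd.leg⟩
      (by simpa using h.le)
    rw [jostR_zero, ← hC] at this
    simpa using this
  refine ⟨C * B + C, by positivity, fun {f g g₁ f' g' g₁' η} h h' hc h₁ => ?_⟩
  have hη := hc.nonneg
  have := eLpNorm_jostR_sub_le h h' hc h₁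
  rw [← hC] at this
  have hCB : 0 ≤ C * B := by positivity
  exact ⟨continuous_jostR h.bdd, continuous_jostR h'.bdd,
    (single h).trans (ENNReal.ofReal_le_ofReal (by linarith)),
    (single h').trans (ENNReal.ofReal_le_ofReal (by linarith)),
    this.trans (ENNReal.ofReal_le_ofReal (by gcongr; linarith))⟩

/-- The boundary values g(0) in the two remainders enter with opposite signs, because reflection
changes the sign of the coefficient, and they multiply the same product of first components. So they
cancel, and only L² remainders are left. -/
theorem mul_scatOff (f g : ℝ → ℂ) (l : ℝ) :
    l * scatOff f g l = (1 / (2 * Complex.I)) * (jostA (reflect f) (reflect g) (-l) * jostR f g l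
      + jostA f g l * jostR (reflect f) (reflect g) (-l)) := by
  have h : (2 * Complex.I) ≠ 0 := by simp
  field_simp
  simp only [scatOff, jostR, reflect]
  push_cast
  rw [neg_zero]
  ring

theorem HBPair.const (c : ℂ) (η : ℝ) (hη : 0 ≤ η) :
    HBPair (fun _ => c) (fun _ => c) ‖c‖ η :=
  ⟨HB.const c, HB.const c, by simpa using (HB.const 0).mono (by simpa using by positivity)⟩

theorem exists_mul_scatOff_const {B : ℝ} (hB : 0 ≤ B) : ∃ C : ℝ, 0 ≤ C ∧
    ∀ {f g g₁ f' g' g₁' : ℝ → ℂ} {η : ℝ}, DiffPair B f g g₁ → DiffPair B f' g' g₁' →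
      ClosePairs B η f g f' g' →
      eLpNorm (fun y => g₁ y - g₁' y) 2 volume ≤ ENNReal.ofReal η →
      L2Pair (fun l => l * scatOff f g l) (fun l => l * scatOff f' g' l) C η := by
  obtain ⟨C, hC, h⟩ := exists_jost_const hB
  obtain ⟨D, hD, hR⟩ := exists_jostR_const hB
  refine ⟨2 * ‖(1 / (2 * Complex.I))‖ * (2 * C * D + 2 * C * D), by positivity,
    fun {f g g₁ f' g' g₁' η} hd hd' hc h₁ => ?_⟩
  have hη := hc.nonneg
  simp_rw [mul_scatOff]
  have h₁' : eLpNorm (fun y => g₁ (-y) - g₁' (-y)) 2 volume ≤ ENNReal.ofReal η :=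
    (eLpNorm_comp_neg_two (hd.mem.sub hd'.mem).1).trans_le h₁
  have k1 := (h hc.reflect).1.comp_neg.mul_l2 (hR hd hd' hc h₁) hD hη
  have k2 := (h hc).1.mul_l2 ((hR hd.reflect hd'.reflect hc.reflect h₁').comp_mp continuous_neg
    measurePreserving_neg_real) hD hη
  exact (HBPair.const _ η hη).mul_l2 (k1.add k2 (by positivity) (by positivity) hη)
    (by positivity) hη

/-- The reciprocal of the diagonal function stays in the algebra of bounded functions with L²
difference quotients, thanks to the lower bound c. The decay estimate needs it only as a bounded
multiplier. -/
theorem exists_scatQuot_const {B c : ℝ} (hB : 0 ≤ B) (hc : 0 < c) : ∃ C : ℝ, 0 ≤ C ∧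
    ∀ {f g f' g' : ℝ → ℂ} {η : ℝ}, ClosePairs B η f g f' g' →
      (∀ l, c ≤ ‖scatDiag f g l‖) → (∀ l, c ≤ ‖scatDiag f' g' l‖) →
      HBPair (scatQuot f g) (scatQuot f' g') C η ∧ L2Pair (scatQuot f g) (scatQuot f' g') C η ∧
      ∀ {g₁ g₁' : ℝ → ℂ}, DiffPair B f g g₁ → DiffPair B f' g' g₁' →
      eLpNorm (fun y => g₁ y - g₁' y) 2 volume ≤ ENNReal.ofReal η →
      L2Pair (fun l => l * scatQuot f g l) (fun l => l * scatQuot f' g' l) C η := by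
  obtain ⟨C, hC, h⟩ := exists_scat_const hB
  obtain ⟨D, hD, hR⟩ := exists_mul_scatOff_const hB
  set M := (c⁻¹ + C * c⁻¹ ^ 2) + 4 * C * (c⁻¹ + C * c⁻¹ ^ 2) ^ 2
  have hM : 0 ≤ M := by positivity
  refine ⟨4 * M * C + 2 * M * C + 2 * M * D, by positivity, fun {f g f' g' η} hcl ha ha' => ?_⟩
  have hη := hcl.nonneg
  obtain ⟨a, b, b2⟩ := h hcl
  have ai := a.inv hη hc ha ha'
  have hMC : 0 ≤ M * C := by positivity
  have hMD : 0 ≤ M * D := by positivity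
  refine ⟨(ai.mul b).mono hη (by linarith), (ai.mul_l2 b2 hC hη).mono hη (by linarith),
    fun {g₁ g₁'} hd hd' h₁ => ?_⟩
  have := (ai.mul_l2 (hR hd hd' hcl h₁) hD hη).mono hη
    (show _ ≤ 4 * M * C + 2 * M * C + 2 * M * D by linarith)
  have e : ∀ p q : ℝ → ℂ, (fun l : ℝ => (l : ℂ) * scatQuot p q l)
      = fun l => (scatDiag p q l)⁻¹ * (l * scatOff p q l) := fun p q => by
    ext l; rw [scatQuot]; ring
  rw [e, e]
  exact this

/-! ### Solutions of the linear system at a fixed spectral parameter -/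

/-- `(P₁, P₂)` solves `P₁' = a P₁ + b P₂`, `P₂' = 2 i l P₂ + c P₁ + d P₂`. -/
structure IsFlow (a b c d : ℝ → ℂ) (l : ℝ) (P₁ P₂ : ℝ → ℂ) : Prop where
  prim₁ : IsPrim P₁ fun x => a x * P₁ x + b x * P₂ x
  prim₂ : IsPrim P₂ fun x => 2 * Complex.I * l * P₂ x + (c x * P₁ x + d x * P₂ x)

/-- A bounded solution with limit `(1, 0)` at `-∞`. -/
structure IsMinus (a b c d : ℝ → ℂ) (l : ℝ) (P₁ P₂ : ℝ → ℂ) : Prop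
    extends IsFlow a b c d l P₁ P₂ where
  bdd₁ : ∃ M : ℝ, ∀ x, ‖P₁ x‖ ≤ M
  bdd₂ : ∃ M : ℝ, ∀ x, ‖P₂ x‖ ≤ M
  lim₁ : Tendsto P₁ atBot (𝓝 1)
  lim₂ : Tendsto P₂ atBot (𝓝 0)

/-- The integral form of the normalized solution. -/
structure IsVolterra (a b c d : ℝ → ℂ) (l : ℝ) (P₁ P₂ : ℝ → ℂ) : Prop where
  cont₁ : Continuous P₁
  cont₂ : Continuous P₂
  bdd₁ : ∃ M : ℝ, ∀ x, ‖P₁ x‖ ≤ M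
  bdd₂ : ∃ M : ℝ, ∀ x, ‖P₂ x‖ ≤ M
  eq₁ : ∀ x, P₁ x = 1 + ∫ y in Iic x, (a y * P₁ y + b y * P₂ y)
  eq₂ : ∀ x, P₂ x = ∫ y in Iic x, osc (l * (x - y)) * (c y * P₁ y + d y * P₂ y)

theorem integrable_mul_bdd {a P : ℝ → ℂ} (ha : Integrable a) (hc : Continuous P)
    (hb : ∃ M : ℝ, ∀ x, ‖P x‖ ≤ M) : Integrable fun y => a y * P y := by
  obtain ⟨M, hM⟩ := hb
  exact ha.mul_bdd hc.aestronglyMeasurable (Eventually.of_forall hM)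

theorem norm_osc_mul (s : ℝ) (z : ℂ) : ‖osc s * z‖ = ‖z‖ := by rw [norm_mul, norm_osc, one_mul]

theorem osc_mul_osc_neg (s : ℝ) (z : ℂ) : osc s * (osc (-s) * z) = z := by
  rw [← mul_assoc, ← osc_add, add_neg_cancel, osc_zero, one_mul]

theorem integrable_osc_mul {f : ℝ → ℂ} {s : ℝ → ℝ} (hf : Integrable f) (hs : Continuous s) :
    Integrable fun y => osc (s y) * f y :=
  hf.bdd_mul (c := 1) (continuous_osc.comp hs).aestronglyMeasurable
    (Eventually.of_forall fun _ => (norm_osc _).le)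

section

variable {a b c d : ℝ → ℂ} {l : ℝ} {P₁ P₂ Q₁ Q₂ : ℝ → ℂ}

theorem IsFlow.isPrim_osc_mul (h : IsFlow a b c d l P₁ P₂) :
    IsPrim (fun x => osc (-(l * x)) * P₂ x)
      fun x => osc (-(l * x)) * (c x * P₁ x + d x * P₂ x) :=
  ((isPrim_osc l).mul h.prim₂).congr_ae (Eventually.of_forall fun x => by dsimp only; ring)

/-- The differential form with limits at -∞ is the one that gauge transformations preserve, while
the integral form gives existence and uniqueness. This and its converse pass between the two. -/
theorem IsVolterra.isMinus (ha : Integrable a) (hb : Integrable b) (hc : Integrable c)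
    (hd : Integrable d) (h : IsVolterra a b c d l P₁ P₂) : IsMinus a b c d l P₁ P₂ := by
  have i1 := (integrable_mul_bdd ha h.cont₁ h.bdd₁).add (integrable_mul_bdd hb h.cont₂ h.bdd₂)
  have i2 := (integrable_mul_bdd hc h.cont₁ h.bdd₁).add (integrable_mul_bdd hd h.cont₂ h.bdd₂)
  have i3 := integrable_osc_mul (s := fun y => -(l * y)) i2 (by fun_prop)
  have e : ∀ x, P₂ x = osc (l * x) * (0 + ∫ y in Iic x, osc (-(l * y)) *
      (c y * P₁ y + d y * P₂ y)) := fun x => by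
    rw [zero_add, h.eq₂, ← integral_const_mul]
    congr 1; ext y
    rw [mul_sub, sub_eq_add_neg, osc_add, mul_assoc]
  have hG := IsPrim.of_Iic (F := fun x => osc (-(l * x)) * P₂ x) (c := 0) i3 fun x => by
    rw [e x, ← mul_assoc, ← osc_add, neg_add_cancel, osc_zero, one_mul]
    rfl
  refine ⟨⟨IsPrim.of_Iic i1 h.eq₁, ?_⟩, h.bdd₁, h.bdd₂, ?_, ?_⟩
  · have := (isPrim_osc (-l)).mul hG
    simp only [neg_mul, neg_neg, osc_mul_osc_neg] at this
    refine this.congr_ae (Eventually.of_forall fun x => ?_)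
    dsimp only [Pi.add_apply]
    have := osc_mul_osc_neg (l * x) (P₂ x)
    push_cast
    linear_combination (2 * Complex.I * l) * this
  · have := (tendsto_integral_Iic_atBot i1).const_add 1
    rw [add_zero] at this
    exact this.congr fun x => (h.eq₁ x).symm
  · refine squeeze_zero_norm (fun x => ?_) ((tendsto_integral_Iic_atBot i3).norm.trans
      (by rw [norm_zero]))
    rw [e x, norm_osc_mul, zero_add]
    rfl

theorem IsMinus.isVolterra (ha : Integrable a) (hb : Integrable b) (hc : Integrable c)
    (hd : Integrable d) (h : IsMinus a b c d l P₁ P₂) : IsVolterra a b c d l P₁ P₂ := by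
  have c1 := h.prim₁.continuous
  have c2 := h.prim₂.continuous
  have i1 := (integrable_mul_bdd ha c1 h.bdd₁).add (integrable_mul_bdd hb c2 h.bdd₂)
  have i2 := (integrable_mul_bdd hc c1 h.bdd₁).add (integrable_mul_bdd hd c2 h.bdd₂)
  refine ⟨c1, c2, h.bdd₁, h.bdd₂, h.prim₁.eq_integral_Iic i1 h.lim₁, fun x => ?_⟩
  have h0 : Tendsto (fun x => osc (-(l * x)) * P₂ x) atBot (𝓝 0) := by
    refine squeeze_zero_norm (fun x => (norm_osc_mul _ _).le) ?_
    simpa using h.lim₂.norm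
  have := h.isPrim_osc_mul.eq_integral_Iic
    (integrable_osc_mul (s := fun y => -(l * y)) i2 (by fun_prop)) h0 x
  rw [zero_add] at this
  rw [← osc_mul_osc_neg (l * x) (P₂ x), this, ← integral_const_mul]
  congr 1; ext y
  rw [mul_sub, sub_eq_add_neg, osc_add, mul_assoc]

theorem IsBC.of_fst {P : ℝ → ℂ} (hc : Continuous P) (hb : ∃ M : ℝ, ∀ x, ‖P x‖ ≤ M) :
    IsBC fun x _ => P x :=
  ⟨hc.comp continuous_fst, hb.imp fun _ h x _ => h x⟩

theorem IsVolterra.volt_eqs (ha : Integrable a) (hb : Integrable b) (hc : Integrable c)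
    (hd : Integrable d) (h : IsVolterra a b c d l P₁ P₂) (x : ℝ) :
    P₁ x = 1 + (volt 0 a (fun x _ => P₁ x) x l + volt 0 b (fun x _ => P₂ x) x l) ∧
    P₂ x = 0 + (volt 1 c (fun x _ => P₁ x) x l + volt 1 d (fun x _ => P₂ x) x l) := by
  have b1 := IsBC.of_fst h.cont₁ h.bdd₁
  have b2 := IsBC.of_fst h.cont₂ h.bdd₂
  constructor
  · rw [h.eq₁ x, volt, volt, ← integral_add (volt_integrable 0 ha b1 x l).integrableOn
      (volt_integrable 0 hb b2 x l).integrableOn]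
    congr 2; ext y; simp
  · rw [h.eq₂ x, volt, volt, zero_add, ← integral_add (volt_integrable 1 hc b1 x l).integrableOn
      (volt_integrable 1 hd b2 x l).integrableOn]
    congr 1; ext y; rw [one_mul]; ring

theorem IsMinus.unique (ha : Integrable a) (hb : Integrable b) (hc : Integrable c)
    (hd : Integrable d) (h : IsMinus a b c d l P₁ P₂) (h' : IsMinus a b c d l Q₁ Q₂) (x : ℝ) :
    P₁ x = Q₁ x ∧ P₂ x = Q₂ x := by
  have v := h.isVolterra ha hb hc hd
  have v' := h'.isVolterra ha hb hc hd
  exact volt_unique ha hb hc hd (IsBC.of_fst v.cont₁ v.bdd₁) (IsBC.of_fst v.cont₂ v.bdd₂)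
    (IsBC.of_fst v'.cont₁ v'.bdd₁) (IsBC.of_fst v'.cont₂ v'.bdd₂)
    (fun x => (v.volt_eqs ha hb hc hd x).1) (fun x => (v.volt_eqs ha hb hc hd x).2)
    (fun x => (v'.volt_eqs ha hb hc hd x).1) (fun x => (v'.volt_eqs ha hb hc hd x).2) x

theorem IsSol.isVolterra {q₁ q₂ : ℝ → ℝ → ℂ} (ha : Integrable a) (hb : Integrable b)
    (hc : Integrable c) (hd : Integrable d) (h : IsSol a b c d q₁ q₂) (l : ℝ) :
    IsVolterra a b c d l (fun x => q₁ x l) fun x => q₂ x l := by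
  refine ⟨h.bc₁.continuous_left l, h.bc₂.continuous_left l, h.bc₁.bdd.imp fun _ h x => h x l,
    h.bc₂.bdd.imp fun _ h x => h x l, fun x => ?_, fun x => ?_⟩
  · rw [h.eq₁ x, volt, volt, ← integral_add (volt_integrable 0 ha h.bc₁ x l).integrableOn
      (volt_integrable 0 hb h.bc₂ x l).integrableOn]
    congr 2; ext y; simp
  · rw [h.eq₂ x, volt, volt, ← integral_add (volt_integrable 1 hc h.bc₁ x l).integrableOn
      (volt_integrable 1 hd h.bc₂ x l).integrableOn]
    congr 1; ext y; rw [one_mul]; ring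

theorem exists_isVolterra (ha : Integrable a) (hb : Integrable b)
    (hc : Integrable c) (hd : Integrable d) (l : ℝ) : ∃ P₁ P₂, IsVolterra a b c d l P₁ P₂ := by
  obtain ⟨q₁, q₂, h⟩ := exists_isSol ha hb hc hd
  exact ⟨_, _, h.isVolterra ha hb hc hd l⟩

theorem isMinus_jost {f g : ℝ → ℂ} (hf : Integrable f) (hg : Integrable g) (l : ℝ) :
    IsMinus (fun _ => 0) f g (fun _ => 0) l (fun x => (jost f g).1 x l)
      fun x => (jost f g).2 x l := by
  have h0 : Integrable (fun _ : ℝ => (0 : ℂ)) := integrable_zero _ _ _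
  have h := isJost_jost hf hg
  have hs : IsSol (fun _ => 0) f g (fun _ => 0) (jost f g).1 (jost f g).2 :=
    ⟨h.bc₁, h.bc₂, fun x l => by rw [h.eq₁ x]; simp, fun x l => by rw [h.eq₂ x]; simp⟩
  exact (hs.isVolterra h0 hf hg h0 l).isMinus h0 hf hg h0

theorem IsMinus.eq_jost {f g : ℝ → ℂ} (hf : Integrable f) (hg : Integrable g)
    (h : IsMinus (fun _ => 0) f g (fun _ => 0) l P₁ P₂) :
    P₁ 0 = jostA f g l ∧ P₂ 0 = jostB f g l := by
  have h0 : Integrable (fun _ : ℝ => (0 : ℂ)) := integrable_zero _ _ _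
  exact h.unique h0 hf hg h0 (isMinus_jost hf hg l) 0

/-- Reversal of the line changes the sign of the coefficients and of l, and turns solutions
normalized at +∞ into solutions normalized at -∞. -/
theorem IsFlow.reflect (h : IsFlow a b c d l P₁ P₂) :
    IsFlow (reflect a) (reflect b) (reflect c) (reflect d) (-l) (fun x => P₁ (-x))
      fun x => P₂ (-x) := by
  refine ⟨h.prim₁.comp_neg.congr_ae (Eventually.of_forall fun x => ?_),
    h.prim₂.comp_neg.congr_ae (Eventually.of_forall fun x => ?_)⟩
  · simp only [_root_.reflect]; ring
  · simp only [_root_.reflect]; push_cast; ring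

/-- The gauge with matrix [[1, 0], [t, κ]]. The conditions on a and b say that the first row is f
times the new second component. In the second row the coefficient κd + tb of P₂ then vanishes, and
`g` is what remains in front of P₁. -/
theorem IsFlow.lower {f g t t' : ℝ → ℂ} {κ : ℂ} (h : IsFlow a b c d l P₁ P₂) (ht : IsPrim t t')
    (ha : ∀ x, a x = f x * t x) (hb : ∀ x, b x = f x * κ) (hd : ∀ x, d x = -a x)
    (hg : ∀ x, g x = κ * c x - 2 * Complex.I * l * t x + t' x + t x * a x) :
    IsFlow (fun _ => 0) f g (fun _ => 0) l P₁ fun x => κ * P₂ x + t x * P₁ x := by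
  refine ⟨h.prim₁.congr_ae (Eventually.of_forall fun x => ?_),
    ((h.prim₂.const_mul κ).add (ht.mul h.prim₁)).congr_ae (Eventually.of_forall fun x => ?_)⟩
  · dsimp only; rw [ha, hb]; ring
  · dsimp only; rw [hg, hd, ha, hb]; ring

/-- The gauge with matrix [[1, t/κ], [0, 1/κ]], which clears the diagonal from the other side. -/
theorem IsFlow.upper {f g t t' : ℝ → ℂ} {κ : ℂ} (hκ : κ ≠ 0) (h : IsFlow a b c d l P₁ P₂)
    (ht : IsPrim t t') (hd : ∀ x, d x = g x * t x) (hc : ∀ x, c x = g x * κ)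
    (ha : ∀ x, a x = -d x)
    (hf : ∀ x, f x = κ * b x + t' x + 2 * Complex.I * l * t x + t x * d x) :
    IsFlow (fun _ => 0) f g (fun _ => 0) l (fun x => P₁ x + t x * (κ⁻¹ * P₂ x))
      fun x => κ⁻¹ * P₂ x := by
  have h2 := h.prim₂.const_mul κ⁻¹
  refine ⟨(h.prim₁.add (ht.mul h2)).congr_ae (Eventually.of_forall fun x => ?_),
    h2.congr_ae (Eventually.of_forall fun x => ?_)⟩
  · dsimp only; rw [hf, ha, hd, hc]; field_simp; ring
  · dsimp only; rw [hd, hc]; field_simp; ring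

end

/-! ### Potentials and their gauge transformations -/

/-- An integrable derivative forces a limit at infinity, and integrability of F forces that limit to
be zero. -/
theorem tendsto_zero_of_integrable {F f : ℝ → ℂ} (hp : IsPrim F f) (hF : Integrable F)
    (hf : Integrable f) : Tendsto F atTop (𝓝 0) := by
  have h1 := intervalIntegral_tendsto_integral_Ioi 0 hf.integrableOn tendsto_id
  have h2 : Tendsto F atTop (𝓝 (F 0 + ∫ x in Ioi 0, f x)) := by
    refine (h1.const_add (F 0)).congr fun x => ?_
    rw [← hp.2, id]; ring
  have h3 := IntegrableAtFilter.eq_zero_of_tendsto (μ := volume)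
    (hF.integrableAtFilter atTop) (fun s hs => ?_) h2
  · rwa [h3] at h2
  · obtain ⟨b, hb⟩ := mem_atTop_sets.1 hs
    rw [← top_le_iff, ← Real.volume_Ici (a := b)]
    exact measure_mono hb

/-- A continuous potential `U ∈ L^{2,1}` with derivative `U₁ ∈ L^{2,1}`. -/
structure IsPotential (U U₁ : ℝ → ℂ) : Prop where
  mem : MemL21 U
  mem₁ : MemL21 U₁
  prim : IsPrim U U₁

/-- The diagonal coefficient of the spectral problem. -/
noncomputable def diagCoeff (U : ℝ → ℂ) (y : ℝ) : ℂ := Complex.I / 2 * (U y * conj (U y))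

theorem ofReal_norm_sq (z : ℂ) : ((‖z‖ ^ 2 : ℝ) : ℂ) = z * conj z := by
  rw [Complex.mul_conj, Complex.normSq_eq_norm_sq]

namespace IsPotential

variable {U U₁ : ℝ → ℂ}

theorem tendsto_atTop (h : IsPotential U U₁) : Tendsto U atTop (𝓝 0) :=
  tendsto_zero_of_integrable h.prim h.mem.integrable h.mem₁.integrable

theorem comp_neg (h : IsPotential U U₁) : IsPotential (fun x => U (-x)) fun x => -U₁ (-x) := by
  refine ⟨?_, MemL21.reflect h.mem₁, h.prim.comp_neg⟩
  simpa [reflect] using (MemL21.of_norm_le (K := 1) (g := fun x => -reflect U x) h.mem.reflect.memLp.1.neg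
    h.mem.reflect (Eventually.of_forall fun x => by simp))

theorem tendsto_atBot (h : IsPotential U U₁) : Tendsto U atBot (𝓝 0) := by
  simpa [Function.comp_def] using h.comp_neg.tendsto_atTop.comp tendsto_neg_atBot_atTop

theorem eq_integral (h : IsPotential U U₁) (x : ℝ) : U x = ∫ y in Iic x, U₁ y := by
  simpa using h.prim.eq_integral_Iic h.mem₁.integrable h.tendsto_atBot x

theorem norm_le (h : IsPotential U U₁) (x : ℝ) : ‖U x‖ ≤ 2 * l21Norm U₁ := by
  rw [h.eq_integral]
  refine (norm_integral_le_integral_norm _).trans ?_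
  exact (setIntegral_le_integral h.mem₁.integrable.norm
    (Eventually.of_forall fun _ => norm_nonneg _)).trans h.mem₁.integral_norm_le

theorem bdd (h : IsPotential U U₁) : ∃ M : ℝ, ∀ x, ‖U x‖ ≤ M := ⟨_, h.norm_le⟩

theorem bdd_conj (h : IsPotential U U₁) : ∃ M : ℝ, ∀ x, ‖conj (U x)‖ ≤ M :=
  ⟨_, fun x => by rw [RCLike.norm_conj]; exact h.norm_le x⟩

theorem continuous (h : IsPotential U U₁) : Continuous U := h.prim.continuous

theorem continuous_conj (h : IsPotential U U₁) : Continuous fun x => conj (U x) :=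
  Complex.continuous_conj.comp h.continuous

theorem integrable_conj (h : IsPotential U U₁) : Integrable fun x => conj (U x) :=
  h.mem.integrable.mono h.continuous_conj.aestronglyMeasurable
    (Eventually.of_forall fun x => by rw [RCLike.norm_conj])

theorem integrable_diagCoeff (h : IsPotential U U₁) : Integrable (diagCoeff U) :=
  (integrable_mul_bdd h.mem.integrable h.continuous_conj h.bdd_conj).const_mul _

theorem integrable_const_mul (h : IsPotential U U₁) (k : ℂ) : Integrable fun x => k * U x :=
  h.mem.integrable.const_mul k

theorem integrable_const_mul_conj (h : IsPotential U U₁) (k : ℂ) :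
    Integrable fun x => k * conj (U x) :=
  h.integrable_conj.const_mul k

end IsPotential

theorem integrable_reflect {f : ℝ → ℂ} (hf : Integrable f) : Integrable (reflect f) :=
  hf.comp_neg.neg

theorem reflect_reflect (f : ℝ → ℂ) : reflect (reflect f) = f := by ext x; simp [reflect]

theorem phase_eq_osc {k : ℂ} {z : ℝ} (hk : k ^ 2 = z) (s : ℝ) : phase k s = osc ((z + 1) * s) := by
  rw [phase, osc, hk]; push_cast; ring_nf

theorem bdd_apply {f : ℝ → Fin 2 → ℂ} (h : ∃ M : ℝ, ∀ x, ‖f x‖ ≤ M) (i : Fin 2) :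
    ∃ M : ℝ, ∀ x, ‖f x i‖ ≤ M := by
  obtain ⟨M, hM⟩ := h
  exact ⟨M, fun x => (norm_le_pi_norm (f x) i).trans (hM x)⟩

theorem mulVec_diagonal_coeffMatrix (U : ℝ → ℂ) (k p q : ℂ) (y : ℝ) (v : Fin 2 → ℂ) :
    (Matrix.diagonal ![p, q] * coeffMatrix U k y).mulVec v =
      ![p * (diagCoeff U y * v 0 + k * U y * v 1),
        q * (-k * conj (U y) * v 0 + -diagCoeff U y * v 1)] := by
  ext i
  fin_cases i <;>
  · simp [coeffMatrix, Matrix.mulVec, dotProduct, Fin.sum_univ_two, Matrix.diagonal_mul, diagCoeff,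
      -Complex.ofReal_pow, ofReal_norm_sq]
    ring

theorem integral_mulVec {U U₁ : ℝ → ℂ} (hU : IsPotential U U₁) (k : ℂ) {f : ℝ → Fin 2 → ℂ}
    (hc : Continuous f) (hb : ∃ M : ℝ, ∀ x, ‖f x‖ ≤ M) {s₀ s₁ : ℝ → ℝ} (h₀ : Continuous s₀)
    (h₁ : Continuous s₁) (S : Set ℝ) :
    ∫ y in S, (Matrix.diagonal ![osc (s₀ y), osc (s₁ y)] * coeffMatrix U k y).mulVec (f y) =
      ![∫ y in S, osc (s₀ y) * (diagCoeff U y * f y 0 + k * U y * f y 1),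
        ∫ y in S, osc (s₁ y) * (-k * conj (U y) * f y 0 + -diagCoeff U y * f y 1)] := by
  have c := fun i => (continuous_apply i).comp hc
  have b := bdd_apply hb
  have i0 := integrable_osc_mul ((integrable_mul_bdd hU.integrable_diagCoeff (c 0) (b 0)).add
    (integrable_mul_bdd (hU.integrable_const_mul k) (c 1) (b 1))) h₀
  have i1 := integrable_osc_mul ((integrable_mul_bdd (hU.integrable_const_mul_conj (-k)) (c 0)
    (b 0)).add (integrable_mul_bdd hU.integrable_diagCoeff.neg (c 1) (b 1))) h₁
  simp_rw [mulVec_diagonal_coeffMatrix]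
  ext i
  rw [eval_integral fun j => ?_]
  · fin_cases i <;> rfl
  · fin_cases j
    · exact i0.integrableOn
    · exact i1.integrableOn

theorem continuous_fin_two {f : ℝ → Fin 2 → ℂ} (h₀ : Continuous fun x => f x 0)
    (h₁ : Continuous fun x => f x 1) : Continuous f :=
  continuous_pi fun i => by fin_cases i; exacts [h₀, h₁]

theorem bdd_fin_two {f : ℝ → Fin 2 → ℂ} (h₀ : ∃ M : ℝ, ∀ x, ‖f x 0‖ ≤ M)
    (h₁ : ∃ M : ℝ, ∀ x, ‖f x 1‖ ≤ M) : ∃ M : ℝ, ∀ x, ‖f x‖ ≤ M := by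
  obtain ⟨M, hM⟩ := h₀
  obtain ⟨N, hN⟩ := h₁
  refine ⟨max M N, fun x => (pi_norm_le_iff_of_nonneg
    ((norm_nonneg _).trans ((hM x).trans (le_max_left _ _)))).2 fun i => ?_⟩
  fin_cases i
  exacts [(hM x).trans (le_max_left _ _), (hN x).trans (le_max_right _ _)]

theorem bdd_comp_neg {P : ℝ → ℂ} (h : ∃ M : ℝ, ∀ x, ‖P (-x)‖ ≤ M) : ∃ M : ℝ, ∀ x, ‖P x‖ ≤ M :=
  h.imp fun M h x => by simpa using h (-x)

theorem continuous_comp_neg {P : ℝ → ℂ} (h : Continuous fun x => P (-x)) : Continuous P := by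
  simpa [Function.comp_def] using h.comp continuous_neg

theorem fin_two_ext_iff (v w : Fin 2 → ℂ) : v = w ↔ v 0 = w 0 ∧ v 1 = w 1 := by
  rw [funext_iff, Fin.forall_fin_two]

section

variable {U U₁ : ℝ → ℂ} {k : ℂ} {z : ℝ}

theorem isVarphiMinus_iff (hU : IsPotential U U₁) (hk : k ^ 2 = z) (f : ℝ → Fin 2 → ℂ) :
    IsVarphiMinus U k f ↔ IsVolterra (diagCoeff U) (fun y => k * U y) (fun y => -k * conj (U y))
      (fun y => -diagCoeff U y) (z + 1) (fun x => f x 0) fun x => f x 1 := by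
  have key : ∀ (_ : Continuous f) (_ : ∃ M : ℝ, ∀ x, ‖f x‖ ≤ M) (x : ℝ),
      (f x = ![1, 0] + ∫ y in Iic x, (Matrix.diagonal ![1, phase k (x - y)] *
        coeffMatrix U k y).mulVec (f y)) ↔
      (f x 0 = 1 + ∫ y in Iic x, (diagCoeff U y * f y 0 + k * U y * f y 1)) ∧
      f x 1 = ∫ y in Iic x, osc ((z + 1) * (x - y)) *
        (-k * conj (U y) * f y 0 + -diagCoeff U y * f y 1) := fun hc hb x => by
    have := integral_mulVec hU k hc hb (s₀ := fun _ => 0) (s₁ := fun y => (z + 1) * (x - y))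
      (by fun_prop) (by fun_prop) (Iic x)
    simp only [osc_zero, one_mul] at this
    simp_rw [phase_eq_osc hk, this, fin_two_ext_iff]
    simp
  constructor
  · rintro ⟨hc, hb, h⟩
    exact ⟨(continuous_apply 0).comp hc, (continuous_apply 1).comp hc, bdd_apply hb 0,
      bdd_apply hb 1, fun x => ((key hc hb x).1 (h x)).1, fun x => ((key hc hb x).1 (h x)).2⟩
  · intro h
    have hc := continuous_fin_two h.cont₁ h.cont₂
    have hb := bdd_fin_two h.bdd₁ h.bdd₂
    exact ⟨hc, hb, fun x => (key hc hb x).2 ⟨h.eq₁ x, h.eq₂ x⟩⟩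

/-- Reversal of the line moves the normalization from +∞ to -∞, so one theory of left Jost solutions
is enough. The parameter becomes -(z + 1). -/
theorem isVarphiPlus_iff (hU : IsPotential U U₁) (hk : k ^ 2 = z) (f : ℝ → Fin 2 → ℂ) :
    IsVarphiPlus U k f ↔ IsVolterra (reflect (diagCoeff U)) (reflect fun y => k * U y)
      (reflect fun y => -k * conj (U y)) (reflect fun y => -diagCoeff U y) (-(z + 1))
      (fun x => f (-x) 0) fun x => f (-x) 1 := by
  have key : ∀ (_ : Continuous f) (_ : ∃ M : ℝ, ∀ x, ‖f x‖ ≤ M) (x : ℝ),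
      (f (-x) = ![1, 0] - ∫ y in Ioi (-x), (Matrix.diagonal ![1, phase k (-x - y)] *
        coeffMatrix U k y).mulVec (f y)) ↔
      (f (-x) 0 = 1 + ∫ y in Iic x, (reflect (diagCoeff U) y * f (-y) 0
        + reflect (fun y => k * U y) y * f (-y) 1)) ∧
      f (-x) 1 = ∫ y in Iic x, osc (-(z + 1) * (x - y)) *
        (reflect (fun y => -k * conj (U y)) y * f (-y) 0
          + reflect (fun y => -diagCoeff U y) y * f (-y) 1) := fun hc hb x => by
    have := integral_mulVec hU k hc hb (s₀ := fun _ => 0) (s₁ := fun y => (z + 1) * (-x - y))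
      (by fun_prop) (by fun_prop) (Ioi (-x))
    simp only [osc_zero, one_mul] at this
    have e0 : ∫ y in Iic x, (reflect (diagCoeff U) y * f (-y) 0
        + reflect (fun y => k * U y) y * f (-y) 1)
        = -∫ y in Ioi (-x), (diagCoeff U y * f y 0 + k * U y * f y 1) := by
      rw [← integral_comp_neg_Iic, ← integral_neg]
      congr 1; ext y; simp only [reflect]; ring
    have e1 : ∫ y in Iic x, osc (-(z + 1) * (x - y)) *
        (reflect (fun y => -k * conj (U y)) y * f (-y) 0
          + reflect (fun y => -diagCoeff U y) y * f (-y) 1)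
        = -∫ y in Ioi (-x), osc ((z + 1) * (-x - y)) *
          (-k * conj (U y) * f y 0 + -diagCoeff U y * f y 1) := by
      rw [← integral_comp_neg_Iic, ← integral_neg]
      congr 1; ext y
      have : (z + 1) * (-x - -y) = -(z + 1) * (x - y) := by ring
      rw [this]; simp only [reflect]; ring
    simp_rw [phase_eq_osc hk, this, fin_two_ext_iff, e0, e1]
    simp [sub_eq_add_neg]
  constructor
  · rintro ⟨hc, hb, h⟩
    exact ⟨((continuous_apply 0).comp hc).comp continuous_neg,
      ((continuous_apply 1).comp hc).comp continuous_neg, (bdd_apply hb 0).imp fun M h x => h _,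
      (bdd_apply hb 1).imp fun M h x => h _, fun x => ((key hc hb x).1 (h _)).1,
      fun x => ((key hc hb x).1 (h _)).2⟩
  · intro h
    have hc := continuous_fin_two (continuous_comp_neg h.cont₁) (continuous_comp_neg h.cont₂)
    have hb := bdd_fin_two (bdd_comp_neg h.bdd₁) (bdd_comp_neg h.bdd₂)
    refine ⟨hc, hb, fun x => ?_⟩
    have := (key hc hb (-x)).2 ⟨h.eq₁ _, h.eq₂ _⟩
    simpa only [neg_neg] using this

/-- Besides reversing the line the two components are exchanged, so that e₂ becomes (1, 0). The sign
of the parameter changes twice and remains z + 1. -/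
theorem isPhiPlus_iff (hU : IsPotential U U₁) (hk : k ^ 2 = z) (f : ℝ → Fin 2 → ℂ) :
    IsPhiPlus U k f ↔ IsVolterra (reflect fun y => -diagCoeff U y)
      (reflect fun y => -k * conj (U y)) (reflect fun y => k * U y) (reflect (diagCoeff U)) (z + 1)
      (fun x => f (-x) 1) fun x => f (-x) 0 := by
  have key : ∀ (_ : Continuous f) (_ : ∃ M : ℝ, ∀ x, ‖f x‖ ≤ M) (x : ℝ),
      (f (-x) = ![0, 1] - ∫ y in Ioi (-x), (Matrix.diagonal ![phase k (-(-x - y)), 1] *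
        coeffMatrix U k y).mulVec (f y)) ↔
      (f (-x) 0 = ∫ y in Iic x, osc ((z + 1) * (x - y)) *
        (reflect (fun y => k * U y) y * f (-y) 1 + reflect (diagCoeff U) y * f (-y) 0)) ∧
      f (-x) 1 = 1 + ∫ y in Iic x,
        (reflect (fun y => -diagCoeff U y) y * f (-y) 1
          + reflect (fun y => -k * conj (U y)) y * f (-y) 0) := fun hc hb x => by
    have := integral_mulVec hU k hc hb (s₁ := fun _ => 0) (s₀ := fun y => (z + 1) * -(-x - y))
      (by fun_prop) (by fun_prop) (Ioi (-x))
    simp only [osc_zero, one_mul] at this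
    have e0 : ∫ y in Iic x, osc ((z + 1) * (x - y)) *
        (reflect (fun y => k * U y) y * f (-y) 1 + reflect (diagCoeff U) y * f (-y) 0)
        = -∫ y in Ioi (-x), osc ((z + 1) * -(-x - y)) *
          (diagCoeff U y * f y 0 + k * U y * f y 1) := by
      rw [← integral_comp_neg_Iic, ← integral_neg]
      congr 1; ext y
      have : (z + 1) * -(-x - -y) = (z + 1) * (x - y) := by ring
      rw [this]; simp only [reflect]; ring
    have e1 : ∫ y in Iic x, (reflect (fun y => -diagCoeff U y) y * f (-y) 1
          + reflect (fun y => -k * conj (U y)) y * f (-y) 0)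
        = -∫ y in Ioi (-x), (-k * conj (U y) * f y 0 + -diagCoeff U y * f y 1) := by
      rw [← integral_comp_neg_Iic, ← integral_neg]
      congr 1; ext y; simp only [reflect]; ring
    simp_rw [phase_eq_osc hk, this, fin_two_ext_iff, e0, e1]
    simp [sub_eq_add_neg]
  constructor
  · rintro ⟨hc, hb, h⟩
    exact ⟨((continuous_apply 1).comp hc).comp continuous_neg,
      ((continuous_apply 0).comp hc).comp continuous_neg, (bdd_apply hb 1).imp fun M h x => h _,
      (bdd_apply hb 0).imp fun M h x => h _, fun x => ((key hc hb x).1 (h _)).2,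
      fun x => ((key hc hb x).1 (h _)).1⟩
  · intro h
    have hc := continuous_fin_two (continuous_comp_neg h.cont₂) (continuous_comp_neg h.cont₁)
    have hb := bdd_fin_two (bdd_comp_neg h.bdd₂) (bdd_comp_neg h.bdd₁)
    refine ⟨hc, hb, fun x => ?_⟩
    have := (key hc hb (-x)).2 ⟨h.eq₂ _, h.eq₁ _⟩
    simpa only [neg_neg] using this

end

/-! ### Gauge transformations of normalized solutions -/

theorem tendsto_mul_zero_of_bdd {s P : ℝ → ℂ} {F : Filter ℝ} (hs : Tendsto s F (𝓝 0))
    (hP : ∃ M : ℝ, ∀ x, ‖P x‖ ≤ M) : Tendsto (fun x => s x * P x) F (𝓝 0) := by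
  obtain ⟨M, hM⟩ := hP
  have : Tendsto (fun x => ‖s x‖ * M) F (𝓝 0) := by simpa using hs.norm.mul_const M
  refine squeeze_zero_norm (fun x => ?_) this
  rw [norm_mul]
  gcongr
  exact hM x

theorem bdd_add {P Q : ℝ → ℂ} (hP : ∃ M : ℝ, ∀ x, ‖P x‖ ≤ M) (hQ : ∃ M : ℝ, ∀ x, ‖Q x‖ ≤ M) :
    ∃ M : ℝ, ∀ x, ‖P x + Q x‖ ≤ M := by
  obtain ⟨M, hM⟩ := hP
  obtain ⟨N, hN⟩ := hQ
  exact ⟨M + N, fun x => (norm_add_le _ _).trans (add_le_add (hM x) (hN x))⟩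

theorem bdd_mul {P Q : ℝ → ℂ} (hP : ∃ M : ℝ, ∀ x, ‖P x‖ ≤ M) (hQ : ∃ M : ℝ, ∀ x, ‖Q x‖ ≤ M) :
    ∃ M : ℝ, ∀ x, ‖P x * Q x‖ ≤ M := by
  obtain ⟨M, hM⟩ := hP
  obtain ⟨N, hN⟩ := hQ
  refine ⟨M * N, fun x => ?_⟩
  rw [norm_mul]
  exact mul_le_mul (hM x) (hN x) (norm_nonneg _) ((norm_nonneg _).trans (hM x))

theorem bdd_const (c : ℂ) : ∃ M : ℝ, ∀ _ : ℝ, ‖c‖ ≤ M := ⟨_, fun _ => le_rfl⟩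

section

variable {a b c d : ℝ → ℂ} {l : ℝ} {P₁ P₂ : ℝ → ℂ}

theorem IsMinus.lower {f g t t' : ℝ → ℂ} {κ : ℂ} (h : IsMinus a b c d l P₁ P₂) (ht : IsPrim t t')
    (tb : ∃ M : ℝ, ∀ x, ‖t x‖ ≤ M) (tl : Tendsto t atBot (𝓝 0))
    (ha : ∀ x, a x = f x * t x) (hb : ∀ x, b x = f x * κ) (hd : ∀ x, d x = -a x)
    (hg : ∀ x, g x = κ * c x - 2 * Complex.I * l * t x + t' x + t x * a x) :
    IsMinus (fun _ => 0) f g (fun _ => 0) l P₁ fun x => κ * P₂ x + t x * P₁ x := by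
  refine ⟨h.toIsFlow.lower ht ha hb hd hg, h.bdd₁,
    bdd_add (bdd_mul (bdd_const κ) h.bdd₂) (bdd_mul tb h.bdd₁), h.lim₁, ?_⟩
  simpa using (h.lim₂.const_mul κ).add (tendsto_mul_zero_of_bdd tl h.bdd₁)

theorem IsMinus.upper {f g t t' : ℝ → ℂ} {κ : ℂ} (hκ : κ ≠ 0) (h : IsMinus a b c d l P₁ P₂)
    (ht : IsPrim t t') (tb : ∃ M : ℝ, ∀ x, ‖t x‖ ≤ M) (tl : Tendsto t atBot (𝓝 0))
    (hd : ∀ x, d x = g x * t x) (hc : ∀ x, c x = g x * κ) (ha : ∀ x, a x = -d x)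
    (hf : ∀ x, f x = κ * b x + t' x + 2 * Complex.I * l * t x + t x * d x) :
    IsMinus (fun _ => 0) f g (fun _ => 0) l (fun x => P₁ x + t x * (κ⁻¹ * P₂ x))
      fun x => κ⁻¹ * P₂ x := by
  have b2 := bdd_mul (bdd_const κ⁻¹) h.bdd₂
  refine ⟨h.toIsFlow.upper hκ ht hd hc ha hf, bdd_add h.bdd₁ (bdd_mul tb b2), b2, ?_, ?_⟩
  · simpa using h.lim₁.add (tendsto_mul_zero_of_bdd tl b2)
  · simpa using h.lim₂.const_mul κ⁻¹

/-- Two solutions of the same system have a Wronskian with explicit evolution. -/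
theorem IsFlow.wronskian {Q₁ Q₂ : ℝ → ℂ} (h : IsFlow a b c d l P₁ P₂)
    (h' : IsFlow a b c d l Q₁ Q₂) (hd : ∀ x, d x = -a x) :
    IsPrim (fun x => osc (-(l * x)) * (P₁ x * Q₂ x - P₂ x * Q₁ x)) fun _ => 0 := by
  refine ((isPrim_osc l).mul ((h.prim₁.mul h'.prim₂).sub (h.prim₂.mul h'.prim₁))).congr_ae
    (Eventually.of_forall fun x => ?_)
  dsimp only
  rw [hd]; ring

/-- A solution and a solution of the system with exchanged components have a constant
Wronskian. -/
theorem IsFlow.wronskian_swap {Q₁ Q₂ : ℝ → ℂ} (h : IsFlow a b c d l P₁ P₂)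
    (h' : IsFlow d c b a (-l) Q₂ Q₁) (hd : ∀ x, d x = -a x) :
    IsPrim (fun x => P₁ x * Q₂ x - P₂ x * Q₁ x) fun _ => 0 := by
  refine ((h.prim₁.mul h'.prim₁).sub (h.prim₂.mul h'.prim₂)).congr_ae
    (Eventually.of_forall fun x => ?_)
  dsimp only
  rw [hd]; push_cast; ring

/-- Here s = 1 corresponds to real k and s = -1 to imaginary k, by conj k = s k. The coefficient
matrix is skew-adjoint for the form |P₁|² + s|P₂|², which is therefore conserved. -/
theorem IsFlow.energy {s : ℂ} (hs : s ^ 2 = 1) (hs' : conj s = s) (h : IsFlow a b c d l P₁ P₂)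
    (ha : ∀ x, conj (a x) = -a x) (hd : ∀ x, d x = -a x) (hc : ∀ x, c x = -s * conj (b x)) :
    IsPrim (fun x => P₁ x * conj (P₁ x) + s * (P₂ x * conj (P₂ x))) fun _ => 0 := by
  refine ((h.prim₁.mul h.prim₁.star).add ((h.prim₂.mul h.prim₂.star).const_mul s)).congr_ae
    (Eventually.of_forall fun x => ?_)
  dsimp only
  simp only [map_add, map_mul, hd, hc, map_neg, ha, hs', Complex.conj_I, Complex.conj_ofReal,
    Complex.conj_conj, map_ofNat]
  linear_combination (-(conj (b x)) * P₁ x * conj (P₂ x) - b x * conj (P₁ x) * P₂ x) * hs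

/-- The conjugation symmetry that expresses ϕ₊ through φ₊. Exchanging the components accounts for
the opposite sign of l. -/
theorem IsFlow.conj_swap {s : ℂ} (hs : s ^ 2 = 1) (hs' : conj s = s) (h : IsFlow a b c d l P₁ P₂)
    (ha : ∀ x, conj (a x) = -a x) (hd : ∀ x, d x = -a x) (hc : ∀ x, c x = -s * conj (b x)) :
    IsFlow d c b a (-l) (fun x => conj (P₁ x)) fun x => -s * conj (P₂ x) := by
  refine ⟨h.prim₁.star.congr_ae (Eventually.of_forall fun x => ?_),
    (h.prim₂.star.const_mul (-s)).congr_ae (Eventually.of_forall fun x => ?_)⟩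
  · simp only [map_add, map_mul, hd, hc, ha]
    linear_combination (-(conj (b x)) * conj (P₂ x)) * hs
  · simp only [map_add, map_mul, hd, hc, map_neg, ha, hs', Complex.conj_I, Complex.conj_ofReal,
      Complex.conj_conj, map_ofNat]
    push_cast
    linear_combination (b x * conj (P₁ x)) * hs

end

/-! ### Scattering data of a potential -/

section

variable {U U₁ : ℝ → ℂ} {k : ℂ} {z : ℝ}

theorem isMinus_varphiMinus (hU : IsPotential U U₁) (hk : k ^ 2 = z) :
    IsMinus (diagCoeff U) (fun y => k * U y) (fun y => -k * conj (U y))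
      (fun y => -diagCoeff U y) (z + 1) (fun x => varphiMinus U k x 0)
      fun x => varphiMinus U k x 1 := by
  have ia := hU.integrable_diagCoeff
  have ib := hU.integrable_const_mul k
  have ic := hU.integrable_const_mul_conj (-k)
  refine IsVolterra.isMinus ia ib ic ia.neg ((isVarphiMinus_iff hU hk _).1 ?_)
  obtain ⟨P₁, P₂, h⟩ := exists_isVolterra ia ib ic ia.neg (z + 1)
  exact Classical.epsilon_spec (p := IsVarphiMinus U k) ⟨fun x => ![P₁ x, P₂ x],
    (isVarphiMinus_iff hU hk _).2 h⟩

theorem isMinus_varphiPlus (hU : IsPotential U U₁) (hk : k ^ 2 = z) :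
    IsMinus (reflect (diagCoeff U)) (reflect fun y => k * U y)
      (reflect fun y => -k * conj (U y)) (reflect fun y => -diagCoeff U y) (-(z + 1))
      (fun x => varphiPlus U k (-x) 0) fun x => varphiPlus U k (-x) 1 := by
  have ia := integrable_reflect hU.integrable_diagCoeff
  have ib := integrable_reflect (hU.integrable_const_mul k)
  have ic := integrable_reflect (hU.integrable_const_mul_conj (-k))
  have id := integrable_reflect hU.integrable_diagCoeff.neg
  refine IsVolterra.isMinus ia ib ic id ((isVarphiPlus_iff hU hk _).1 ?_)
  obtain ⟨P₁, P₂, h⟩ := exists_isVolterra ia ib ic id (-(z + 1))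
  refine Classical.epsilon_spec (p := IsVarphiPlus U k) ⟨fun x => ![P₁ (-x), P₂ (-x)],
    (isVarphiPlus_iff hU hk _).2 ?_⟩
  simp only [neg_neg, Matrix.cons_val_zero, Matrix.cons_val_one]
  exact h

theorem isMinus_phiPlus (hU : IsPotential U U₁) (hk : k ^ 2 = z) :
    IsMinus (reflect fun y => -diagCoeff U y)
      (reflect fun y => -k * conj (U y)) (reflect fun y => k * U y) (reflect (diagCoeff U)) (z + 1)
      (fun x => phiPlus U k (-x) 1) fun x => phiPlus U k (-x) 0 := by
  have ia := integrable_reflect hU.integrable_diagCoeff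
  have ib := integrable_reflect (hU.integrable_const_mul k)
  have ic := integrable_reflect (hU.integrable_const_mul_conj (-k))
  have id := integrable_reflect hU.integrable_diagCoeff.neg
  refine IsVolterra.isMinus id ic ib ia ((isPhiPlus_iff hU hk _).1 ?_)
  obtain ⟨P₁, P₂, h⟩ := exists_isVolterra id ic ib ia (z + 1)
  refine Classical.epsilon_spec (p := IsPhiPlus U k) ⟨fun x => ![P₂ (-x), P₁ (-x)],
    (isPhiPlus_iff hU hk _).2 ?_⟩
  simp only [neg_neg, Matrix.cons_val_zero, Matrix.cons_val_one]
  exact h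

theorem isFlow_varphiPlus (hU : IsPotential U U₁) (hk : k ^ 2 = z) :
    IsFlow (diagCoeff U) (fun y => k * U y) (fun y => -k * conj (U y))
      (fun y => -diagCoeff U y) (z + 1) (fun x => varphiPlus U k x 0)
      fun x => varphiPlus U k x 1 := by
  simpa only [reflect_reflect, neg_neg] using (isMinus_varphiPlus hU hk).toIsFlow.reflect

theorem isFlow_phiPlus (hU : IsPotential U U₁) (hk : k ^ 2 = z) :
    IsFlow (fun y => -diagCoeff U y) (fun y => -k * conj (U y)) (fun y => k * U y)
      (diagCoeff U) (-(z + 1)) (fun x => phiPlus U k x 1) fun x => phiPlus U k x 0 := by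
  simpa only [reflect_reflect, neg_neg] using (isMinus_phiPlus hU hk).toIsFlow.reflect

theorem tendsto_of_comp_neg {P : ℝ → ℂ} {c : ℂ} (h : Tendsto (fun x => P (-x)) atBot (𝓝 c)) :
    Tendsto P atTop (𝓝 c) := by
  simpa [Function.comp_def] using h.comp tendsto_neg_atTop_atBot

/-- The Wronskian is constant in x and tends to 1 at +∞, so φ₊ and the phase times ϕ₊ form a basis
of solutions. -/
theorem wronskian_plus (hU : IsPotential U U₁) (hk : k ^ 2 = z) (x : ℝ) :
    varphiPlus U k x 0 * phiPlus U k x 1 - varphiPlus U k x 1 * phiPlus U k x 0 = 1 := by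
  have h := isMinus_varphiPlus hU hk
  have h' := isMinus_phiPlus hU hk
  have hw := (isFlow_varphiPlus hU hk).wronskian_swap (isFlow_phiPlus hU hk) fun _ => rfl
  have l1 := tendsto_of_comp_neg (P := fun x => varphiPlus U k x 0) h.lim₁
  have l2 := tendsto_of_comp_neg (P := fun x => varphiPlus U k x 1) h.lim₂
  have l3 := tendsto_of_comp_neg (P := fun x => phiPlus U k x 1) h'.lim₁
  have l4 := tendsto_of_comp_neg (P := fun x => phiPlus U k x 0) h'.lim₂
  have l5 := (l1.mul l3).sub (l2.mul l4)
  have l6 := (tendsto_const_nhds (f := atTop)).congr fun y => hw.eq_of_zero x y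
  simpa using tendsto_nhds_unique l6 l5

/-- Cramer's rule in the basis of right Jost solutions. Existence of the pair is proved first, since
`scatteringPair` is a choice that satisfies the relation only if some pair does. -/
theorem scattering_eq (hU : IsPotential U U₁) (hk : k ^ 2 = z) :
    scatA U k = varphiMinus U k 0 0 * phiPlus U k 0 1 - varphiMinus U k 0 1 * phiPlus U k 0 0 ∧
    scatB U k = varphiPlus U k 0 0 * varphiMinus U k 0 1
      - varphiPlus U k 0 1 * varphiMinus U k 0 0 := by
  have w := wronskian_plus hU hk
  have hA := (isMinus_varphiMinus hU hk).toIsFlow.wronskian_swap (isFlow_phiPlus hU hk)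
    fun _ => rfl
  have hB := (isFlow_varphiPlus hU hk).wronskian (isMinus_varphiMinus hU hk).toIsFlow fun _ => rfl
  have ex : ∃ s, IsScatteringPair U k s := by
    refine ⟨(varphiMinus U k 0 0 * phiPlus U k 0 1 - varphiMinus U k 0 1 * phiPlus U k 0 0,
      varphiPlus U k 0 0 * varphiMinus U k 0 1 - varphiPlus U k 0 1 * varphiMinus U k 0 0),
      fun x => ?_⟩
    have e1 := hA.eq_of_zero x 0
    have e2 := hB.eq_of_zero x 0
    rw [mul_zero, neg_zero, osc_zero, one_mul] at e2
    have e3 := osc_mul_osc_neg ((z + 1) * x) (varphiPlus U k x 0 * varphiMinus U k x 1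
      - varphiPlus U k x 1 * varphiMinus U k x 0)
    rw [e2] at e3
    rw [← e1, phase_eq_osc hk, mul_comm _ (osc _), e3, fin_two_ext_iff]
    have w := w x
    constructor
    · simp only [Pi.add_apply, Pi.smul_apply, smul_eq_mul]
      linear_combination (-varphiMinus U k x 0) * w
    · simp only [Pi.add_apply, Pi.smul_apply, smul_eq_mul]
      linear_combination (-varphiMinus U k x 1) * w
  -- The relation at the single point x = 0 already determines both coefficients, because the
  -- Wronskian there is 1.
  have h := Classical.epsilon_spec ex 0
  have hp : phase k ((0 : ℝ)) = 1 := by rw [phase_eq_osc hk, mul_zero, osc_zero]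
  rw [hp, mul_one, fin_two_ext_iff] at h
  simp only [Pi.add_apply, Pi.smul_apply, smul_eq_mul] at h
  obtain ⟨h0, h1⟩ := h
  have w := w 0
  have e : scatteringPair U k = Classical.epsilon (IsScatteringPair U k) := rfl
  constructor
  · rw [scatA, e]
    linear_combination (-phiPlus U k 0 1) * h0 + phiPlus U k 0 0 * h1
      - (Classical.epsilon (IsScatteringPair U k)).1 * w
  · rw [scatB, e]
    linear_combination (varphiPlus U k 0 1) * h0 - varphiPlus U k 0 0 * h1
      - (Classical.epsilon (IsScatteringPair U k)).2 * w

end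

/-! ### Scattering data in terms of the off-diagonal systems -/

/-- The function `w = -i u' + 2u - |u|² u / 2`. -/
noncomputable def gaugeW (U U₁ : ℝ → ℂ) (x : ℝ) : ℂ :=
  -Complex.I * U₁ x + 2 * U x - 1 / 2 * (U x * conj (U x)) * U x

/-- The coefficients of the first off-diagonal system. -/
noncomputable def lowF (U : ℝ → ℂ) (x : ℝ) : ℂ := U x / 2
/-- The second coefficient of the first off-diagonal system. -/
noncomputable def lowG (U U₁ : ℝ → ℂ) (x : ℝ) : ℂ := conj (gaugeW U U₁ x)
/-- The coefficients of the second off-diagonal system. -/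
noncomputable def upF (U U₁ : ℝ → ℂ) (x : ℝ) : ℂ := -gaugeW U U₁ x / 2
/-- The second coefficient of the second off-diagonal system. -/
noncomputable def upG (U : ℝ → ℂ) (x : ℝ) : ℂ := -conj (U x)

namespace IsPotential

variable {U U₁ : ℝ → ℂ}

theorem mem_of_norm_le {f g : ℝ → ℂ} {K : ℝ} (hf : MemL21 f) (hg : AEStronglyMeasurable g)
    (h : ∀ x, ‖g x‖ ≤ K * ‖f x‖) : MemL21 g :=
  MemL21.of_norm_le hg hf (Eventually.of_forall h)

theorem memL21_conj {f : ℝ → ℂ} (hf : MemL21 f) : MemL21 fun x => conj (f x) :=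
  mem_of_norm_le (K := 1) hf
    (Complex.continuous_conj.comp_aestronglyMeasurable hf.aestronglyMeasurable)
    fun x => by rw [RCLike.norm_conj, one_mul]

theorem memL21_const_mul {f : ℝ → ℂ} (hf : MemL21 f) (c : ℂ) : MemL21 fun x => c * f x :=
  mem_of_norm_le (K := ‖c‖) hf (hf.aestronglyMeasurable.const_mul c) fun x => by rw [norm_mul]

theorem memL21_cubic (h : IsPotential U U₁) : MemL21 fun x => U x * conj (U x) * U x := by
  refine mem_of_norm_le (K := (2 * l21Norm U₁) ^ 2) h.mem
    ((h.continuous.mul h.continuous_conj).mul h.continuous).aestronglyMeasurable fun x => ?_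
  rw [norm_mul, norm_mul, RCLike.norm_conj, ← sq]
  gcongr
  exact h.norm_le x

theorem memL21_gaugeW (h : IsPotential U U₁) : MemL21 (gaugeW U U₁) := by
  have := ((memL21_const_mul h.mem₁ (-Complex.I)).add (memL21_const_mul h.mem 2)).sub
    (memL21_const_mul h.memL21_cubic (1 / 2))
  convert this using 2 with x
  rw [gaugeW]; ring

theorem memL21_lowF (h : IsPotential U U₁) : MemL21 (lowF U) := by
  convert memL21_const_mul h.mem (1 / 2) using 2 with x
  rw [lowF]; ring

theorem memL21_lowG (h : IsPotential U U₁) : MemL21 (lowG U U₁) := memL21_conj h.memL21_gaugeW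

theorem memL21_upF (h : IsPotential U U₁) : MemL21 (upF U U₁) := by
  convert memL21_const_mul h.memL21_gaugeW (-1 / 2) using 2 with x
  rw [upF]; ring

theorem memL21_upG (h : IsPotential U U₁) : MemL21 (upG U) := by
  convert memL21_const_mul (memL21_conj h.mem) (-1) using 2 with x
  rw [upG]; ring

end IsPotential

section

variable {U U₁ : ℝ → ℂ} {k : ℂ} {z : ℝ}

/-- With t = i ū and κ = 2k the terms κc = -2k²ū and -2ilt = 2(k² + 1)ū add up to 2ū, so k drops out
and the second coefficient is the conjugate of w. The component-swapped ϕ₊ needs the opposite gauge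
with the same t and κ, which requires k ≠ 0. -/
theorem scattering_lower (hU : IsPotential U U₁) (hk : k ^ 2 = z) (hk0 : k ≠ 0) :
    scatA U k = scatDiag (lowF U) (lowG U U₁) (z + 1) ∧
    2 * k * scatB U k = scatOff (lowF U) (lowG U U₁) (z + 1) := by
  obtain ⟨eA, eB⟩ := scattering_eq hU hk
  have iF := hU.memL21_lowF.integrable
  have iG := hU.memL21_lowG.integrable
  have h2k : 2 * k ≠ 0 := by simpa using hk0
  have pt : IsPrim (fun x => Complex.I * conj (U x)) fun x => Complex.I * conj (U₁ x) :=
    hU.prim.star.const_mul _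
  have tb := bdd_mul (bdd_const Complex.I) hU.bdd_conj
  have tl : Tendsto (fun x => Complex.I * conj (U x)) atBot (𝓝 0) := by
    simpa using ((Complex.continuous_conj.tendsto _).comp hU.tendsto_atBot).const_mul Complex.I
  have pt' : IsPrim (fun x => Complex.I * conj (U (-x))) fun x => Complex.I * conj (-U₁ (-x)) :=
    hU.comp_neg.prim.star.const_mul _
  have tb' := bdd_mul (bdd_const Complex.I) hU.comp_neg.bdd_conj
  have tl' : Tendsto (fun x => Complex.I * conj (U (-x))) atBot (𝓝 0) := by
    simpa using ((Complex.continuous_conj.tendsto _).comp hU.comp_neg.tendsto_atBot).const_mul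
      Complex.I
  have hz : (z : ℂ) = k ^ 2 := hk.symm
  have j1 := ((isMinus_varphiMinus hU hk).lower (f := lowF U) (g := lowG U U₁) (κ := 2 * k)
    pt tb tl (fun x => by simp only [diagCoeff, lowF]; ring)
    (fun x => by simp only [lowF]; ring) (fun x => rfl) fun x => by
      simp only [lowG, gaugeW, diagCoeff, map_add, map_sub, map_mul, map_neg, map_div₀, map_one,
        map_ofNat, Complex.conj_I, Complex.conj_conj]
      push_cast
      rw [hz]
      linear_combination (2 * k ^ 2 * conj (U x) + 2 * conj (U x)
        - 1 / 2 * U x * conj (U x) ^ 2) * Complex.I_sq).eq_jost iF iG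
  have j2 := ((isMinus_varphiPlus hU hk).lower (f := reflect (lowF U))
    (g := reflect (lowG U U₁)) (κ := 2 * k)
    pt' tb' tl' (fun x => by simp only [diagCoeff, lowF, reflect]; ring)
    (fun x => by simp only [lowF, reflect]; ring) (fun x => rfl) fun x => by
      simp only [lowG, gaugeW, diagCoeff, map_add, map_sub, map_mul, map_neg, map_div₀, map_one,
        map_ofNat, Complex.conj_I, Complex.conj_conj, reflect]
      push_cast
      rw [hz]
      linear_combination (-(2 * k ^ 2 * conj (U (-x)) + 2 * conj (U (-x))
        - 1 / 2 * U (-x) * conj (U (-x)) ^ 2)) * Complex.I_sq).eq_jost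
      (integrable_reflect iF) (integrable_reflect iG)
  have j3 := ((isMinus_phiPlus hU hk).upper (f := reflect (lowG U U₁))
    (g := reflect (lowF U)) h2k
    pt' tb' tl' (fun x => by simp only [diagCoeff, lowF, reflect]; ring)
    (fun x => by simp only [lowF, reflect]; ring)
    (fun x => by simp only [reflect]) fun x => by
      simp only [lowG, gaugeW, diagCoeff, map_add, map_sub, map_mul, map_neg, map_div₀, map_one,
        map_ofNat, Complex.conj_I, Complex.conj_conj, reflect]
      push_cast
      rw [hz]
      linear_combination (-(2 * k ^ 2 * conj (U (-x)) + 2 * conj (U (-x))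
        - 1 / 2 * U (-x) * conj (U (-x)) ^ 2)) * Complex.I_sq).eq_jost
      (integrable_reflect iG) (integrable_reflect iF)
  simp only [neg_zero] at j2 j3
  rw [scatDiag, scatOff, ← j1.1, ← j1.2, ← j2.1, ← j2.2, ← j3.1, ← j3.2, eA, eB]
  constructor
  · field_simp; ring
  · ring

/-- With t = iu/2 and κ = k the term k²u cancels against 2ilt = -(k² + 1)u, leaving -w/2. The factor
k in front of `scatOff` shows both that r₊ is regular at z = 0 and that b is small for small k. -/
theorem scattering_upper (hU : IsPotential U U₁) (hk : k ^ 2 = z) (hk0 : k ≠ 0) :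
    scatA U k = scatDiag (upF U U₁) (upG U) (z + 1) ∧
    scatB U k = k * scatOff (upF U U₁) (upG U) (z + 1) := by
  obtain ⟨eA, eB⟩ := scattering_eq hU hk
  have iF := hU.memL21_upF.integrable
  have iG := hU.memL21_upG.integrable
  have pt : IsPrim (fun x => Complex.I / 2 * U x) fun x => Complex.I / 2 * U₁ x :=
    hU.prim.const_mul _
  have tb := bdd_mul (bdd_const (Complex.I / 2)) hU.bdd
  have tl : Tendsto (fun x => Complex.I / 2 * U x) atBot (𝓝 0) := by
    simpa using hU.tendsto_atBot.const_mul (Complex.I / 2)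
  have pt' : IsPrim (fun x => Complex.I / 2 * U (-x)) fun x => Complex.I / 2 * -U₁ (-x) :=
    hU.comp_neg.prim.const_mul _
  have tb' := bdd_mul (bdd_const (Complex.I / 2)) hU.comp_neg.bdd
  have tl' : Tendsto (fun x => Complex.I / 2 * U (-x)) atBot (𝓝 0) := by
    simpa using hU.comp_neg.tendsto_atBot.const_mul (Complex.I / 2)
  have hz : (z : ℂ) = k ^ 2 := hk.symm
  have j1 := ((isMinus_varphiMinus hU hk).upper (f := upF U U₁) (g := upG U) hk0
    pt tb tl (fun x => by simp only [diagCoeff, upG]; ring)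
    (fun x => by simp only [upG]; ring) (fun x => by rw [neg_neg]) fun x => by
      simp only [upF, gaugeW, diagCoeff]
      push_cast
      rw [hz]
      linear_combination (-(k ^ 2 * U x + U x
        - 1 / 4 * U x ^ 2 * conj (U x))) * Complex.I_sq).eq_jost iF iG
  have j2 := ((isMinus_varphiPlus hU hk).upper (f := reflect (upF U U₁))
    (g := reflect (upG U)) hk0
    pt' tb' tl' (fun x => by simp only [diagCoeff, upG, reflect]; ring)
    (fun x => by simp only [upG, reflect]; ring) (fun x => by simp only [reflect, neg_neg])
    fun x => by
      simp only [upF, gaugeW, diagCoeff, reflect]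
      push_cast
      rw [hz]
      linear_combination (k ^ 2 * U (-x) + U (-x)
        - 1 / 4 * U (-x) ^ 2 * conj (U (-x))) * Complex.I_sq).eq_jost
      (integrable_reflect iF) (integrable_reflect iG)
  have j3 := ((isMinus_phiPlus hU hk).lower (f := reflect (upG U))
    (g := reflect (upF U U₁)) (κ := k)
    pt' tb' tl' (fun x => by simp only [diagCoeff, upG, reflect]; ring)
    (fun x => by simp only [upG, reflect]; ring) (fun x => by simp only [reflect, neg_neg])
    fun x => by
      simp only [upF, gaugeW, diagCoeff, reflect]
      push_cast
      rw [hz]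
      linear_combination (k ^ 2 * U (-x) + U (-x)
        - 1 / 4 * U (-x) ^ 2 * conj (U (-x))) * Complex.I_sq).eq_jost
      (integrable_reflect iG) (integrable_reflect iF)
  simp only [neg_zero] at j2 j3
  rw [scatDiag, scatOff, ← j1.1, ← j1.2, ← j2.1, ← j2.2, ← j3.1, ← j3.2, eA, eB]
  constructor
  · field_simp; ring
  · field_simp; ring

theorem conj_diagCoeff (U : ℝ → ℂ) (x : ℝ) : conj (diagCoeff U x) = -diagCoeff U x := by
  simp only [diagCoeff, map_mul, map_div₀, map_ofNat, Complex.conj_I, Complex.conj_conj]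
  ring

/-- Both φ₋ and φ₊ have conserved energy 1, read off at their own ends of the line, and the symmetry
under conjugation turns the Wronskians into the coordinates of φ₋ relative to φ₊. -/
theorem scattering_energy (hU : IsPotential U U₁) (hk : k ^ 2 = z) {s : ℂ} (hs : s ^ 2 = 1)
    (hs' : conj s = s) (hks : conj k = s * k) :
    scatA U k * conj (scatA U k) + s * (scatB U k * conj (scatB U k)) = 1 := by
  obtain ⟨eA, eB⟩ := scattering_eq hU hk
  have hm := isMinus_varphiMinus hU hk
  have hp := isMinus_varphiPlus hU hk
  have fp := isFlow_varphiPlus hU hk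
  have ha := conj_diagCoeff U
  have hc : ∀ x, -k * conj (U x) = -s * conj (k * U x) := fun x => by
    rw [map_mul, hks]; linear_combination k * conj (U x) * hs
  have energy : ∀ {P₁ P₂ : ℝ → ℂ} {F : Filter ℝ}, F.NeBot →
      IsFlow (diagCoeff U) (fun y => k * U y) (fun y => -k * conj (U y))
      (fun y => -diagCoeff U y) (z + 1) P₁ P₂ → Tendsto P₁ F (𝓝 1) → Tendsto P₂ F (𝓝 0) →
      P₁ 0 * conj (P₁ 0) + s * (P₂ 0 * conj (P₂ 0)) = 1 := fun {P₁ P₂ F} hF h l1 l2 => by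
    have hw := h.energy hs hs' ha (fun _ => rfl) hc
    have c := fun w : ℂ => Complex.continuous_conj.tendsto w
    have l5 := (l1.mul ((c _).comp l1)).add ((l2.mul ((c _).comp l2)).const_mul s)
    have l6 := (tendsto_const_nhds (f := F)).congr fun y => hw.eq_of_zero 0 y
    simpa using tendsto_nhds_unique l6 l5
  have Em := energy atBot_neBot hm.toIsFlow hm.lim₁ hm.lim₂
  have Ep := energy atTop_neBot fp
    (tendsto_of_comp_neg (P := fun x => varphiPlus U k x 0) hp.lim₁)
    (tendsto_of_comp_neg (P := fun x => varphiPlus U k x 1) hp.lim₂)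
  -- The conjugated and exchanged φ₊ has the normalization of ϕ₊, so the two agree by uniqueness.
  have hq : phiPlus U k 0 1 = conj (varphiPlus U k 0 0) ∧
      phiPlus U k 0 0 = -s * conj (varphiPlus U k 0 1) := by
    have ia := integrable_reflect hU.integrable_diagCoeff
    have ib := integrable_reflect (hU.integrable_const_mul k)
    have ic := integrable_reflect (hU.integrable_const_mul_conj (-k))
    have id := integrable_reflect hU.integrable_diagCoeff.neg
    have hf := (fp.conj_swap hs hs' ha (fun _ => rfl) hc).reflect
    rw [neg_neg] at hf
    have c := fun w : ℂ => Complex.continuous_conj.tendsto w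
    have hm' : IsMinus (reflect fun y => -diagCoeff U y) (reflect fun y => -k * conj (U y))
        (reflect fun y => k * U y) (reflect (diagCoeff U)) (z + 1)
        (fun x => conj (varphiPlus U k (-x) 0)) fun x => -s * conj (varphiPlus U k (-x) 1) := by
      refine ⟨hf, ?_, bdd_mul (bdd_const _) ?_, ?_, ?_⟩
      · simpa only [RCLike.norm_conj] using hp.bdd₁
      · simpa only [RCLike.norm_conj] using hp.bdd₂
      · simpa [Function.comp_def] using (c _).comp hp.lim₁
      · simpa [Function.comp_def] using ((c _).comp hp.lim₂).const_mul (-s)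
    have := (isMinus_phiPlus hU hk).unique id ic ib ia hm' 0
    simpa using this
  rw [eA, eB, hq.1, hq.2]
  simp only [map_sub, map_mul, map_neg, hs', Complex.conj_conj]
  generalize varphiMinus U k 0 0 = a at *
  generalize varphiMinus U k 0 1 = b at *
  generalize varphiPlus U k 0 0 = c at *
  generalize varphiPlus U k 0 1 = d at *
  -- Lagrange's identity: |a|² + s|b|² is the product of the energies of φ₋ and φ₊ at the origin.
  linear_combination (c * conj c + s * (d * conj d)) * Em + Ep

end

/-! ### Lower bounds for the diagonal scattering function -/

/-- The Euclidean norm of the pair of coefficients. -/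
noncomputable def coeffNorm (f g : ℝ → ℂ) (x : ℝ) : ℝ := Real.sqrt (‖f x‖ ^ 2 + ‖g x‖ ^ 2)

theorem coeffNorm_nonneg (f g : ℝ → ℂ) (x : ℝ) : 0 ≤ coeffNorm f g x := Real.sqrt_nonneg _

theorem norm_snd_le_coeffNorm (f g : ℝ → ℂ) (x : ℝ) : ‖g x‖ ≤ coeffNorm f g x :=
  Real.le_sqrt_of_sq_le (by nlinarith [sq_nonneg ‖f x‖])

theorem coeffNorm_le (f g : ℝ → ℂ) (x : ℝ) : coeffNorm f g x ≤ ‖f x‖ + ‖g x‖ :=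
  Real.sqrt_le_iff.2 ⟨by positivity, by nlinarith [norm_nonneg (f x), norm_nonneg (g x)]⟩

theorem integrable_coeffNorm {f g : ℝ → ℂ} (hf : Integrable f) (hg : Integrable g) :
    Integrable (coeffNorm f g) := by
  refine (hf.norm.add hg.norm).mono' ?_ (Eventually.of_forall fun x => ?_)
  · exact Real.continuous_sqrt.comp_aestronglyMeasurable
      ((hf.aestronglyMeasurable.norm.pow 2).add (hg.aestronglyMeasurable.norm.pow 2))
  · rw [Real.norm_of_nonneg (coeffNorm_nonneg f g x)]
    exact coeffNorm_le f g x

section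

variable {f g : ℝ → ℂ} {l : ℝ} {P₁ P₂ : ℝ → ℂ}

/-- Gronwall for the Euclidean norm of the pair, with the Frobenius norm of the coefficient matrix
in the exponent. Componentwise estimates would lose the constant that the smallness condition
prescribes. -/
theorem IsMinus.norm_le_exp (hf : Integrable f) (hg : Integrable g)
    (h : IsMinus (fun _ => 0) f g (fun _ => 0) l P₁ P₂) (x : ℝ) :
    coeffNorm P₁ P₂ x ≤ Real.exp (cumul (coeffNorm f g) x) := by
  have h0 : Integrable (fun _ : ℝ => (0 : ℂ)) := integrable_zero _ _ _
  have v := h.isVolterra h0 hf hg h0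
  have hm := integrable_coeffNorm hf hg
  obtain ⟨M, hM⟩ := h.bdd₁
  obtain ⟨N, hN⟩ := h.bdd₂
  have hMN : ∀ x, coeffNorm P₁ P₂ x ≤ M + N := fun x =>
    (coeffNorm_le _ _ x).trans (add_le_add (hM x) (hN x))
  have hcP : Continuous (coeffNorm P₁ P₂) := by
    have := v.cont₁; have := v.cont₂
    unfold coeffNorm; fun_prop
  have hmP : Integrable fun y => coeffNorm f g y * coeffNorm P₁ P₂ y :=
    hm.mul_bdd (c := M + N) hcP.aestronglyMeasurable (Eventually.of_forall fun y => by
      rw [Real.norm_of_nonneg (coeffNorm_nonneg _ _ y)]; exact hMN y)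
  have key : ∀ x, coeffNorm P₁ P₂ x ≤ 1 + ∫ y in Iic x, coeffNorm f g y * coeffNorm P₁ P₂ y := by
    intro x
    set R := coeffNorm P₁ P₂ x with hR
    have hR0 : 0 ≤ R := coeffNorm_nonneg _ _ x
    set J := ∫ y in Iic x, coeffNorm f g y * coeffNorm P₁ P₂ y with hJ
    have hR2 : R ^ 2 = ‖P₁ x‖ ^ 2 + ‖P₂ x‖ ^ 2 := Real.sq_sqrt (by positivity)
    have e1 := v.eq₁ x
    have e2 := v.eq₂ x
    simp only [zero_mul, zero_add, add_zero] at e1 e2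
    have i1 : Integrable fun y => f y * P₂ y := integrable_mul_bdd hf v.cont₂ v.bdd₂
    have i2 : Integrable fun y => osc (l * (x - y)) * (g y * P₁ y) :=
      integrable_osc_mul (s := fun y => l * (x - y)) (integrable_mul_bdd hg v.cont₁ v.bdd₁)
        (by fun_prop)
    -- The integral equation is paired with the conjugate of the solution at the fixed point x,
    -- which gives R² ≤ R + R J; division by R is exact.
    have e : ((R ^ 2 : ℝ) : ℂ) = conj (P₁ x) + ∫ y in Iic x, (conj (P₁ x) * (f y * P₂ y)
        + conj (P₂ x) * (osc (l * (x - y)) * (g y * P₁ y))) := by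
      rw [integral_add (i1.const_mul _).integrableOn (i2.const_mul _).integrableOn,
        integral_const_mul, integral_const_mul, ← e2, hR2, Complex.ofReal_add, ofReal_norm_sq,
        ofReal_norm_sq]
      linear_combination conj (P₁ x) * e1
    have hb : R ^ 2 ≤ R + R * J := by
      have h1 : ‖((R ^ 2 : ℝ) : ℂ)‖ = R ^ 2 := by
        rw [Complex.norm_real, Real.norm_of_nonneg (sq_nonneg R)]
      rw [← h1, e]
      refine (norm_add_le _ _).trans (add_le_add ?_ ?_)
      · rw [RCLike.norm_conj]
        exact Real.le_sqrt_of_sq_le (by nlinarith [sq_nonneg ‖P₂ x‖])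
      · rw [hJ, ← integral_const_mul]
        refine norm_integral_le_of_norm_le (hmP.const_mul R).integrableOn
          (Eventually.of_forall fun y => ?_)
        refine (norm_add_le _ _).trans ?_
        rw [norm_mul, norm_mul, norm_mul, norm_osc_mul, norm_mul, RCLike.norm_conj,
          RCLike.norm_conj, hR]
        simp only [coeffNorm]
        rw [← Real.sqrt_mul (by positivity), ← Real.sqrt_mul (by positivity)]
        refine Real.le_sqrt_of_sq_le ?_
        have c1 : (‖P₁ x‖ * (‖f y‖ * ‖P₂ y‖) + ‖P₂ x‖ * (‖g y‖ * ‖P₁ y‖)) ^ 2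
            ≤ (‖P₁ x‖ ^ 2 + ‖P₂ x‖ ^ 2) * ((‖f y‖ * ‖P₂ y‖) ^ 2 + (‖g y‖ * ‖P₁ y‖) ^ 2) := by
          nlinarith [sq_nonneg (‖P₁ x‖ * (‖g y‖ * ‖P₁ y‖) - ‖P₂ x‖ * (‖f y‖ * ‖P₂ y‖))]
        refine c1.trans (mul_le_mul_of_nonneg_left ?_ (by positivity))
        nlinarith [sq_nonneg (‖f y‖ * ‖P₁ y‖), sq_nonneg (‖g y‖ * ‖P₂ y‖)]
    rcases hR0.eq_or_lt with h0 | h0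
    · rw [← h0]
      have : 0 ≤ J := integral_nonneg fun y =>
        mul_nonneg (coeffNorm_nonneg _ _ y) (coeffNorm_nonneg _ _ y)
      linarith
    · nlinarith
  have hMN0 : 0 ≤ M + N := (coeffNorm_nonneg _ _ x).trans (hMN x)
  have G := gronwall (N := fun x => ENNReal.ofReal (coeffNorm P₁ P₂ x)) (x₀ := x) (M := 1)
    (K := M + N) hm (coeffNorm_nonneg f g) zero_le_one
    (fun y _ => ENNReal.ofReal_le_ofReal (hMN y)) (fun y _ => ?_) x le_rfl
  · rw [one_mul] at G
    exact (ENNReal.ofReal_le_ofReal_iff (Real.exp_nonneg _)).1 G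
  · refine (ENNReal.ofReal_le_ofReal (key y)).trans ?_
    rw [ENNReal.ofReal_add zero_le_one (integral_nonneg fun y =>
        mul_nonneg (coeffNorm_nonneg _ _ y) (coeffNorm_nonneg _ _ y)),
      ofReal_integral_eq_lintegral_ofReal hmP.integrableOn (Eventually.of_forall fun y =>
        mul_nonneg (coeffNorm_nonneg _ _ y) (coeffNorm_nonneg _ _ y))]
    refine add_le_add le_rfl (le_of_eq ?_)
    congr 1; ext y
    rw [ENNReal.ofReal_mul (coeffNorm_nonneg _ _ y)]

/-- Since |g| is at most the Frobenius norm m, |P₂| is bounded by ∫ m e^{∫m} ≤ e^W - 1, and P₁ - 1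
is the integral of f P₂. The gain of -1 over e^W is what keeps the later lower bound positive. -/
theorem IsMinus.norm_fst_sub_one_le (hf : Integrable f) (hg : Integrable g)
    (h : IsMinus (fun _ => 0) f g (fun _ => 0) l P₁ P₂) (x : ℝ) :
    ‖P₁ x - 1‖ ≤ (∫ y, ‖f y‖) * (Real.exp (∫ y, coeffNorm f g y) - 1) := by
  have h0 : Integrable (fun _ : ℝ => (0 : ℂ)) := integrable_zero _ _ _
  have v := h.isVolterra h0 hf hg h0
  have hm := integrable_coeffNorm hf hg
  have hm0 := coeffNorm_nonneg f g
  set W := ∫ y, coeffNorm f g y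
  have b2 : ∀ x, ‖P₂ x‖ ≤ Real.exp W - 1 := fun x => by
    have e2 := v.eq₂ x
    simp only [zero_mul, add_zero] at e2
    rw [e2]
    have im := integrable_mul_exp_cumul hm hm0 zero_le_one
    refine (norm_integral_le_of_norm_le im.integrableOn (Eventually.of_forall fun y => ?_)).trans ?_
    · rw [norm_osc_mul, norm_mul, one_mul]
      refine mul_le_mul (norm_snd_le_coeffNorm f g y) ?_ (norm_nonneg _) (hm0 y)
      refine le_trans ?_ (h.norm_le_exp hf hg y)
      exact Real.le_sqrt_of_sq_le (by nlinarith [sq_nonneg ‖P₂ y‖])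
    · have := integral_Iic_mul_exp_cumul hm hm0 zero_le_one x
      rw [one_mul, one_mul] at this
      rw [this]
      have := cumul_le_integral hm hm0 x
      gcongr
  have e1 := v.eq₁ x
  simp only [zero_mul, zero_add] at e1
  rw [e1, add_sub_cancel_left, ← integral_mul_const]
  have ie : Integrable fun y => ‖f y‖ * (Real.exp W - 1) := hf.norm.mul_const _
  refine (norm_integral_le_of_norm_le ie.integrableOn (Eventually.of_forall fun y => ?_)).trans
    (setIntegral_le_integral ie (Eventually.of_forall fun y =>
      mul_nonneg (norm_nonneg _) ((norm_nonneg _).trans (b2 0))))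
  rw [norm_mul]
  exact mul_le_mul_of_nonneg_left (b2 y) (norm_nonneg _)

/-- The Wronskian is constant in x, and the right solution tends to (1, 0) at +∞. So the Wronskian
is the limit of P₁ there and inherits the bound for P₁ - 1. -/
theorem norm_scatDiag_sub_one_le (hf : Integrable f) (hg : Integrable g) (l : ℝ) :
    ‖scatDiag f g l - 1‖ ≤ (∫ y, ‖f y‖) * (Real.exp (∫ y, coeffNorm f g y) - 1) := by
  have hP := isMinus_jost hf hg l
  have hQ := isMinus_jost (integrable_reflect hg) (integrable_reflect hf) l
  have hz : reflect (fun _ => 0) = fun _ => 0 := by ext x; simp [reflect]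
  have fQ := hQ.toIsFlow.reflect
  rw [reflect_reflect, reflect_reflect, hz] at fQ
  have hw := hP.toIsFlow.wronskian_swap fQ fun _ => by simp
  have t1 := hQ.lim₁.comp tendsto_neg_atTop_atBot
  have t2 := hQ.lim₂.comp tendsto_neg_atTop_atBot
  set K := (∫ y, ‖f y‖) * (Real.exp (∫ y, coeffNorm f g y) - 1)
  set P₁ := fun x => (jost f g).1 x l
  set P₂ := fun x => (jost f g).2 x l
  set Q₁ := fun x => (jost (reflect g) (reflect f)).1 x l with hQ₁
  set Q₂ := fun x => (jost (reflect g) (reflect f)).2 x l with hQ₂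
  have e : ∀ x, scatDiag f g l = P₁ x * Q₁ (-x) - P₂ x * Q₂ (-x) := fun x => by
    have := hw.eq_of_zero 0 x
    rw [neg_zero] at this
    exact this
  have t3 : Tendsto (fun x => K * ‖Q₁ (-x)‖ + (‖Q₁ (-x) - 1‖ + ‖Q₂ (-x) * P₂ x‖)) atTop
      (𝓝 (K * ‖(1 : ℂ)‖ + (‖(1 : ℂ) - 1‖ + ‖(0 : ℂ)‖))) :=
    (t1.norm.const_mul K).add ((t1.sub_const 1).norm.add
      (tendsto_mul_zero_of_bdd t2 hP.bdd₂).norm)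
  rw [sub_self, norm_zero, norm_one, mul_one, add_zero, add_zero] at t3
  refine ge_of_tendsto' t3 fun x => ?_
  have e' : scatDiag f g l - 1 = (P₁ x - 1) * Q₁ (-x) + ((Q₁ (-x) - 1) - Q₂ (-x) * P₂ x) := by
    rw [e x]; ring
  rw [e']
  refine (norm_add_le _ _).trans (add_le_add ?_ (norm_sub_le _ _))
  rw [norm_mul]
  exact mul_le_mul_of_nonneg_right (hP.norm_fst_sub_one_le hf hg x) (norm_nonneg _)

theorem norm_scatDiag_ge (hf : Integrable f) (hg : Integrable g) (l : ℝ) :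
    1 - (∫ y, ‖f y‖) * Real.exp (∫ y, coeffNorm f g y) + (∫ y, ‖f y‖) ≤ ‖scatDiag f g l‖ := by
  have h := norm_scatDiag_sub_one_le hf hg l
  have h1 : ‖(1 : ℂ)‖ ≤ ‖scatDiag f g l‖ + ‖scatDiag f g l - 1‖ := by
    rw [norm_sub_rev]
    simpa using norm_add_le (scatDiag f g l) (1 - scatDiag f g l)
  rw [norm_one] at h1
  linarith

/-- The bound 1 - s e^W + s does not degenerate at the edge of the smallness condition. If s e^W ≤
1/2 it is at least 1/2; otherwise it exceeds s ≥ e^{-W}/2, and W ≤ 4B. -/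
theorem norm_scatDiag_ge_of_bdd {B : ℝ} (h : BddPair B f g)
    (hs : (∫ y, ‖f y‖) * Real.exp (∫ y, coeffNorm f g y) < 1) (l : ℝ) :
    Real.exp (-(4 * B)) / 2 ≤ ‖scatDiag f g l‖ := by
  have hf := h.memf.integrable
  have hg := h.memg.integrable
  have h1 := norm_scatDiag_ge hf hg l
  set s := ∫ y, ‖f y‖
  set W := ∫ y, coeffNorm f g y
  have hs0 : 0 ≤ s := integral_nonneg fun y => norm_nonneg _
  have hB := h.nonneg
  have hW : W ≤ 4 * B := by
    have : W ≤ ∫ y, (‖f y‖ + ‖g y‖) := integral_mono (integrable_coeffNorm hf hg)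
      (hf.norm.add hg.norm) (coeffNorm_le f g)
    rw [integral_add hf.norm hg.norm] at this
    have := h.memf.integral_norm_le
    have := h.memg.integral_norm_le
    have := h.lef
    have := h.leg
    linarith
  rcases le_total (s * Real.exp W) (1 / 2) with hc | hc
  · have : Real.exp (-(4 * B)) ≤ 1 := Real.exp_le_one_iff.2 (by linarith)
    linarith
  · have : Real.exp (-(4 * B)) ≤ Real.exp (-W) := Real.exp_le_exp.2 (by linarith)
    have e : s = s * Real.exp W * Real.exp (-W) := by
      rw [mul_assoc, ← Real.exp_add, add_neg_cancel, Real.exp_zero, mul_one]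
    have : 1 / 2 * Real.exp (-W) ≤ s := by
      rw [e]; gcongr
    linarith

end

theorem BddPair.closePairs_self {B : ℝ} {f g : ℝ → ℂ} (h : BddPair B f g) :
    ClosePairs B 0 f g f g :=
  ⟨h, h, by simp [l21Norm_zero], by simp [l21Norm_zero]⟩

/-! ### Lower bounds from conservation of energy -/

section

variable {U U₁ : ℝ → ℂ}

theorem exists_bddPair {f g : ℝ → ℂ} (hf : MemL21 f) (hg : MemL21 g) : ∃ B, BddPair B f g :=
  ⟨max (l21Norm f) (l21Norm g), hf, hg, le_max_left _ _, le_max_right _ _⟩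

theorem continuous_scatDiag {f g : ℝ → ℂ} (hf : MemL21 f) (hg : MemL21 g) :
    Continuous (scatDiag f g) := by
  obtain ⟨B, hB⟩ := exists_bddPair hf hg
  obtain ⟨C, -, h⟩ := exists_scat_const hB.nonneg
  exact (h hB.closePairs_self).1.hb.cont

theorem exists_norm_scatOff_le {f g : ℝ → ℂ} (hf : MemL21 f) (hg : MemL21 g) :
    ∃ C : ℝ, 0 ≤ C ∧ ∀ l, ‖scatOff f g l‖ ≤ C := by
  obtain ⟨B, hB⟩ := exists_bddPair hf hg
  obtain ⟨C, hC, h⟩ := exists_scat_const hB.nonneg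
  exact ⟨C, hC, (h hB.closePairs_self).2.1.hb.bdd⟩

theorem sqrt_sq_ofReal (z : ℝ) : Complex.sqrt z ^ 2 = z :=
  Complex.cpow_nat_inv_pow (z : ℂ) two_ne_zero

theorem sqrt_ofReal_ne_zero {z : ℝ} (hz : z ≠ 0) : Complex.sqrt z ≠ 0 := fun h => by
  have := sqrt_sq_ofReal z
  rw [h, zero_pow two_ne_zero] at this
  exact hz (by exact_mod_cast this.symm)

/-- The point l = 1 corresponds to k = 0, where the gauge transformations degenerate; continuity
fills it in. -/
theorem eq_of_eq_off_one {F G : ℝ → ℂ} (hF : Continuous F) (hG : Continuous G)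
    (h : ∀ l ≠ 1, F l = G l) : F = G :=
  Continuous.ext_on (dense_compl_singleton (1 : ℝ)) hF hG fun l hl => h l hl

theorem ge_of_ge_off_one {F : ℝ → ℂ} (hF : Continuous F) {c : ℝ}
    (h : ∀ l ≠ 1, c ≤ ‖F l‖) (l : ℝ) : c ≤ ‖F l‖ := by
  have hcl : IsClosed {l | c ≤ ‖F l‖} := isClosed_le continuous_const hF.norm
  have := (dense_compl_singleton (1 : ℝ)).mono (s₂ := {l | c ≤ ‖F l‖}) fun l hl => h l hl
  exact hcl.closure_subset (this l)

theorem scatA_sqrt (hU : IsPotential U U₁) {l : ℝ} (hl : l ≠ 1) :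
    scatA U (Complex.sqrt ((l - 1 : ℝ) : ℂ)) = scatDiag (lowF U) (lowG U U₁) l := by
  have := (scattering_lower hU (sqrt_sq_ofReal (l - 1))
    (sqrt_ofReal_ne_zero (sub_ne_zero.2 hl))).1
  rwa [sub_add_cancel] at this

/-- Both functions equal a away from l = 1. Hence one lower bound serves r₋ and r₊. -/
theorem scatDiag_lower_eq_upper (hU : IsPotential U U₁) :
    scatDiag (lowF U) (lowG U U₁) = scatDiag (upF U U₁) (upG U) := by
  refine eq_of_eq_off_one (continuous_scatDiag hU.memL21_lowF hU.memL21_lowG)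
    (continuous_scatDiag hU.memL21_upF hU.memL21_upG) fun l hl => ?_
  have := (scattering_upper hU (sqrt_sq_ofReal (l - 1))
    (sqrt_ofReal_ne_zero (sub_ne_zero.2 hl))).1
  rw [← scatA_sqrt hU hl, this, sub_add_cancel]

theorem sqrt_ofReal_of_nonneg {z : ℝ} (hz : 0 ≤ z) : Complex.sqrt (z : ℂ) = (Real.sqrt z : ℝ) := by
  rw [Complex.sqrt_of_nonneg (by exact_mod_cast hz), Complex.ofReal_re]

theorem conj_sqrt_of_nonpos {z : ℝ} (hz : z ≤ 0) :
    conj (Complex.sqrt (z : ℂ)) = -1 * Complex.sqrt (z : ℂ) := by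
  have h : 0 ≤ -z := by linarith
  have e : (z : ℂ) = -((-z : ℝ) : ℂ) := by push_cast; ring
  rw [e, Complex.sqrt_neg_of_nonneg (Complex.zero_le_real.2 h), sqrt_ofReal_of_nonneg h]
  simp

/-- Conservation of energy for real spectral parameters. -/
theorem norm_sq_add_norm_sq (hU : IsPotential U U₁) (k : ℝ) :
    ‖scatA U k‖ ^ 2 + ‖scatB U k‖ ^ 2 = 1 := by
  have := scattering_energy hU (k := k) (z := k ^ 2) (by push_cast; ring) (s := 1) (by ring)
    (map_one _) (by simp)
  rw [one_mul, ← ofReal_norm_sq, ← ofReal_norm_sq] at this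
  exact_mod_cast this

/-- The diagonal coefficient is at least `1` for imaginary spectral parameters. -/
theorem one_le_norm_scatA (hU : IsPotential U U₁) {k : ℂ} {z : ℝ} (hk : k ^ 2 = z)
    (hk' : conj k = -1 * k) : 1 ≤ ‖scatA U k‖ := by
  have := scattering_energy hU hk (s := -1) (by ring) (by simp) hk'
  rw [← ofReal_norm_sq, ← ofReal_norm_sq] at this
  have h : ‖scatA U k‖ ^ 2 + -1 * ‖scatB U k‖ ^ 2 = 1 := by exact_mod_cast this
  nlinarith [sq_nonneg ‖scatB U k‖, norm_nonneg (scatA U k)]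

theorem one_le_norm_scatDiag (hU : IsPotential U U₁) {l : ℝ} (hl : l < 1) :
    1 ≤ ‖scatDiag (lowF U) (lowG U U₁) l‖ := by
  rw [← scatA_sqrt hU hl.ne]
  exact one_le_norm_scatA hU (sqrt_sq_ofReal _) (conj_sqrt_of_nonpos (by linarith))

theorem scatA_real_sqrt (hU : IsPotential U U₁) {l : ℝ} (hl : 1 < l) :
    scatA U (Real.sqrt (l - 1) : ℝ) = scatDiag (lowF U) (lowG U U₁) l := by
  rw [← sqrt_ofReal_of_nonneg (by linarith), scatA_sqrt hU hl.ne']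

/-- The hypothesis concerns real k, that is l ≥ 1. For l < 1 the parameter k is imaginary and |a| ≥
1 holds automatically. -/
theorem min_le_norm_scatDiag (hU : IsPotential U U₁) {c : ℝ}
    (h : ∀ k : ℝ, c ≤ ‖scatA U k‖) (l : ℝ) :
    min c 1 ≤ ‖scatDiag (lowF U) (lowG U U₁) l‖ := by
  refine ge_of_ge_off_one (continuous_scatDiag hU.memL21_lowF hU.memL21_lowG) (fun l hl => ?_) l
  rcases lt_or_gt_of_ne hl with hl | hl
  · exact (min_le_right _ _).trans (one_le_norm_scatDiag hU hl)
  · rw [← scatA_real_sqrt hU hl]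
    exact (min_le_left _ _).trans (h _)

/-- For l > 1 the conservation law gives |a| ≥ 1/2 wherever |b|² ≤ 1/2. The two gauge
transformations provide this for large and for small k, and the remaining interval is compact. -/
theorem exists_scatDiag_ge (hU : IsPotential U U₁) (h : ∀ k : ℝ, scatA U k ≠ 0) :
    ∃ c : ℝ, 0 < c ∧ ∀ l, c ≤ ‖scatDiag (lowF U) (lowG U U₁) l‖ := by
  obtain ⟨C, hC, hlow⟩ := exists_norm_scatOff_le hU.memL21_lowF hU.memL21_lowG
  obtain ⟨D, hD, hup⟩ := exists_norm_scatOff_le hU.memL21_upF hU.memL21_upG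
  have hcont := continuous_scatDiag hU.memL21_lowF hU.memL21_lowG
  have half : ∀ k : ℝ, ‖scatB U k‖ ^ 2 ≤ 1 / 2 → 1 / 2 ≤ ‖scatA U k‖ := fun k hb => by
    have := norm_sq_add_norm_sq hU k
    nlinarith [norm_nonneg (scatA U k)]
  have ck : ∀ k : ℝ, (k : ℂ) ^ 2 = ((k ^ 2 : ℝ) : ℂ) := fun k => by push_cast; ring
  -- The product 2kb is bounded by C, so k ≥ C + 1 forces |b| ≤ 1/2.
  have large : ∀ k : ℝ, C + 1 ≤ k → 1 / 2 ≤ ‖scatA U k‖ := fun k hk => by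
    have hk0 : 0 < k := by linarith
    refine half k ?_
    have e := (scattering_lower hU (ck k) (by exact_mod_cast hk0.ne')).2
    have h1 := hlow (k ^ 2 + 1)
    rw [← e, norm_mul, norm_mul, Complex.norm_real, Complex.norm_ofNat,
      Real.norm_of_nonneg hk0.le] at h1
    have hb := norm_nonneg (scatB U k)
    have : ‖scatB U k‖ ≤ 1 / 2 := by
      by_contra! hcon
      nlinarith
    nlinarith
  -- The quotient b/k is bounded by D, and k ≤ 1/(2(D + 1)) forces |b| ≤ 1/2.
  have small : ∀ k : ℝ, 0 < k → k * (2 * (D + 1)) ≤ 1 → 1 / 2 ≤ ‖scatA U k‖ := fun k hk0 hk => by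
    refine half k ?_
    have e := (scattering_upper hU (ck k) (by exact_mod_cast hk0.ne')).2
    have h1 := hup (k ^ 2 + 1)
    have hb := norm_nonneg (scatB U k)
    have : ‖scatB U k‖ ≤ k * D := by
      rw [e, norm_mul, Complex.norm_real, Real.norm_of_nonneg hk0.le]
      gcongr
    have : ‖scatB U k‖ ≤ 1 / 2 := by nlinarith
    nlinarith
  set δ := 1 / (2 * (D + 1)) with hδ
  have hδ0 : 0 < δ := by positivity
  obtain ⟨m, hm, hmin⟩ : ∃ m : ℝ, 0 < m ∧ ∀ l ∈ Icc (1 + δ ^ 2) (1 + (C + 1) ^ 2),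
      m ≤ ‖scatDiag (lowF U) (lowG U U₁) l‖ := by
    rcases (Icc (1 + δ ^ 2) (1 + (C + 1) ^ 2)).eq_empty_or_nonempty with he | hne
    · exact ⟨1, one_pos, fun l hl => by rw [he] at hl; exact hl.elim⟩
    · obtain ⟨x, hx, hxm⟩ := isCompact_Icc.exists_isMinOn hne hcont.norm.continuousOn
      refine ⟨_, ?_, fun l hl => hxm hl⟩
      have hx1 : 1 < x := by nlinarith [hx.1, sq_pos_of_pos hδ0]
      beta_reduce
      rw [← scatA_real_sqrt hU hx1]
      exact norm_pos_iff.2 (h _)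
  refine ⟨min m (1 / 2), by positivity, ge_of_ge_off_one hcont fun l hl => ?_⟩
  rcases lt_or_gt_of_ne hl with hl | hl
  · exact (min_le_right _ _).trans ((by norm_num : (1 : ℝ) / 2 ≤ 1).trans
      (one_le_norm_scatDiag hU hl))
  by_cases h1 : l ≤ 1 + δ ^ 2
  · rw [← scatA_real_sqrt hU hl]
    refine (min_le_right _ _).trans (small _ (Real.sqrt_pos.2 (by linarith)) ?_)
    have : Real.sqrt (l - 1) ≤ δ := Real.sqrt_le_iff.2 ⟨hδ0.le, by linarith⟩
    calc Real.sqrt (l - 1) * (2 * (D + 1)) ≤ δ * (2 * (D + 1)) := by gcongr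
      _ = 1 := by rw [hδ]; field_simp
  by_cases h2 : 1 + (C + 1) ^ 2 ≤ l
  · rw [← scatA_real_sqrt hU hl]
    exact (min_le_right _ _).trans (large _ (Real.le_sqrt_of_sq_le (by linarith)))
  · exact (min_le_left _ _).trans (hmin l ⟨(not_le.1 h1).le, (not_le.1 h2).le⟩)

end

/-! ### Dependence on the class of the potential -/

theorem coeffMatrix_ae_eq {u U : ℝ → ℂ} (h : u =ᵐ[volume] U) (k : ℂ) :
    coeffMatrix u k =ᵐ[volume] coeffMatrix U k :=
  h.mono fun y hy => by rw [coeffMatrix, coeffMatrix, hy]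

theorem setIntegral_coeffMatrix_congr {u U : ℝ → ℂ} (h : u =ᵐ[volume] U) (k : ℂ) (S : Set ℝ)
    (D : ℝ → Matrix (Fin 2) (Fin 2) ℂ) (f : ℝ → Fin 2 → ℂ) :
    ∫ y in S, (D y * coeffMatrix u k y).mulVec (f y)
      = ∫ y in S, (D y * coeffMatrix U k y).mulVec (f y) :=
  integral_congr_ae (ae_restrict_of_ae ((coeffMatrix_ae_eq h k).mono fun y hy => by
    dsimp only; rw [hy]))

/-- The potential enters the defining predicates only under integrals. Almost everywhere equal
potentials give equal predicates, hence the same choices. -/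
theorem scatteringPair_congr_ae {u U : ℝ → ℂ} (h : u =ᵐ[volume] U) (k : ℂ) :
    scatteringPair u k = scatteringPair U k := by
  have h1 : IsVarphiMinus u k = IsVarphiMinus U k := by
    ext f; simp only [IsVarphiMinus, setIntegral_coeffMatrix_congr h k]
  have h2 : IsVarphiPlus u k = IsVarphiPlus U k := by
    ext f; simp only [IsVarphiPlus, setIntegral_coeffMatrix_congr h k]
  have h3 : IsPhiPlus u k = IsPhiPlus U k := by
    ext f; simp only [IsPhiPlus, setIntegral_coeffMatrix_congr h k]
  have h4 : IsScatteringPair u k = IsScatteringPair U k := by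
    ext s; simp only [IsScatteringPair, varphiMinus, varphiPlus, phiPlus, h1, h2, h3]
  rw [scatteringPair, scatteringPair, h4]

theorem scatA_congr_ae {u U : ℝ → ℂ} (h : u =ᵐ[volume] U) (k : ℂ) : scatA u k = scatA U k := by
  rw [scatA, scatA, scatteringPair_congr_ae h]

theorem scatB_congr_ae {u U : ℝ → ℂ} (h : u =ᵐ[volume] U) (k : ℂ) : scatB u k = scatB U k := by
  rw [scatB, scatB, scatteringPair_congr_ae h]

section

variable {u U U₁ : ℝ → ℂ}

/-- The first system absorbs the factor 2k of r₋ into its off-diagonal Wronskian; the second one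
absorbs 1/k in r₊. -/
theorem rMinus_eq (h : u =ᵐ[volume] U) (hU : IsPotential U U₁) {z : ℝ} (hz : z ≠ 0) :
    rMinus u z = scatQuot (lowF U) (lowG U U₁) (z + 1) := by
  obtain ⟨eA, eB⟩ := scattering_lower hU (sqrt_sq_ofReal z) (sqrt_ofReal_ne_zero hz)
  rw [rMinus, reflection, scatA_congr_ae h, scatB_congr_ae h, scatQuot, ← eA, ← eB]
  ring

theorem rPlus_eq (h : u =ᵐ[volume] U) (hU : IsPotential U U₁) {z : ℝ} (hz : z ≠ 0) :
    rPlus u z = (1 / 2) * scatQuot (upF U U₁) (upG U) (z + 1) := by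
  have h0 := sqrt_ofReal_ne_zero hz
  obtain ⟨eA, eB⟩ := scattering_upper hU (sqrt_sq_ofReal z) h0
  rw [rPlus, reflection, scatA_congr_ae h, scatB_congr_ae h, scatQuot, ← eA, eB]
  field_simp

end

/-! ### Lipschitz dependence of the coefficients on the potential -/

/-- Two bounded functions whose difference is bounded by `K η`. -/
structure BoundPair (X X' : ℝ → ℂ) (K η : ℝ) : Prop where
  meas : AEStronglyMeasurable X
  meas' : AEStronglyMeasurable X'
  le : ∀ x, ‖X x‖ ≤ K
  le' : ∀ x, ‖X' x‖ ≤ K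
  sub_le : ∀ x, ‖X x - X' x‖ ≤ K * η

/-- Two functions in a weighted `L²` space whose difference has norm at most `K η`. -/
structure WeightPair (ρ : ℝ → ℝ) (X X' : ℝ → ℂ) (K η : ℝ) : Prop where
  meas : AEStronglyMeasurable X
  meas' : AEStronglyMeasurable X'
  le : eLpNorm (fun x => (ρ x : ℂ) * X x) 2 volume ≤ ENNReal.ofReal K
  le' : eLpNorm (fun x => (ρ x : ℂ) * X' x) 2 volume ≤ ENNReal.ofReal K
  sub_le : eLpNorm (fun x => (ρ x : ℂ) * (X x - X' x)) 2 volume ≤ ENNReal.ofReal (K * η)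

theorem eLpNorm_weight_mul_le {ρ : ℝ → ℝ} {X Y : ℝ → ℂ} {K L : ℝ} (hK : 0 ≤ K)
    (hX : ∀ x, ‖X x‖ ≤ K) (hY : eLpNorm (fun x => (ρ x : ℂ) * Y x) 2 volume ≤ ENNReal.ofReal L) :
    eLpNorm (fun x => (ρ x : ℂ) * (X x * Y x)) 2 volume ≤ ENNReal.ofReal (K * L) := by
  simpa only [mul_left_comm] using eLpNorm_mul_le_of_bound hK hX hY

theorem eLpNorm_weight_add_le {ρ : ℝ → ℝ} (hρ : Continuous ρ) {X Y : ℝ → ℂ} {K L : ℝ}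
    (hK : 0 ≤ K) (hL : 0 ≤ L) (mX : AEStronglyMeasurable X) (mY : AEStronglyMeasurable Y)
    (hX : eLpNorm (fun x => (ρ x : ℂ) * X x) 2 volume ≤ ENNReal.ofReal K)
    (hY : eLpNorm (fun x => (ρ x : ℂ) * Y x) 2 volume ≤ ENNReal.ofReal L) :
    eLpNorm (fun x => (ρ x : ℂ) * (X x + Y x)) 2 volume ≤ ENNReal.ofReal (K + L) := by
  rw [ENNReal.ofReal_add hK hL]
  have mρ : AEStronglyMeasurable fun x => (ρ x : ℂ) :=
    (Complex.continuous_ofReal.comp hρ).aestronglyMeasurable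
  simp_rw [mul_add]
  exact (eLpNorm_add_le (mρ.mul mX) (mρ.mul mY) (by norm_num)).trans (add_le_add hX hY)

theorem aestronglyMeasurable_conj {X : ℝ → ℂ} (h : AEStronglyMeasurable X) :
    AEStronglyMeasurable fun x => conj (X x) :=
  Complex.continuous_conj.comp_aestronglyMeasurable h

section

variable {ρ : ℝ → ℝ} {X X' Y Y' : ℝ → ℂ} {K L η : ℝ}

theorem BoundPair.nonneg (h : BoundPair X X' K η) : 0 ≤ K := (norm_nonneg _).trans (h.le 0)

theorem BoundPair.star (h : BoundPair X X' K η) :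
    BoundPair (fun x => conj (X x)) (fun x => conj (X' x)) K η := by
  refine ⟨aestronglyMeasurable_conj h.meas, aestronglyMeasurable_conj h.meas', fun x => ?_,
    fun x => ?_, fun x => ?_⟩
  · rw [RCLike.norm_conj]; exact h.le x
  · rw [RCLike.norm_conj]; exact h.le' x
  · rw [← map_sub, RCLike.norm_conj]; exact h.sub_le x

theorem BoundPair.mul (hX : BoundPair X X' K η) (hY : BoundPair Y Y' L η) :
    BoundPair (fun x => X x * Y x) (fun x => X' x * Y' x) (2 * (K * L)) η := by
  have hK := hX.nonneg
  have hL := hY.nonneg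
  have hKL : 0 ≤ K * L := mul_nonneg hK hL
  refine ⟨hX.meas.mul hY.meas, hX.meas'.mul hY.meas', fun x => ?_, fun x => ?_, fun x => ?_⟩
  · rw [norm_mul]
    have := mul_le_mul (hX.le x) (hY.le x) (norm_nonneg _) hK
    linarith
  · rw [norm_mul]
    have := mul_le_mul (hX.le' x) (hY.le' x) (norm_nonneg _) hK
    linarith
  · have e : X x * Y x - X' x * Y' x = (X x - X' x) * Y x + X' x * (Y x - Y' x) := by ring
    rw [e]
    refine (norm_add_le _ _).trans ?_
    rw [norm_mul, norm_mul]
    have h1 := mul_le_mul (hX.sub_le x) (hY.le x) (norm_nonneg _)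
      ((norm_nonneg _).trans (hX.sub_le x))
    have h2 := mul_le_mul (hX.le' x) (hY.sub_le x) (norm_nonneg _) hK
    linarith

theorem BoundPair.mul_weight (hρ : Continuous ρ) (hX : BoundPair X X' K η)
    (hY : WeightPair ρ Y Y' L η) (hL : 0 ≤ L) (hη : 0 ≤ η) :
    WeightPair ρ (fun x => X x * Y x) (fun x => X' x * Y' x) (2 * (K * L)) η := by
  have hK := hX.nonneg
  have hKL : 0 ≤ K * L := mul_nonneg hK hL
  refine ⟨hX.meas.mul hY.meas, hX.meas'.mul hY.meas',
    (eLpNorm_weight_mul_le hK hX.le hY.le).trans (ENNReal.ofReal_le_ofReal (by linarith)),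
    (eLpNorm_weight_mul_le hK hX.le' hY.le').trans (ENNReal.ofReal_le_ofReal (by linarith)), ?_⟩
  have e : ∀ x, X x * Y x - X' x * Y' x = (X x - X' x) * Y x + X' x * (Y x - Y' x) := fun x => by
    ring
  simp_rw [e]
  refine (eLpNorm_weight_add_le hρ (by positivity) (by positivity)
    ((hX.meas.sub hX.meas').mul hY.meas) (hX.meas'.mul (hY.meas.sub hY.meas'))
    (eLpNorm_weight_mul_le (by positivity) hX.sub_le hY.le)
    (eLpNorm_weight_mul_le hK hX.le' hY.sub_le)).trans (ENNReal.ofReal_le_ofReal ?_)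
  linarith

theorem WeightPair.mono (h : WeightPair ρ X X' K η) (hη : 0 ≤ η) (hKL : K ≤ L) :
    WeightPair ρ X X' L η :=
  ⟨h.meas, h.meas', h.le.trans (ENNReal.ofReal_le_ofReal hKL),
    h.le'.trans (ENNReal.ofReal_le_ofReal hKL),
    h.sub_le.trans (ENNReal.ofReal_le_ofReal (by gcongr))⟩

theorem WeightPair.add (hρ : Continuous ρ) (hX : WeightPair ρ X X' K η)
    (hY : WeightPair ρ Y Y' L η) (hK : 0 ≤ K) (hL : 0 ≤ L) (hη : 0 ≤ η) :
    WeightPair ρ (fun x => X x + Y x) (fun x => X' x + Y' x) (K + L) η := by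
  refine ⟨hX.meas.add hY.meas, hX.meas'.add hY.meas',
    eLpNorm_weight_add_le hρ hK hL hX.meas hY.meas hX.le hY.le,
    eLpNorm_weight_add_le hρ hK hL hX.meas' hY.meas' hX.le' hY.le', ?_⟩
  have e : ∀ x, X x + Y x - (X' x + Y' x) = (X x - X' x) + (Y x - Y' x) := fun x => by ring
  simp_rw [e, add_mul]
  exact eLpNorm_weight_add_le hρ (by positivity) (by positivity) (hX.meas.sub hX.meas')
    (hY.meas.sub hY.meas') hX.sub_le hY.sub_le

theorem WeightPair.const_mul (h : WeightPair ρ X X' K η) (c : ℂ) :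
    WeightPair ρ (fun x => c * X x) (fun x => c * X' x) (‖c‖ * K) η := by
  have hc := norm_nonneg c
  have hb : ∀ _ : ℝ, ‖c‖ ≤ ‖c‖ := fun _ => le_rfl
  refine ⟨h.meas.const_mul c, h.meas'.const_mul c, eLpNorm_weight_mul_le hc hb h.le,
    eLpNorm_weight_mul_le hc hb h.le', ?_⟩
  simp_rw [← mul_sub]
  rw [mul_assoc]
  exact eLpNorm_weight_mul_le hc hb h.sub_le

theorem WeightPair.star (h : WeightPair ρ X X' K η) :
    WeightPair ρ (fun x => conj (X x)) (fun x => conj (X' x)) K η := by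
  have e : ∀ Z : ℝ → ℂ, eLpNorm (fun x => (ρ x : ℂ) * conj (Z x)) 2 volume
      = eLpNorm (fun x => (ρ x : ℂ) * Z x) 2 volume := fun Z =>
    eLpNorm_congr_norm_ae (Eventually.of_forall fun x => by
      rw [norm_mul, norm_mul, RCLike.norm_conj])
  refine ⟨aestronglyMeasurable_conj h.meas, aestronglyMeasurable_conj h.meas',
    (e X).trans_le h.le, (e X').trans_le h.le', ?_⟩
  simp_rw [← map_sub]
  exact (e fun x => X x - X' x).trans_le h.sub_le

end

/-- The weight of `L^{2,1}`. -/
noncomputable def bracket (x : ℝ) : ℝ := Real.sqrt (1 + x ^ 2)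

theorem continuous_bracket : Continuous bracket := by unfold bracket; fun_prop

theorem weightPair_of_memL21 {X X' : ℝ → ℂ} {K η : ℝ} (h : MemL21 X) (h' : MemL21 X')
    (hX : l21Norm X ≤ K) (hX' : l21Norm X' ≤ K) (hs : l21Norm (fun x => X x - X' x) ≤ K * η) :
    WeightPair bracket X X' K η := by
  refine ⟨h.aestronglyMeasurable, h'.aestronglyMeasurable, ?_, ?_, ?_⟩
  · exact h.eLpNorm_weighted.trans_le (ENNReal.ofReal_le_ofReal hX)
  · exact h'.eLpNorm_weighted.trans_le (ENNReal.ofReal_le_ofReal hX')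
  · exact (h.sub h').eLpNorm_weighted.trans_le (ENNReal.ofReal_le_ofReal hs)

theorem memL21_of_eLpNorm_le {X : ℝ → ℂ} {K : ℝ} (hK : 0 ≤ K) (hm : AEStronglyMeasurable X)
    (h : eLpNorm (fun x => (bracket x : ℂ) * X x) 2 volume ≤ ENNReal.ofReal K) :
    MemL21 X ∧ l21Norm X ≤ K :=
  ⟨⟨(Complex.continuous_ofReal.comp continuous_bracket).aestronglyMeasurable.mul hm,
    h.trans_lt ENNReal.ofReal_lt_top⟩, ENNReal.toReal_le_of_le_ofReal hK h⟩

theorem WeightPair.closePairs {f f' g g' : ℝ → ℂ} {K η : ℝ} (hf : WeightPair bracket f f' K η)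
    (hg : WeightPair bracket g g' K η) (hK : 0 ≤ K) (hη : 0 ≤ η) :
    ClosePairs K (K * η) f g f' g' := by
  obtain ⟨a1, b1⟩ := memL21_of_eLpNorm_le hK hf.meas hf.le
  obtain ⟨a2, b2⟩ := memL21_of_eLpNorm_le hK hf.meas' hf.le'
  obtain ⟨a3, b3⟩ := memL21_of_eLpNorm_le hK hg.meas hg.le
  obtain ⟨a4, b4⟩ := memL21_of_eLpNorm_le hK hg.meas' hg.le'
  exact ⟨⟨a1, a3, b1, b3⟩, ⟨a2, a4, b2, b4⟩,
    (memL21_of_eLpNorm_le (by positivity) (hf.meas.sub hf.meas') hf.sub_le).2,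
    (memL21_of_eLpNorm_le (by positivity) (hg.meas.sub hg.meas') hg.sub_le).2⟩

/-- Two potentials of norm at most `N` at distance at most `N η` in `H^{1,1}`. -/
structure PotentialPair (N η : ℝ) (U U₁ V V₁ : ℝ → ℂ) : Prop where
  fst : IsPotential U U₁
  snd : IsPotential V V₁
  le : l21Norm U ≤ N
  le₁ : l21Norm U₁ ≤ N
  le' : l21Norm V ≤ N
  le₁' : l21Norm V₁ ≤ N
  sub_le : l21Norm (fun x => U x - V x) ≤ N * η
  sub_le₁ : l21Norm (fun x => U₁ x - V₁ x) ≤ N * η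

theorem IsPotential.sub {U U₁ V V₁ : ℝ → ℂ} (h : IsPotential U U₁) (h' : IsPotential V V₁) :
    IsPotential (fun x => U x - V x) fun x => U₁ x - V₁ x :=
  ⟨h.mem.sub h'.mem, h.mem₁.sub h'.mem₁, h.prim.sub h'.prim⟩

/-- The derivative of `gaugeW`. -/
noncomputable def gaugeW₁ (U U₁ U₂ : ℝ → ℂ) (x : ℝ) : ℂ :=
  -Complex.I * U₂ x + 2 * U₁ x
    + (-1 / 2) * (2 * (U x * conj (U x) * U₁ x) + U x * U x * conj (U₁ x))

section

variable {N η : ℝ} {U U₁ V V₁ : ℝ → ℂ}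

theorem PotentialPair.boundPair (h : PotentialPair N η U U₁ V V₁) :
    BoundPair U V (2 * N) η := by
  refine ⟨h.fst.mem.aestronglyMeasurable, h.snd.mem.aestronglyMeasurable,
    fun x => (h.fst.norm_le x).trans (by linarith [h.le₁]),
    fun x => (h.snd.norm_le x).trans (by linarith [h.le₁']), fun x => ?_⟩
  exact ((h.fst.sub h.snd).norm_le x).trans (by linarith [h.sub_le₁])

theorem PotentialPair.weightPair (h : PotentialPair N η U U₁ V V₁) :
    WeightPair bracket U V N η :=
  weightPair_of_memL21 h.fst.mem h.snd.mem h.le h.le' h.sub_le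

theorem PotentialPair.weightPair₁ (h : PotentialPair N η U U₁ V V₁) :
    WeightPair bracket U₁ V₁ N η :=
  weightPair_of_memL21 h.fst.mem₁ h.snd.mem₁ h.le₁ h.le₁' h.sub_le₁

theorem PotentialPair.nonneg (h : PotentialPair N η U U₁ V V₁) : 0 ≤ N :=
  (l21Norm_nonneg U).trans h.le

/-- A bound for the coefficients of the off-diagonal systems. -/
noncomputable def coeffConst (N : ℝ) : ℝ := 4 * N + 2 * (2 * (2 * N * (2 * N)) * N) * 2

theorem coeffConst_nonneg (hN : 0 ≤ N) : 0 ≤ coeffConst N := by unfold coeffConst; positivity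

theorem PotentialPair.gaugeW (h : PotentialPair N η U U₁ V V₁) (hη : 0 ≤ η) :
    WeightPair bracket (gaugeW U U₁) (gaugeW V V₁) (coeffConst N) η := by
  have hN := h.nonneg
  have hb := continuous_bracket
  have b := h.boundPair
  have w := h.weightPair
  have c := (b.mul b.star).mul_weight hb w hN hη
  have := ((h.weightPair₁.const_mul (-Complex.I)).add hb (w.const_mul 2) (by positivity)
    (by positivity) hη).add hb (c.const_mul (-1 / 2)) (by positivity) (by positivity) hη
  have e : ∀ X X₁ : ℝ → ℂ, _root_.gaugeW X X₁ = fun x => -Complex.I * X₁ x + 2 * X x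
      + -1 / 2 * (X x * conj (X x) * X x) := fun X X₁ => by
    ext x; rw [_root_.gaugeW]; ring
  rw [e, e]
  refine this.mono hη ?_
  have h3 : 0 ≤ N * N * N := by positivity
  simp only [norm_neg, Complex.norm_I, Complex.norm_ofNat, norm_div, norm_one, coeffConst]
  nlinarith

theorem PotentialPair.closePairs_low (h : PotentialPair N η U U₁ V V₁) (hη : 0 ≤ η) :
    ClosePairs (coeffConst N) (coeffConst N * η) (lowF U) (lowG U U₁) (lowF V) (lowG V V₁) := by
  have hN := h.nonneg
  refine WeightPair.closePairs ?_ (h.gaugeW hη).star (coeffConst_nonneg hN) hη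
  have e : ∀ X : ℝ → ℂ, lowF X = fun x => 1 / 2 * X x := fun X => by ext x; rw [lowF]; ring
  rw [e, e]
  refine (h.weightPair.const_mul (1 / 2)).mono hη ?_
  have h3 : 0 ≤ N * N * N := by positivity
  simp only [Complex.norm_ofNat, norm_div, norm_one, coeffConst]
  nlinarith

theorem PotentialPair.closePairs_up (h : PotentialPair N η U U₁ V V₁) (hη : 0 ≤ η) :
    ClosePairs (coeffConst N) (coeffConst N * η) (upF U U₁) (upG U) (upF V V₁) (upG V) := by
  have hN := h.nonneg
  have hC := coeffConst_nonneg hN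
  have h3 : 0 ≤ N * N * N := by positivity
  refine WeightPair.closePairs ?_ ?_ hC hη
  · have e : ∀ X X₁ : ℝ → ℂ, upF X X₁ = fun x => -1 / 2 * _root_.gaugeW X X₁ x := fun X X₁ => by
      ext x; rw [upF]; ring
    rw [e, e]
    refine ((h.gaugeW hη).const_mul (-1 / 2)).mono hη ?_
    simp only [norm_neg, Complex.norm_ofNat, norm_div, norm_one]
    linarith
  · have e : ∀ X : ℝ → ℂ, upG X = fun x => -1 * conj (X x) := fun X => by ext x; rw [upG]; ring
    rw [e, e]
    refine (h.weightPair.star.const_mul (-1)).mono hη ?_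
    simp only [norm_neg, norm_one, coeffConst]
    nlinarith

/-- The integrable case applied to |F|², whose derivative is integrable by Cauchy-Schwarz. -/
theorem tendsto_zero_of_memLp {F f : ℝ → ℂ} (hp : IsPrim F f) (hF : MemLp F 2)
    (hf : MemLp f 2) : Tendsto F atTop (𝓝 0) := by
  have hFs : MemLp (fun x => conj (F x)) 2 := hF.star
  have hfs : MemLp (fun x => conj (f x)) 2 := hf.star
  have h1 := (tendsto_zero_of_integrable (hp.mul hp.star) (hF.integrable_mul hFs)
    ((hf.integrable_mul hFs).add (hF.integrable_mul hfs))).norm.sqrt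
  rw [norm_zero, Real.sqrt_zero] at h1
  refine squeeze_zero_norm (fun x => le_of_eq ?_) h1
  rw [norm_mul, RCLike.norm_conj, Real.sqrt_mul_self (norm_nonneg _)]

/-- Two potentials with second derivatives in `L²`. -/
structure SmoothPair (N η : ℝ) (U U₁ U₂ V V₁ V₂ : ℝ → ℂ) : Prop
    extends PotentialPair N η U U₁ V V₁ where
  prim₁ : IsPrim U₁ U₂
  prim₁' : IsPrim V₁ V₂
  mem₂ : MemLp U₂ 2
  mem₂' : MemLp V₂ 2
  le₂ : eLpNorm U₂ 2 volume ≤ ENNReal.ofReal N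
  le₂' : eLpNorm V₂ 2 volume ≤ ENNReal.ofReal N
  sub_le₂ : eLpNorm (fun x => U₂ x - V₂ x) 2 volume ≤ ENNReal.ofReal (N * η)

theorem WeightPair.eLpNorm_le {X X' : ℝ → ℂ} {K η : ℝ} (h : WeightPair (fun _ => 1) X X' K η) :
    eLpNorm X 2 volume ≤ ENNReal.ofReal K ∧ eLpNorm X' 2 volume ≤ ENNReal.ofReal K ∧
      eLpNorm (fun x => X x - X' x) 2 volume ≤ ENNReal.ofReal (K * η) := by
  have h1 := h.le
  have h2 := h.le'
  have h3 := h.sub_le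
  simp only [Complex.ofReal_one, one_mul] at h1 h2 h3
  exact ⟨h1, h2, h3⟩

theorem weightPair_one {X X' : ℝ → ℂ} {K η : ℝ} (h : MemL21 X) (h' : MemL21 X')
    (hX : l21Norm X ≤ K) (hX' : l21Norm X' ≤ K) (hs : l21Norm (fun x => X x - X' x) ≤ K * η) :
    WeightPair (fun _ => 1) X X' K η := by
  refine ⟨h.aestronglyMeasurable, h'.aestronglyMeasurable, ?_, ?_, ?_⟩ <;>
    simp only [Complex.ofReal_one, one_mul]
  · exact h.eLpNorm_le.trans (ENNReal.ofReal_le_ofReal hX)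
  · exact h'.eLpNorm_le.trans (ENNReal.ofReal_le_ofReal hX')
  · exact (h.sub h').eLpNorm_le.trans (ENNReal.ofReal_le_ofReal hs)

theorem IsPotential.isPrim_gaugeW {U₂ : ℝ → ℂ} (h : IsPotential U U₁) (h₂ : IsPrim U₁ U₂) :
    IsPrim (_root_.gaugeW U U₁) (gaugeW₁ U U₁ U₂) := by
  have hp := h.prim
  have := ((h₂.const_mul (-Complex.I)).add (hp.const_mul 2)).sub
    (((hp.mul hp.star).mul hp).const_mul (1 / 2))
  have e : _root_.gaugeW U U₁ = fun x => -Complex.I * U₁ x + 2 * U x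
      - 1 / 2 * (U x * conj (U x) * U x) := by
    ext x; rw [_root_.gaugeW]; ring
  rw [e]
  refine this.congr_ae (Eventually.of_forall fun x => ?_)
  dsimp only
  rw [gaugeW₁]; ring

/-- A bound for the derivatives of the coefficients of the off-diagonal systems. -/
noncomputable def derivConst (N : ℝ) : ℝ := coeffConst N + 3 * N + 6 * (2 * (2 * N * (2 * N)) * N)

theorem derivConst_nonneg (hN : 0 ≤ N) : 0 ≤ derivConst N := by
  have := coeffConst_nonneg hN
  unfold derivConst; positivity

theorem SmoothPair.gaugeW₁ {U₂ V₂ : ℝ → ℂ} (h : SmoothPair N η U U₁ U₂ V V₁ V₂) (hη : 0 ≤ η) :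
    WeightPair (fun _ => 1) (gaugeW₁ U U₁ U₂) (gaugeW₁ V V₁ V₂) (derivConst N) η := by
  have hN := h.nonneg
  have hb : Continuous fun _ : ℝ => (1 : ℝ) := continuous_const
  have b := h.boundPair
  have w₁ := weightPair_one h.fst.mem₁ h.snd.mem₁ h.le₁ h.le₁' h.sub_le₁
  have w₂ : WeightPair (fun _ => 1) U₂ V₂ N η := by
    refine ⟨h.mem₂.1, h.mem₂'.1, ?_, ?_, ?_⟩ <;> simp only [Complex.ofReal_one, one_mul]
    exacts [h.le₂, h.le₂', h.sub_le₂]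
  have c := (b.mul b.star).mul_weight hb w₁ hN hη
  have d := (b.mul b).mul_weight hb w₁.star hN hη
  have := ((w₂.const_mul (-Complex.I)).add hb (w₁.const_mul 2) (by positivity)
    (by positivity) hη).add hb (((c.const_mul 2).add hb d (by positivity) (by positivity)
    hη).const_mul (-1 / 2)) (by positivity) (by positivity) hη
  refine this.mono hη ?_
  have h3 : 0 ≤ N * N * N := by positivity
  have := coeffConst_nonneg hN
  simp only [norm_neg, Complex.norm_I, Complex.norm_ofNat, norm_div, norm_one, derivConst]
  nlinarith

theorem tendsto_conj_zero {F : Filter ℝ} {f : ℝ → ℂ} (h : Tendsto f F (𝓝 0)) :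
    Tendsto (fun x => conj (f x)) F (𝓝 0) := by
  simpa [Function.comp_def] using (Complex.continuous_conj.tendsto _).comp h

theorem tendsto_atBot_zero_of_memLp {F f : ℝ → ℂ} (hp : IsPrim F f) (hF : MemLp F 2)
    (hf : MemLp f 2) : Tendsto F atBot (𝓝 0) := by
  have hn := Measure.measurePreserving_neg (volume : Measure ℝ)
  have := tendsto_zero_of_memLp hp.comp_neg (hF.comp_measurePreserving hn)
    (hf.comp_measurePreserving hn).neg
  simpa [Function.comp_def] using this.comp tendsto_neg_atBot_atTop

theorem diffPair_of_conj {B : ℝ} {f G G₁ : ℝ → ℂ} (h : BddPair B f fun x => conj (G x))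
    (hG : MemL21 G) (hp : IsPrim G G₁) (hm : MemLp G₁ 2)
    (hle : eLpNorm G₁ 2 volume ≤ ENNReal.ofReal B) :
    DiffPair B f (fun x => conj (G x)) fun x => conj (G₁ x) := by
  refine ⟨h, hp.star, hm.star, ?_, tendsto_conj_zero (tendsto_atBot_zero_of_memLp hp hG.memLp hm),
    tendsto_conj_zero (tendsto_zero_of_memLp hp hG.memLp hm)⟩
  exact (eLpNorm_congr_norm_ae (Eventually.of_forall fun x => RCLike.norm_conj _)).trans_le hle

theorem BddPair.mono {B C : ℝ} {f g : ℝ → ℂ} (h : BddPair B f g) (hBC : B ≤ C) :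
    BddPair C f g := ⟨h.memf, h.memg, h.lef.trans hBC, h.leg.trans hBC⟩

theorem ClosePairs.mono {B C η' : ℝ} {f g f' g' : ℝ → ℂ} (h : ClosePairs B η f g f' g')
    (hBC : B ≤ C) (hη : η ≤ η') : ClosePairs C η' f g f' g' :=
  ⟨h.fst.mono hBC, h.snd.mono hBC, h.lef.trans hη, h.leg.trans hη⟩

theorem PotentialPair.closePairs_lower (h : PotentialPair N η U U₁ V V₁) (hη : 0 ≤ η) :
    ClosePairs (derivConst N) (derivConst N * η) (lowF U) (lowG U U₁) (lowF V) (lowG V V₁) := by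
  have hN := h.nonneg
  have hle : coeffConst N ≤ derivConst N := by
    have : 0 ≤ N * N * N := by positivity
    unfold derivConst; nlinarith
  exact (h.closePairs_low hη).mono hle (by gcongr)

theorem PotentialPair.closePairs_upper (h : PotentialPair N η U U₁ V V₁) (hη : 0 ≤ η) :
    ClosePairs (derivConst N) (derivConst N * η) (upF U U₁) (upG U) (upF V V₁) (upG V) := by
  have hN := h.nonneg
  have hle : coeffConst N ≤ derivConst N := by
    have : 0 ≤ N * N * N := by positivity
    unfold derivConst; nlinarith
  exact (h.closePairs_up hη).mono hle (by gcongr)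

theorem eLpNorm_conj_sub (X Y : ℝ → ℂ) :
    eLpNorm (fun x => conj (X x) - conj (Y x)) 2 volume
      = eLpNorm (fun x => X x - Y x) 2 volume :=
  eLpNorm_congr_norm_ae (Eventually.of_forall fun x => by rw [← map_sub, RCLike.norm_conj])

/-- Here the second coefficient is the conjugate of w, which contains u'. Its derivative contains
u'', so this is where H² is used. -/
theorem SmoothPair.diffPair_lower {U₂ V₂ : ℝ → ℂ} (h : SmoothPair N η U U₁ U₂ V V₁ V₂)
    (hη : 0 ≤ η) : ∃ g₁ g₁' : ℝ → ℂ, DiffPair (derivConst N) (lowF U) (lowG U U₁) g₁ ∧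
      DiffPair (derivConst N) (lowF V) (lowG V V₁) g₁' ∧
      eLpNorm (fun y => g₁ y - g₁' y) 2 volume ≤ ENNReal.ofReal (derivConst N * η) := by
  have hc := h.closePairs_lower hη
  have w := h.gaugeW₁ hη
  obtain ⟨h1, h2, h3⟩ := w.eLpNorm_le
  refine ⟨_, _, diffPair_of_conj hc.fst h.fst.memL21_gaugeW (h.fst.isPrim_gaugeW h.prim₁)
    ⟨w.meas, h1.trans_lt ENNReal.ofReal_lt_top⟩ h1,
    diffPair_of_conj hc.snd h.snd.memL21_gaugeW (h.snd.isPrim_gaugeW h.prim₁')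
    ⟨w.meas', h2.trans_lt ENNReal.ofReal_lt_top⟩ h2, ?_⟩
  rw [eLpNorm_conj_sub]
  exact h3

theorem DiffPair.of_neg_conj {B : ℝ} (hU : IsPotential U U₁) {f : ℝ → ℂ}
    (h : BddPair B f (upG U)) (hB : l21Norm U₁ ≤ B) :
    DiffPair B f (upG U) fun x => conj (-U₁ x) := by
  have e : upG U = fun x => conj (-U x) := by ext x; rw [upG, map_neg]
  rw [e] at h ⊢
  have hm : MemL21 fun x => -U x := by simpa using MemL21.zero.sub hU.mem
  refine diffPair_of_conj h hm hU.prim.neg hU.mem₁.memLp.neg ?_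
  exact (eLpNorm_neg U₁ 2 volume).trans_le
    (hU.mem₁.eLpNorm_le.trans (ENNReal.ofReal_le_ofReal hB))

/-- Here the second coefficient is -ū, so the decay of r₊ costs no more than a first derivative of
u. -/
theorem PotentialPair.diffPair_upper (h : PotentialPair N η U U₁ V V₁)
    (hη : 0 ≤ η) : ∃ g₁ g₁' : ℝ → ℂ, DiffPair (derivConst N) (upF U U₁) (upG U) g₁ ∧
      DiffPair (derivConst N) (upF V V₁) (upG V) g₁' ∧
      eLpNorm (fun y => g₁ y - g₁' y) 2 volume ≤ ENNReal.ofReal (derivConst N * η) := by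
  have hc := h.closePairs_upper hη
  have hN := h.nonneg
  have hle : N ≤ derivConst N := by
    have : 0 ≤ N * N * N := by positivity
    have := coeffConst_nonneg hN
    unfold derivConst; nlinarith
  refine ⟨_, _, .of_neg_conj h.fst hc.fst (h.le₁.trans hle),
    .of_neg_conj h.snd hc.snd (h.le₁'.trans hle), ?_⟩
  rw [eLpNorm_conj_sub]
  have e : eLpNorm (fun x => -U₁ x - -V₁ x) 2 volume
      = eLpNorm (fun x => U₁ x - V₁ x) 2 volume :=
    eLpNorm_congr_norm_ae (Eventually.of_forall fun x => by
      rw [← norm_neg]; congr 1; ring)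
  rw [e]
  refine (h.fst.mem₁.sub h.snd.mem₁).eLpNorm_le.trans (ENNReal.ofReal_le_ofReal ?_)
  exact h.sub_le₁.trans (by gcongr)

end

/-! ### Representatives of potentials -/

theorem weighted_congr_ae {f g : ℝ → ℂ} (h : f =ᵐ[volume] g) :
    weighted f =ᵐ[volume] weighted g :=
  h.mono fun x hx => by rw [weighted, weighted, hx]

theorem memL21_congr_ae {f g : ℝ → ℂ} (h : f =ᵐ[volume] g) (hf : MemL21 f) : MemL21 g :=
  MemLp.ae_eq (weighted_congr_ae h) hf

theorem l21Norm_congr_ae {f g : ℝ → ℂ} (h : f =ᵐ[volume] g) : l21Norm f = l21Norm g := by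
  rw [l21Norm, l21Norm, l2Norm, l2Norm, eLpNorm_congr_ae (weighted_congr_ae h)]

theorem NLSGI.IsWeakDeriv.weakDeriv {f g : ℝ → ℂ} (h : IsWeakDeriv f g) :
    IsWeakDeriv f (weakDeriv f) :=
  Classical.epsilon_spec (p := IsWeakDeriv f) ⟨g, h⟩

theorem NLSGI.MemH11.isWeakDeriv {u : ℝ → ℂ} (h : MemH11 u) : IsWeakDeriv u (weakDeriv u) := by
  obtain ⟨-, g, hg, -⟩ := h
  exact IsWeakDeriv.weakDeriv hg

theorem NLSGI.MemH11.memL21_weakDeriv {u : ℝ → ℂ} (h : MemH11 u) : MemL21 (weakDeriv u) := by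
  obtain ⟨-, g, hg, hm⟩ := h
  exact memL21_congr_ae (weakDeriv_ae_eq hg).symm hm

theorem NLSGI.MemH11.exists_isPotential {u : ℝ → ℂ} (h : MemH11 u) :
    ∃ U, u =ᵐ[volume] U ∧ IsPotential U (weakDeriv u) := by
  obtain ⟨U, hU, hp⟩ := h.isWeakDeriv.exists_isPrim
  exact ⟨U, hU, memL21_congr_ae hU h.1, h.memL21_weakDeriv, hp⟩

theorem NLSGI.MemH2.isWeakDeriv {u : ℝ → ℂ} (h : MemH2 u) :
    IsWeakDeriv u (weakDeriv u) ∧ IsWeakDeriv (weakDeriv u) (weakDeriv (weakDeriv u)) ∧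
      MemLp (weakDeriv (weakDeriv u)) 2 := by
  obtain ⟨-, g, k, hg, -, hk, hm⟩ := h
  have e := weakDeriv_ae_eq hg
  have h2 : IsWeakDeriv (weakDeriv u) k := hk.congr_ae e.symm EventuallyEq.rfl
  exact ⟨IsWeakDeriv.weakDeriv hg, IsWeakDeriv.weakDeriv h2, hm.ae_eq (weakDeriv_ae_eq h2).symm⟩

/-- A continuously differentiable representative of a potential. -/
structure IsSmoothRep (u U U₁ : ℝ → ℂ) : Prop where
  ae_eq : u =ᵐ[volume] U
  ae_eq₁ : weakDeriv u =ᵐ[volume] U₁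
  isPotential : IsPotential U U₁
  prim₁ : IsPrim U₁ (weakDeriv (weakDeriv u))
  mem₂ : MemLp (weakDeriv (weakDeriv u)) 2

theorem exists_isSmoothRep {u : ℝ → ℂ} (h : MemH2 u) (h' : MemH11 u) :
    ∃ U U₁, IsSmoothRep u U U₁ := by
  obtain ⟨U, hU, hp⟩ := h'.exists_isPotential
  obtain ⟨-, h2, h3⟩ := h.isWeakDeriv
  obtain ⟨V, hV, hVp⟩ := h2.exists_isPrim
  exact ⟨U, V, hU, hV, ⟨hp.mem, memL21_congr_ae hV hp.mem₁, hp.prim.congr_ae hV⟩, hVp, h3⟩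

theorem l21Norm_le_potentialNorm (u : ℝ → ℂ) : l21Norm u ≤ potentialNorm u := by
  have h1 : 0 ≤ h2Norm u := Real.sqrt_nonneg _
  have h2 : l21Norm u ≤ h11Norm u :=
    Real.le_sqrt_of_sq_le (by nlinarith [sq_nonneg (l21Norm (weakDeriv u))])
  rw [potentialNorm]; linarith

theorem l21Norm_weakDeriv_le_potentialNorm (u : ℝ → ℂ) :
    l21Norm (weakDeriv u) ≤ potentialNorm u := by
  have h1 : 0 ≤ h2Norm u := Real.sqrt_nonneg _
  have h2 : l21Norm (weakDeriv u) ≤ h11Norm u :=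
    Real.le_sqrt_of_sq_le (by nlinarith [sq_nonneg (l21Norm u)])
  rw [potentialNorm]; linarith

theorem l2Norm_weakDeriv_weakDeriv_le_potentialNorm (u : ℝ → ℂ) :
    l2Norm (weakDeriv (weakDeriv u)) ≤ potentialNorm u := by
  have h1 : 0 ≤ h11Norm u := Real.sqrt_nonneg _
  have h2 : l2Norm (weakDeriv (weakDeriv u)) ≤ h2Norm u :=
    Real.le_sqrt_of_sq_le (by nlinarith [sq_nonneg (l2Norm u), sq_nonneg (l2Norm (weakDeriv u))])
  rw [potentialNorm]; linarith

theorem potentialNorm_nonneg (u : ℝ → ℂ) : 0 ≤ potentialNorm u :=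
  (l21Norm_nonneg u).trans (l21Norm_le_potentialNorm u)

theorem eLpNorm_eq_l2Norm {f : ℝ → ℂ} (h : MemLp f 2) :
    eLpNorm f 2 volume = ENNReal.ofReal (l2Norm f) :=
  (ENNReal.ofReal_toReal h.2.ne).symm

theorem weakDeriv_sub_ae_eq {u v : ℝ → ℂ} (hu : MemH2 u) (hv : MemH2 v) :
    weakDeriv (u - v) =ᵐ[volume] (fun x => weakDeriv u x - weakDeriv v x) ∧
    weakDeriv (weakDeriv (u - v)) =ᵐ[volume]
      fun x => weakDeriv (weakDeriv u) x - weakDeriv (weakDeriv v) x := by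
  obtain ⟨u1, u2, -⟩ := hu.isWeakDeriv
  obtain ⟨v1, v2, -⟩ := hv.isWeakDeriv
  have h1 : weakDeriv (u - v) =ᵐ[volume] fun x => weakDeriv u x - weakDeriv v x :=
    weakDeriv_ae_eq (u1.sub v1)
  exact ⟨h1, weakDeriv_ae_eq ((u2.sub v2).congr_ae h1.symm EventuallyEq.rfl)⟩

theorem IsSmoothRep.smoothPair {u v U U₁ V V₁ : ℝ → ℂ} (hu : MemH2 u) (hv : MemH2 v)
    (hU : IsSmoothRep u U U₁) (hV : IsSmoothRep v V V₁) {N : ℝ} (hN : 0 < N)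
    (hNu : potentialNorm u ≤ N) (hNv : potentialNorm v ≤ N) :
    SmoothPair N (potentialNorm (u - v) / N) U U₁ (weakDeriv (weakDeriv u)) V V₁
      (weakDeriv (weakDeriv v)) := by
  obtain ⟨d1, d2⟩ := weakDeriv_sub_ae_eq hu hv
  -- Differences are measured as N η throughout, so η is the distance divided by N; this is why N
  -- has to be positive.
  have e : N * (potentialNorm (u - v) / N) = potentialNorm (u - v) := by field_simp
  refine ⟨⟨hU.isPotential, hV.isPotential, ?_, ?_, ?_, ?_, ?_, ?_⟩, hU.prim₁, hV.prim₁, hU.mem₂,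
    hV.mem₂, ?_, ?_, ?_⟩
  · rw [← l21Norm_congr_ae hU.ae_eq]; exact (l21Norm_le_potentialNorm u).trans hNu
  · rw [← l21Norm_congr_ae hU.ae_eq₁]; exact (l21Norm_weakDeriv_le_potentialNorm u).trans hNu
  · rw [← l21Norm_congr_ae hV.ae_eq]; exact (l21Norm_le_potentialNorm v).trans hNv
  · rw [← l21Norm_congr_ae hV.ae_eq₁]; exact (l21Norm_weakDeriv_le_potentialNorm v).trans hNv
  · rw [e]
    refine le_trans (le_of_eq (l21Norm_congr_ae ?_)) (l21Norm_le_potentialNorm (u - v))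
    filter_upwards [hU.ae_eq, hV.ae_eq] with x h1 h2
    rw [Pi.sub_apply, h1, h2]
  · rw [e]
    refine le_trans (le_of_eq (l21Norm_congr_ae ?_)) (l21Norm_weakDeriv_le_potentialNorm (u - v))
    filter_upwards [hU.ae_eq₁, hV.ae_eq₁, d1] with x h1 h2 h3
    rw [h3, h1, h2]
  · rw [eLpNorm_eq_l2Norm hU.mem₂]
    exact ENNReal.ofReal_le_ofReal ((l2Norm_weakDeriv_weakDeriv_le_potentialNorm u).trans hNu)
  · rw [eLpNorm_eq_l2Norm hV.mem₂]
    exact ENNReal.ofReal_le_ofReal ((l2Norm_weakDeriv_weakDeriv_le_potentialNorm v).trans hNv)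
  · rw [e, ← eLpNorm_congr_ae d2, eLpNorm_eq_l2Norm ((hU.mem₂.sub hV.mem₂).ae_eq d2.symm)]
    exact ENNReal.ofReal_le_ofReal (l2Norm_weakDeriv_weakDeriv_le_potentialNorm (u - v))

theorem IsPotential.potentialPair_self {U U₁ : ℝ → ℂ} (h : IsPotential U U₁) :
    PotentialPair (max (l21Norm U) (l21Norm U₁)) 0 U U₁ U U₁ :=
  ⟨h, h, le_max_left _ _, le_max_right _ _, le_max_left _ _, le_max_right _ _,
    by simp [l21Norm_zero], by simp [l21Norm_zero]⟩

/-! ### Norms of the reflection coefficients -/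

section

variable {r X : ℝ → ℂ} {κ : ℂ} {K : ℝ}

theorem ae_eq_of_ne_zero {Y : ℝ → ℂ} (h : ∀ z ≠ 0, r z = Y z) : r =ᵐ[volume] Y := by
  have : ∀ᵐ z : ℝ, z ≠ 0 := by simp [ae_iff, measure_singleton]
  exact this.mono h

theorem eLpNorm_comp_add_one (hX : AEStronglyMeasurable X) :
    eLpNorm (fun z => X (z + 1)) 2 volume = eLpNorm X 2 volume :=
  eLpNorm_comp_measurePreserving hX (measurePreserving_add_right volume 1)

/-- The argument z + 1 and the exceptional point z = 0 do not affect L² norms. The weak derivative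
comes from the Lipschitz bound for translates. -/
theorem memH1_of_eq (hK : 0 ≤ K) (hκ : ‖κ‖ ≤ 1) (hr : ∀ z ≠ 0, r z = κ * X (z + 1)) (hX : HB X K)
    (h2 : eLpNorm X 2 volume ≤ ENNReal.ofReal K) : MemH1 r ∧ h1Norm r ≤ 2 * K := by
  have hb : ∀ _ : ℝ, ‖κ‖ ≤ 1 := fun _ => hκ
  have hc : Continuous fun z => X (z + 1) := hX.cont.comp (by fun_prop)
  have e := ae_eq_of_ne_zero hr
  have b : eLpNorm (fun z => κ * X (z + 1)) 2 volume ≤ ENNReal.ofReal K := by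
    have := eLpNorm_mul_le_of_bound zero_le_one hb
      ((eLpNorm_comp_add_one hX.cont.aestronglyMeasurable).trans_le h2)
    rwa [one_mul] at this
  have hm : MemLp (fun z => κ * X (z + 1)) 2 :=
    ⟨(hc.const_mul κ).aestronglyMeasurable, b.trans_lt ENNReal.ofReal_lt_top⟩
  obtain ⟨g, hg, hgm, hgK⟩ := IsWeakDeriv.of_translation hm hK fun h => by
    simp_rw [← mul_sub]
    have := eLpNorm_mul_le_of_bound zero_le_one hb ((hX.comp_add 1).lip h)
    rwa [one_mul] at this
  have hg' : IsWeakDeriv r g := hg.congr_ae e.symm EventuallyEq.rfl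
  refine ⟨⟨hm.ae_eq e.symm, g, hg', hgm⟩, ?_⟩
  have n1 : l2Norm r ≤ K := ENNReal.toReal_le_of_le_ofReal hK
    ((eLpNorm_congr_ae e).trans_le b)
  have n2 : l2Norm (weakDeriv r) ≤ K := ENNReal.toReal_le_of_le_ofReal hK
    ((eLpNorm_congr_ae (weakDeriv_ae_eq hg')).trans_le hgK)
  have p1 : 0 ≤ l2Norm r := ENNReal.toReal_nonneg
  have p2 : 0 ≤ l2Norm (weakDeriv r) := ENNReal.toReal_nonneg
  exact Real.sqrt_le_iff.2 ⟨by positivity, by nlinarith⟩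

theorem memL21_of_eq (hK : 0 ≤ K) (hκ : ‖κ‖ ≤ 1) (hr : ∀ z ≠ 0, r z = κ * X (z + 1))
    (hc : Continuous X) (h2 : eLpNorm X 2 volume ≤ ENNReal.ofReal K)
    (hw : eLpNorm (fun l : ℝ => (l : ℂ) * X l) 2 volume ≤ ENNReal.ofReal K) :
    MemL21 r ∧ l21Norm r ≤ 3 * K := by
  have e := weighted_congr_ae (ae_eq_of_ne_zero hr)
  have hcw : Continuous fun l : ℝ => (l : ℂ) * X l := by fun_prop
  have hc1 : Continuous fun z => X (z + 1) := hc.comp (by fun_prop)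
  have b : eLpNorm (weighted r) 2 volume ≤ ENNReal.ofReal (3 * K) := by
    rw [eLpNorm_congr_ae e]
    have i1 : eLpNorm (fun l => ((2 : ℝ) : ℂ) * X l) 2 volume ≤ ENNReal.ofReal (2 * K) :=
      eLpNorm_mul_le_of_bound two_pos.le (fun _ => by simp) h2
    -- The weight at z is dominated by 2 + |z + 1|, so the sum of the moduli of 2X and lX at l = z +
    -- 1 is a pointwise majorant, of norm at most 3K.
    have i2 : eLpNorm (fun l => ((‖((2 : ℝ) : ℂ) * X l‖ + ‖(l : ℂ) * X l‖ : ℝ) : ℂ)) 2 volume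
        ≤ ENNReal.ofReal (2 * K + K) := by
      simp_rw [Complex.ofReal_add]
      refine eLpNorm_add_le_ofReal (by positivity) hK (by fun_prop) (by fun_prop) ?_ ?_
      · refine (le_of_eq (eLpNorm_congr_norm_ae (Eventually.of_forall fun l => ?_))).trans i1
        rw [Complex.norm_real, norm_norm]
      · refine (le_of_eq (eLpNorm_congr_norm_ae (Eventually.of_forall fun l => ?_))).trans hw
        rw [Complex.norm_real, norm_norm]
    have i3 := (eLpNorm_comp_add_one (X := fun l =>
      ((‖((2 : ℝ) : ℂ) * X l‖ + ‖(l : ℂ) * X l‖ : ℝ) : ℂ))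
      (Continuous.aestronglyMeasurable (by fun_prop))).trans_le i2
    refine (eLpNorm_mono fun z => ?_).trans (i3.trans_eq (by ring_nf))
    rw [weighted, norm_mul, norm_mul, Complex.norm_real, Complex.norm_real, norm_mul, norm_mul,
      Complex.norm_real, Complex.norm_real, ← add_mul, Real.norm_of_nonneg (by positivity),
      Real.norm_of_nonneg (by positivity), Real.norm_of_nonneg two_pos.le, Real.norm_eq_abs]
    have s : Real.sqrt (1 + z ^ 2) ≤ 2 + |z + 1| := by
      refine Real.sqrt_le_iff.2 ⟨by positivity, ?_⟩
      rcases abs_cases (z + 1) with ⟨h, h'⟩ | ⟨h, h'⟩ <;> rw [h] <;> nlinarith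
    calc Real.sqrt (1 + z ^ 2) * (‖κ‖ * ‖X (z + 1)‖)
        ≤ (2 + |z + 1|) * (1 * ‖X (z + 1)‖) := by gcongr
      _ = _ := by rw [one_mul]
  exact memL21_of_eLpNorm_le (by positivity) (((hc1.const_mul κ).aestronglyMeasurable).congr
    (ae_eq_of_ne_zero hr).symm) b

end

/-! ### The direct scattering map -/

theorem reflectionNorm_le_of_pairs {r s X X' : ℝ → ℂ} {κ : ℂ} {K η : ℝ} (hK : 0 ≤ K) (hη : 0 ≤ η)
    (hκ : ‖κ‖ ≤ 1) (hr : ∀ z ≠ 0, r z = κ * X (z + 1)) (hs : ∀ z ≠ 0, s z = κ * X' (z + 1))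
    (hb : HBPair X X' K η) (h2 : L2Pair X X' K η)
    (hw : L2Pair (fun l => l * X l) (fun l => l * X' l) K η) :
    reflectionNorm (r - s) ≤ 5 * (K * η) := by
  have hKη : 0 ≤ K * η := mul_nonneg hK hη
  have e : ∀ z ≠ 0, (r - s) z = κ * (fun l => X l - X' l) (z + 1) := fun z hz => by
    rw [Pi.sub_apply, hr z hz, hs z hz, mul_sub]
  have h1 := (memH1_of_eq hKη hκ e hb.sub h2.sub_le).2
  have hw' := hw.sub_le
  simp_rw [← mul_sub] at hw'
  have h3 := (memL21_of_eq hKη hκ e hb.sub.cont h2.sub_le hw').2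
  rw [reflectionNorm]
  linarith

section

variable {u v U U₁ U₂ V V₁ V₂ : ℝ → ℂ}

theorem rMinus_eq_one_mul (h : u =ᵐ[volume] U) (hU : IsPotential U U₁) :
    ∀ z ≠ 0, rMinus u z = 1 * scatQuot (lowF U) (lowG U U₁) (z + 1) := fun z hz => by
  rw [rMinus_eq h hU hz, one_mul]

theorem norm_half_le : ‖(1 / 2 : ℂ)‖ ≤ 1 := by simp; norm_num

/-- All bounds but one hold for pairs in H^{1,1}. Only the weighted bound for the first system asks
for second derivatives. -/
theorem exists_low_const {N c : ℝ} (hN : 0 ≤ N) (hc : 0 < c) : ∃ C : ℝ, 0 ≤ C ∧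
    ∀ {U U₁ V V₁ : ℝ → ℂ} {η : ℝ}, PotentialPair N η U U₁ V V₁ → 0 ≤ η →
      (∀ l, c ≤ ‖scatDiag (lowF U) (lowG U U₁) l‖) →
      (∀ l, c ≤ ‖scatDiag (lowF V) (lowG V V₁) l‖) →
      (HBPair (scatQuot (lowF U) (lowG U U₁)) (scatQuot (lowF V) (lowG V V₁)) C
        (derivConst N * η) ∧
      L2Pair (scatQuot (lowF U) (lowG U U₁)) (scatQuot (lowF V) (lowG V V₁)) C
        (derivConst N * η)) ∧
      (HBPair (scatQuot (upF U U₁) (upG U)) (scatQuot (upF V V₁) (upG V)) C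
        (derivConst N * η) ∧
      L2Pair (scatQuot (upF U U₁) (upG U)) (scatQuot (upF V V₁) (upG V)) C
        (derivConst N * η) ∧
      L2Pair (fun l => l * scatQuot (upF U U₁) (upG U) l)
        (fun l => l * scatQuot (upF V V₁) (upG V) l) C (derivConst N * η)) ∧
      ∀ {U₂ V₂ : ℝ → ℂ}, SmoothPair N η U U₁ U₂ V V₁ V₂ →
        L2Pair (fun l => l * scatQuot (lowF U) (lowG U U₁) l)
          (fun l => l * scatQuot (lowF V) (lowG V V₁) l) C (derivConst N * η) := by
  obtain ⟨C, hC, h⟩ := exists_scatQuot_const (derivConst_nonneg hN) hc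
  refine ⟨C, hC, fun {U U₁ V V₁ η} hp hη hU hV => ?_⟩
  obtain ⟨a1, a2, a3⟩ := h (hp.closePairs_lower hη) hU hV
  rw [scatDiag_lower_eq_upper hp.fst] at hU
  rw [scatDiag_lower_eq_upper hp.snd] at hV
  obtain ⟨b1, b2, b3⟩ := h (hp.closePairs_upper hη) hU hV
  obtain ⟨g₁, g₁', d1, d2, d3⟩ := hp.diffPair_upper hη
  refine ⟨⟨a1, a2⟩, ⟨b1, b2, b3 d1 d2 d3⟩, fun {U₂ V₂} hs => ?_⟩
  obtain ⟨k₁, k₁', e1, e2, e3⟩ := hs.diffPair_lower hη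
  exact a3 e1 e2 e3

theorem exists_lipschitz_const {N c : ℝ} (hN : 0 ≤ N) (hc : 0 < c) : ∃ L : ℝ, 0 ≤ L ∧
    ∀ {u v U U₁ U₂ V V₁ V₂ : ℝ → ℂ} {η : ℝ}, SmoothPair N η U U₁ U₂ V V₁ V₂ → 0 ≤ η →
      (∀ l, c ≤ ‖scatDiag (lowF U) (lowG U U₁) l‖) →
      (∀ l, c ≤ ‖scatDiag (lowF V) (lowG V V₁) l‖) → u =ᵐ[volume] U → v =ᵐ[volume] V →
      reflectionNorm (rMinus u - rMinus v) + reflectionNorm (rPlus u - rPlus v) ≤ L * η := by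
  obtain ⟨C, hC, h⟩ := exists_low_const hN hc
  have hD := derivConst_nonneg hN
  refine ⟨10 * (C * derivConst N), by positivity,
    fun {u v U U₁ U₂ V V₁ V₂ η} hs hη hU hV hu hv => ?_⟩
  obtain ⟨⟨a1, a2⟩, ⟨b1, b2, b3⟩, a3⟩ := h hs.toPotentialPair hη hU hV
  have hη' : 0 ≤ derivConst N * η := by positivity
  have r1 := reflectionNorm_le_of_pairs hC hη' norm_one.le (rMinus_eq_one_mul hu hs.fst)
    (rMinus_eq_one_mul hv hs.snd) a1 a2 (a3 hs)
  have r2 := reflectionNorm_le_of_pairs hC hη' norm_half_le (fun z hz => rPlus_eq hu hs.fst hz)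
    (fun z hz => rPlus_eq hv hs.snd hz) b1 b2 b3
  linarith

/-- Membership is obtained from the Lipschitz estimates by comparing the potential with itself. -/
theorem memH1_of_scatDiag_ge {c : ℝ} (hc : 0 < c) (hU : IsPotential U U₁)
    (h : ∀ l, c ≤ ‖scatDiag (lowF U) (lowG U U₁) l‖) (hu : u =ᵐ[volume] U) :
    MemH1 (rPlus u) ∧ MemH1 (rMinus u) := by
  have hp := hU.potentialPair_self
  obtain ⟨C, hC, k⟩ := exists_low_const hp.nonneg hc
  obtain ⟨⟨a1, a2⟩, ⟨b1, b2, -⟩, -⟩ := k hp le_rfl h h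
  exact ⟨(memH1_of_eq hC norm_half_le (fun z hz => rPlus_eq hu hU hz) b1.hb b2.le).1,
    (memH1_of_eq hC norm_one.le (rMinus_eq_one_mul hu hU) a1.hb a2.le).1⟩

theorem memL21_of_scatDiag_ge {N c η : ℝ} (hc : 0 < c) (hs : SmoothPair N η U U₁ U₂ U U₁ U₂)
    (hη : 0 ≤ η)
    (h : ∀ l, c ≤ ‖scatDiag (lowF U) (lowG U U₁) l‖) (hu : u =ᵐ[volume] U) :
    MemL21 (rPlus u) ∧ MemL21 (rMinus u) := by
  obtain ⟨C, hC, k⟩ := exists_low_const hs.nonneg hc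
  obtain ⟨⟨a1, a2⟩, ⟨b1, b2, b3⟩, a3⟩ := k hs.toPotentialPair hη h h
  exact ⟨(memL21_of_eq hC norm_half_le (fun z hz => rPlus_eq hu hs.fst hz) b1.hb.cont b2.le
      b3.le).1,
    (memL21_of_eq hC norm_one.le (rMinus_eq_one_mul hu hs.fst) a1.hb.cont a2.le (a3 hs).le).1⟩

/-- The coefficients of the first system are u/2 and the conjugate of w, so the factor 1/2 and the
Frobenius norm of the smallness condition are exactly those of the bound for a. -/
theorem NLSGI.IsSmall.integral_mul_exp_lt (h : IsSmall u) (hu : u =ᵐ[volume] U)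
    (hu₁ : weakDeriv u =ᵐ[volume] U₁) :
    (∫ y, ‖lowF U y‖) * Real.exp (∫ y, coeffNorm (lowF U) (lowG U U₁) y) < 1 := by
  have e1 : ∫ y, ‖lowF U y‖ = 1 / 2 * ∫ y, ‖u y‖ := by
    rw [← integral_const_mul]
    refine integral_congr_ae (hu.mono fun y hy => ?_)
    simp only [lowF, hy, norm_div, Complex.norm_ofNat]
    ring
  have e2 : ∫ y, coeffNorm (lowF U) (lowG U U₁) y = coeffL1Norm u := by
    refine integral_congr_ae ?_
    filter_upwards [hu, hu₁] with y h1 h2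
    simp only [coeffNorm, lowF, lowG, RCLike.norm_conj, wFun, gaugeW, h1, h2, ofReal_norm_sq]
  rw [e1, e2]
  have := h
  rw [IsSmall] at this
  linarith

theorem scatA_ne_zero_of_isSmall (h : MemH11 u) (hs : IsSmall u) (k : ℝ) : scatA u k ≠ 0 := by
  obtain ⟨U, hu, hU⟩ := h.exists_isPotential
  rw [scatA_congr_ae hu, ← norm_pos_iff]
  have hk : (k : ℂ) ^ 2 = ((k ^ 2 : ℝ) : ℂ) := by push_cast; ring
  -- The parameter k = 0 is excluded from the gauge transformations, but it also counts as
  -- imaginary, where |a| ≥ 1.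
  by_cases hk0 : k = 0
  · exact one_pos.trans_le (one_le_norm_scatA hU hk (by simp [hk0]))
  · rw [(scattering_lower hU hk (by exact_mod_cast hk0)).1]
    obtain ⟨B, hB⟩ := exists_bddPair hU.memL21_lowF hU.memL21_lowG
    exact (by positivity : 0 < Real.exp (-(4 * B)) / 2).trans_le
      (norm_scatDiag_ge_of_bdd hB (hs.integral_mul_exp_lt hu EventuallyEq.rfl) _)

theorem exists_lipschitz_const_potentialNorm {N c : ℝ} (hN : 0 < N) (hc : 0 < c) : ∃ L : ℝ,
    ∀ {u v U U₁ V V₁ : ℝ → ℂ}, MemH2 u → MemH2 v → IsSmoothRep u U U₁ → IsSmoothRep v V V₁ →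
      potentialNorm u ≤ N → potentialNorm v ≤ N →
      (∀ l, c ≤ ‖scatDiag (lowF U) (lowG U U₁) l‖) →
      (∀ l, c ≤ ‖scatDiag (lowF V) (lowG V V₁) l‖) →
      reflectionNorm (rMinus u - rMinus v) + reflectionNorm (rPlus u - rPlus v)
        ≤ L * potentialNorm (u - v) := by
  obtain ⟨L, -, h⟩ := exists_lipschitz_const hN.le hc
  refine ⟨L / N, fun {u v U U₁ V V₁} hu hv hU hV nu nv lu lv => ?_⟩
  have := h (hU.smoothPair hu hv hV hN nu nv)
    (div_nonneg (potentialNorm_nonneg _) hN.le) lu lv hU.ae_eq hV.ae_eq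
  rwa [← mul_comm_div] at this

end

theorem lemma5 :
    -- potentials in `H^{1,1}`
    (∀ u : ℝ → ℂ, MemH11 u → (∀ k : ℝ, scatA u k ≠ 0) →
      MemH1 (rPlus u) ∧ MemH1 (rMinus u)) ∧
    -- potentials in `H² ∩ H^{1,1}`
    (∀ u : ℝ → ℂ, MemH2 u → MemH11 u → (∀ k : ℝ, scatA u k ≠ 0) →
      MemL21 (rPlus u) ∧ MemL21 (rMinus u)) ∧
    -- Lipschitz continuity on bounded sets on which `a` is bounded away from zero
    (∀ B c : ℝ, 0 < c → ∃ L : ℝ, ∀ u v : ℝ → ℂ,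
      MemH2 u → MemH11 u → MemH2 v → MemH11 v →
      potentialNorm u ≤ B → potentialNorm v ≤ B →
      (∀ k : ℝ, c ≤ ‖scatA u k‖) → (∀ k : ℝ, c ≤ ‖scatA v k‖) →
      reflectionNorm (rMinus u - rMinus v) + reflectionNorm (rPlus u - rPlus v)
        ≤ L * potentialNorm (u - v)) ∧
    -- under the smallness condition `a` has no zeros, and
    -- the Lipschitz constant depends on the bound `B` only
    (∀ u : ℝ → ℂ, MemH11 u → IsSmall u → ∀ k : ℝ, scatA u k ≠ 0) ∧
    (∀ B : ℝ, ∃ L : ℝ, ∀ u v : ℝ → ℂ,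
      MemH2 u → MemH11 u → MemH2 v → MemH11 v →
      potentialNorm u ≤ B → potentialNorm v ≤ B →
      IsSmall u → IsSmall v →
      reflectionNorm (rMinus u - rMinus v) + reflectionNorm (rPlus u - rPlus v)
        ≤ L * potentialNorm (u - v)) := by
  refine ⟨fun u hu ha => ?_, fun u hu hu' ha => ?_, fun B c hc => ?_,
    fun u hu hs k => scatA_ne_zero_of_isSmall hu hs k, fun B => ?_⟩
  · obtain ⟨U, e, hU⟩ := hu.exists_isPotential
    obtain ⟨c, hc, h⟩ := exists_scatDiag_ge hU fun k => by rw [← scatA_congr_ae e]; exact ha k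
    exact memH1_of_scatDiag_ge hc hU h e
  · obtain ⟨U, U₁, hU⟩ := exists_isSmoothRep hu hu'
    obtain ⟨c, hc, h⟩ := exists_scatDiag_ge hU.isPotential fun k => by
      rw [← scatA_congr_ae hU.ae_eq]; exact ha k
    have hN : 0 < potentialNorm u + 1 := by linarith [potentialNorm_nonneg u]
    have hs := hU.smoothPair hu hu hU hN (by linarith) (by linarith)
    exact memL21_of_scatDiag_ge hc hs (div_nonneg (potentialNorm_nonneg _) hN.le) h hU.ae_eq
  -- Since B may be zero or negative, it is replaced by a positive bound.
  · have hN : 0 < max B 1 := lt_max_of_lt_right one_pos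
    have hc' : 0 < min c 1 := lt_min hc one_pos
    obtain ⟨L, h⟩ := exists_lipschitz_const_potentialNorm hN hc'
    refine ⟨L, fun u v hu hu' hv hv' nu nv au av => ?_⟩
    obtain ⟨U, U₁, hU⟩ := exists_isSmoothRep hu hu'
    obtain ⟨V, V₁, hV⟩ := exists_isSmoothRep hv hv'
    refine h hu hv hU hV (nu.trans (le_max_left _ _)) (nv.trans (le_max_left _ _))
      (min_le_norm_scatDiag hU.isPotential fun k => ?_)
      (min_le_norm_scatDiag hV.isPotential fun k => ?_)
    · rw [← scatA_congr_ae hU.ae_eq]; exact au k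
    · rw [← scatA_congr_ae hV.ae_eq]; exact av k
  · have hN : 0 < max B 1 := lt_max_of_lt_right one_pos
    -- The lower bound for a is computed from the bound `derivConst (max B 1)` on the L^{2,1} norms
    -- of the coefficients alone, so the Lipschitz constant depends on B only.
    obtain ⟨L, h⟩ := exists_lipschitz_const_potentialNorm hN
      (show 0 < Real.exp (-(4 * derivConst (max B 1))) / 2 by positivity)
    refine ⟨L, fun u v hu hu' hv hv' nu nv su sv => ?_⟩
    obtain ⟨U, U₁, hU⟩ := exists_isSmoothRep hu hu'
    obtain ⟨V, V₁, hV⟩ := exists_isSmoothRep hv hv'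
    have nu' := nu.trans (le_max_left B 1)
    have nv' := nv.trans (le_max_left B 1)
    have hc := (hU.smoothPair hu hv hV hN nu' nv').closePairs_lower
      (div_nonneg (potentialNorm_nonneg _) hN.le)
    exact h hu hv hU hV nu' nv'
      (norm_scatDiag_ge_of_bdd hc.fst (su.integral_mul_exp_lt hU.ae_eq hU.ae_eq₁))
      (norm_scatDiag_ge_of_bdd hc.snd (sv.integral_mul_exp_lt hV.ae_eq hV.ae_eq₁))
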